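/- **Setting.** A quasi-Banach space is a complete quasi-normed real vector space; it is called $r$-normable, $0<r\le 1$, if $\|\sum_{j=1}^n x_j\|^r\le\sum_{j=1}^n\|x_j\|^r$ for all finite sequences in $X$. An $X$-valued random variable is a Borel map with separable range. Let $(\Omega,\mathcal A,(\mathcal F_n)_{n\ge1},\mathbb P)$ be a complete probability space with a filtration, $\mathcal F_0=\{\emptyset,\Omega\}$ and $\mathcal F_\infty=\sigma(\mathcal F_n:n\ge1)$, and let $f=(f_n)_{n\ge1}$ be an $X$-valued $(\mathcal F_n)$-adapted sequence with differences $d_n=f_n-f_{n-1}$, $f_0=0$. A *decoupled sum sequence* of $f$ is a sequence $g=(g_n)_{n\ge1}$ of $X$-valued random variables on $(\Omega,\mathcal A,\mathbb P)$ whose differences $e_n=g_n-g_{n-1}$, $g_0=0$, satisfy $\mathbb P(d_n\in B\mid\mathcal F_{n-1})=\mathbb P(e_n\in B\mid\mathcal F_\infty)$ a.s. for all $n\ge1$ and Borel $B\subseteq X$, and are conditionally independent given $\mathcal F_\infty$. For $p\in(0,\infty)$ the *decoupling inequality holds in $X$ for $p$* if there is a constant $D\ge0$ such that $\|f_n\|_{L^p(\Omega;X)}\le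 D\|g_n\|_{L^p(\Omega;X)}$, $n\ge1$, for all such probability spaces, all adapted sequences $f$ in $L^p(\Omega;X)$ and all decoupled sum sequences $g$ of $f$; the least such $D$ is denoted by $D_p(X)$. Put $f_n^*=\max_{1\le j\le n}\|f_j\|$, $g_n^*=\max_{1\le j\le n}\|g_j\|$. For $q\in(0,\infty)$ let $F_q$ be the set of continuous non-decreasing $\Phi:[0,\infty)\to[0,\infty)$ with $\Phi(0)=0$ and $\Phi(st)\le s^q\Phi(t)$ for all $s\ge1$, $t\ge0$. **Theorem.** Let $X$ be an $r$-normable quasi-Banach space in which the decoupling inequality holds for some $p\in(0,\infty)$. Then for every $q\in(0,\infty)$ there is a constant $K=K_{X,r,p,q}$ such that for all $\Phi\in F_q$, all complete probability spaces with a filtration, all $X$-valued adapted sequences $f$ and all decoupled sum sequences $g$ of $f$, $$\mathbb E\,\Phi(\|f_n\|)\le K\,\mathbb E\,\Phi(\|g_n\|)\quad\text{and}\quad \mathbb E\,\Phi(f_n^*)\le K\,\mathbb E\,\Phi(g_n^*),\qquad n\ge1, \tag{1}$$ where the left-hand sides are finite whenever the right-hand sides are. In particular, the decoupling inequality holds in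 $X$ for every $q\in(0,\infty)$. If moreover $X$ is a Banach space and $p\ge1$, then for every $q\in(0,\infty)$ the inequalities (1) hold for all $\Phi\in F_q$ with $$K=e^{q}\,2^{\frac{3q}{p}+p+7q+7}\,D_p(X)^q\left(\tfrac qp\right)^q,$$ and in particular $$D_q(X)\le e\,2^{\frac3p+\frac pq+7+\frac7q}\,D_p(X)\,\tfrac qp .$$ -/

import Mathlib

open MeasureTheory ProbabilityTheory
open scoped NNReal ENNReal Uniformity

/-- A (real) quasi-Banach space: a real vector space with a quasi-norm `qnorm`, whose uniform
structure (hence topology) is the one given by the quasi-norm, and which is complete.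
A complex space is covered by restriction of scalars. -/
class QuasiBanachSpace (X : Type*) [AddCommGroup X] [Module ℝ X] [UniformSpace X] where
  qnorm : X → ℝ≥0
  qnorm_eq_zero_iff : ∀ x : X, qnorm x = 0 ↔ x = 0
  qnorm_smul : ∀ (c : ℝ) (x : X), qnorm (c • x) = ‖c‖₊ * qnorm x
  exists_quasi_triangle :
    ∃ C : ℝ≥0, ∀ x y : X, qnorm (x + y) ≤ C * (qnorm x + qnorm y)
  uniformity_basis :
    (𝓤 X).HasBasis (fun ε : ℝ≥0 => 0 < ε) (fun ε => {z : X × X | qnorm (z.1 - z.2) < ε})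
  complete : CompleteSpace X

namespace Decoupling

/-- The quasi-norm of a quasi-Banach space. -/
abbrev qn {X : Type*} [AddCommGroup X] [Module ℝ X] [UniformSpace X] [QuasiBanachSpace X]
    (x : X) : ℝ≥0 :=
  QuasiBanachSpace.qnorm x

/-- `X` is `r`-normable, `0 < r ≤ 1` (with constant `1`). -/
def IsRNormable (X : Type*) [AddCommGroup X] [Module ℝ X] [UniformSpace X]
    [QuasiBanachSpace X] (r : ℝ) : Prop :=
  0 < r ∧ r ≤ 1 ∧ ∀ (n : ℕ) (x : Fin n → X), qn (∑ j, x j) ^ r ≤ ∑ j, qn (x j) ^ r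

/-- `X` is a Banach space, i.e. its quasi-norm satisfies the triangle inequality. -/
def IsBanach (X : Type*) [AddCommGroup X] [Module ℝ X] [UniformSpace X]
    [QuasiBanachSpace X] : Prop :=
  ∀ x y : X, qn (x + y) ≤ qn x + qn y

/-- The difference sequence `(f n - f (n-1))_{n ≥ 1}`. Sequences are indexed by `ℕ`, their terms
of index `≥ 1` matter, and `f 0 = 0` is imposed separately. -/
def diffSeq {Ω X : Type*} [AddCommGroup X] (f : ℕ → Ω → X) (n : ℕ) (ω : Ω) : X :=
  f n ω - f (n - 1) ω

/-- The maximal function `f_n^* = max_{1 ≤ j ≤ n} ‖f_j‖`. -/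
def maxFn {Ω X : Type*} [AddCommGroup X] [Module ℝ X] [UniformSpace X] [QuasiBanachSpace X]
    (f : ℕ → Ω → X) (n : ℕ) (ω : Ω) : ℝ≥0 :=
  (Finset.Icc 1 n).sup (fun j => qn (f j ω))

/-- `(e n)_{n ≥ 1}` is an `ℱ_∞`-decoupled tangent sequence of `(d n)_{n ≥ 1}`, where
`ℱ_∞ = ⨆ k, ℱ k`. An `X`-valued random variable is a Borel map with separable range, which is
`StronglyMeasurable`. -/
structure IsDecoupledTangent {Ω X : Type*} [TopologicalSpace X] [MeasurableSpace X]
    {mΩ : MeasurableSpace Ω} (μ : Measure Ω) (ℱ : Filtration ℕ mΩ) (d e : ℕ → Ω → X) :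
    Prop where
  stronglyMeasurable : ∀ n, 1 ≤ n → StronglyMeasurable (e n)
  tangent : ∀ n, 1 ≤ n → ∀ B : Set X, MeasurableSet B →
    μ⟦d n ⁻¹' B | ℱ (n - 1)⟧ =ᵐ[μ] μ⟦e n ⁻¹' B | ⨆ k, ℱ k⟧
  condIndep : ∀ n, 1 ≤ n → ∀ B : ℕ → Set X, (∀ k, MeasurableSet (B k)) →
    μ⟦⋂ k ∈ Finset.Icc 1 n, e k ⁻¹' B k | ⨆ k, ℱ k⟧ =ᵐ[μ]
      fun ω => ∏ k ∈ Finset.Icc 1 n, (μ⟦e k ⁻¹' B k | ⨆ k, ℱ k⟧) ω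

/-- The filtration `(ℱ n)_{n ≥ 1}` is extended by the trivial `σ`-algebra `ℱ 0`, the sequence
`f` is `ℱ`-adapted with `f 0 = 0`, and `g` is an `ℱ_∞`-decoupled sum sequence of `f`. -/
structure IsDecoupledSum {Ω X : Type*} [AddCommGroup X] [TopologicalSpace X]
    [MeasurableSpace X] {mΩ : MeasurableSpace Ω} (μ : Measure Ω) (ℱ : Filtration ℕ mΩ)
    (f g : ℕ → Ω → X) : Prop where
  filtration_zero : ℱ 0 = ⊥
  adapted : StronglyAdapted ℱ f
  f_zero : f 0 = 0
  g_zero : g 0 = 0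
  tangent : IsDecoupledTangent μ ℱ (diffSeq f) (diffSeq g)

/-- The decoupling inequality `‖f_n‖_p ≤ D ‖g_n‖_p` for all complete probability spaces, all
adapted `L^p`-sequences `f` and all decoupled sum sequences `g` of `f`. -/
def DecouplingWith.{u, v} (X : Type v) [AddCommGroup X] [Module ℝ X] [UniformSpace X]
    [QuasiBanachSpace X] [MeasurableSpace X] (p D : ℝ) : Prop :=
  ∀ (Ω : Type u) (mΩ : MeasurableSpace Ω) (μ : Measure Ω) [IsProbabilityMeasure μ]
    [μ.IsComplete] (ℱ : Filtration ℕ mΩ) (f g : ℕ → Ω → X),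
    IsDecoupledSum μ ℱ f g →
    (∀ n, 1 ≤ n → MemLp (fun ω => (qn (f n ω) : ℝ)) (ENNReal.ofReal p) μ) →
    ∀ n, 1 ≤ n →
      eLpNorm (fun ω => (qn (f n ω) : ℝ)) (ENNReal.ofReal p) μ ≤
        ENNReal.ofReal D * eLpNorm (fun ω => (qn (g n ω) : ℝ)) (ENNReal.ofReal p) μ

/-- The decoupling inequality holds in `X` for `p`. -/
def DecouplingHolds.{u, v} (X : Type v) [AddCommGroup X] [Module ℝ X] [UniformSpace X]
    [QuasiBanachSpace X] [MeasurableSpace X] (p : ℝ) : Prop :=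
  ∃ D : ℝ, DecouplingWith.{u, v} X p D

/-- The least constant `D_p(X)` in the decoupling inequality. -/
noncomputable def decouplingConst.{u, v} (X : Type v) [AddCommGroup X] [Module ℝ X]
    [UniformSpace X] [QuasiBanachSpace X] [MeasurableSpace X] (p : ℝ) : ℝ :=
  sInf {D : ℝ | 0 ≤ D ∧ DecouplingWith.{u, v} X p D}

/-- Continuous non-decreasing `Φ : [0,∞) → [0,∞)` with `Φ 0 = 0` and `Φ (s t) ≤ s ^ q Φ t` for
`s ≥ 1`, `t ≥ 0`. (Demanding this for `s < 1` too would leave only `Φ t = c t ^ q`.) -/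
structure IsGrowthFunction (q : ℝ) (Φ : ℝ≥0 → ℝ≥0) : Prop where
  continuous : Continuous Φ
  monotone : Monotone Φ
  map_zero : Φ 0 = 0
  growth : ∀ s t : ℝ≥0, 1 ≤ s → Φ (s * t) ≤ s ^ q * Φ t

/-- `E Φ(‖f_n‖) ≤ K E Φ(‖g_n‖)` and `E Φ(f_n^*) ≤ K E Φ(g_n^*)` for all complete probability
spaces, all adapted `f`, all decoupled sum sequences `g` of `f` and all `n ≥ 1`. The expectations
take values in `[0,∞]`, so the left-hand sides are finite if the right-hand sides are. -/
def PhiDecouplingWith.{u, v} (X : Type v) [AddCommGroup X] [Module ℝ X] [UniformSpace X]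
    [QuasiBanachSpace X] [MeasurableSpace X] (Φ : ℝ≥0 → ℝ≥0) (K : ℝ) : Prop :=
  ∀ (Ω : Type u) (mΩ : MeasurableSpace Ω) (μ : Measure Ω) [IsProbabilityMeasure μ]
    [μ.IsComplete] (ℱ : Filtration ℕ mΩ) (f g : ℕ → Ω → X),
    IsDecoupledSum μ ℱ f g →
    ∀ n, 1 ≤ n →
      (∫⁻ ω, (Φ (qn (f n ω)) : ℝ≥0∞) ∂μ ≤
        ENNReal.ofReal K * ∫⁻ ω, (Φ (qn (g n ω)) : ℝ≥0∞) ∂μ) ∧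
      (∫⁻ ω, (Φ (maxFn f n ω) : ℝ≥0∞) ∂μ ≤
        ENNReal.ofReal K * ∫⁻ ω, (Φ (maxFn g n ω) : ℝ≥0∞) ∂μ)

end Decoupling

universe u v

set_option linter.unusedSectionVars false

/-! The metric `‖x - y‖ ^ r` turns `X` into a complete normed group, replacing `p`, `q`, `D` by `p /
r`, `q / r`, `D ^ r`. Only the group structure is used afterwards, and the sequences take their
values in a closed separable subgroup. There `exists_isTangentKernel` supplies predictable random
measures `κ n`: given `ℱ (n - 1)` the difference `d n` has law `κ n`, and given `ℱ_∞` the `e n` are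
independent with laws `κ n`. Hence a predictable transform `x ↦ φ n ω x`, applied to `d` and to `e`,
gives another decoupled pair on the same filtered space.

The core is the good-λ inequality `measure_exceedSet_le`. With `m = δ l`, keep only the differences
between the passages of `f` above `l` and above `β l`, truncate them at `2 m`, and stop as soon as
the conditional probability of `g^* > m` exceeds a small `θ`; this probability is predictable. The
transformed pair is bounded, so the assumed inequality for `p` applies. Given `ℱ_∞`, the transformed
decoupled sum is a block of independent bounded variables, whose `p`-th moment is at most a multiple
of `m ^ p` by a Hoffmann-Jørgensen argument. Outside the exceptional events, `f^* > β l` forces the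
transformed sum of `f` to be at least `(β - 1) l / 2`, and Chebyshev's inequality applies. The
exceptional events, a jump of `f` above `2 m` or a conditional probability above `θ`, are controlled
by `P(g^* > m)`. Integrating against `Φ` gives the inequality for maximal functions for every `q`.

For `‖f_n‖` against `‖g_n‖`, subtract from both sequences a predictable `c` with `c_n = 0`, where
`c_k` is nearly a center of the conditional law of `g_k`. This leaves `f_n` and `g_n` unchanged, and
by an Ottaviani type inequality the maximal function of the recentered `g` has tails controlled by
those of `‖g_n‖` (`exists_recentered`). The good-λ inequality for the new pair then bounds `‖f_n‖`.
The explicit constant comes from the choice of `β` and `δ` in `levelRatio` and `decoupledRatio`. -/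

namespace Decoupling

/-! ### Random measures and disintegration. -/

section Kernels

variable {α β Ω : Type*} [mα : MeasurableSpace α] [mβ : MeasurableSpace β]

theorem measurable_infinitePi {E : Type*} [MeasurableSpace E] (κ : ℕ → α → Measure E)
    [∀ n a, IsProbabilityMeasure (κ n a)] (hκ : ∀ n, Measurable (κ n)) :
    Measurable fun a => Measure.infinitePi fun n => κ n a := by
  refine .measure_of_isPiSystem_of_isProbabilityMeasure generateFrom_squareCylinders.symm
    (isPiSystem_squareCylinders (fun _ => MeasurableSpace.isPiSystem_measurableSet) (by simp)) ?_
  rintro _ ⟨s, t, ht, rfl⟩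
  simp only [Set.mem_pi, Set.mem_univ, forall_const, Set.mem_ofPred_eq] at ht
  simp_rw [Measure.infinitePi_pi _ (fun i _ => ht i)]
  exact Finset.measurable_prod _ fun i _ => (Measure.measurable_coe (ht i)).comp (hκ i)

theorem measurable_lintegral_of_measurable_measure {κ : α → Measure β}
    [∀ a, IsProbabilityMeasure (κ a)] (hκ : Measurable κ) {h : α → β → ℝ≥0∞}
    (hh : Measurable (Function.uncurry h)) : Measurable fun a => ∫⁻ x, h a x ∂κ a := by
  let k : Kernel α β := ⟨κ, hκ⟩
  have : IsMarkovKernel k := ⟨fun a => inferInstanceAs (IsProbabilityMeasure (κ a))⟩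
  exact hh.lintegral_kernel_prod_right (κ := k)

/-- Disintegration formula for the joint law of `(T, Y)`, from its values on rectangles. -/
theorem lintegral_disintegration {mΩ : MeasurableSpace Ω} {μ : Measure Ω} [IsProbabilityMeasure μ]
    {T : Ω → α} {Y : Ω → β} (hT : Measurable T) (hY : Measurable Y)
    {κ : α → Measure β} [∀ a, IsProbabilityMeasure (κ a)] (hκ : Measurable κ)
    (hrect : ∀ A B, MeasurableSet A → MeasurableSet B →
      μ (T ⁻¹' A ∩ Y ⁻¹' B) = ∫⁻ ω in T ⁻¹' A, κ (T ω) B ∂μ)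
    {h : α → β → ℝ≥0∞} (hh : Measurable (Function.uncurry h)) :
    ∫⁻ ω, h (T ω) (Y ω) ∂μ = ∫⁻ ω, ∫⁻ x, h (T ω) x ∂κ (T ω) ∂μ := by
  let k : Kernel α β := ⟨κ, hκ⟩
  have hk : IsMarkovKernel k := ⟨fun a => inferInstanceAs (IsProbabilityMeasure (κ a))⟩
  have hprob : IsProbabilityMeasure (μ.map T) := Measure.isProbabilityMeasure_map hT.aemeasurable
  have hTY : Measurable fun ω => (T ω, Y ω) := hT.prodMk hY
  have key : μ.map (fun ω => (T ω, Y ω)) = (μ.map T) ⊗ₘ k := by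
    have : IsProbabilityMeasure (μ.map fun ω => (T ω, Y ω)) :=
      Measure.isProbabilityMeasure_map hTY.aemeasurable
    refine Measure.ext_prod fun {A B} hA hB => ?_
    rw [Measure.map_apply hTY (hA.prod hB), Measure.compProd_apply_prod hA hB,
      setLIntegral_map hA (k.measurable_coe hB) hT]
    exact hrect A B hA hB
  calc ∫⁻ ω, h (T ω) (Y ω) ∂μ
      = ∫⁻ z, Function.uncurry h z ∂(μ.map fun ω => (T ω, Y ω)) := by
        rw [lintegral_map hh hTY]; rfl
    _ = ∫⁻ ω, ∫⁻ x, h (T ω) x ∂κ (T ω) ∂μ := by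
        rw [key, Measure.lintegral_compProd hh]
        exact lintegral_map (measurable_lintegral_of_measurable_measure (κ := κ) hκ hh) hT

end Kernels

/-! ### Conditional probabilities in integrated form. -/

section CondProb

variable {Ω : Type*} {m mΩ : MeasurableSpace Ω} {μ : Measure Ω} [IsProbabilityMeasure μ]

theorem condProb_ae_eq_of_forall_setLIntegral_eq (hm : m ≤ mΩ) {A : Set Ω} (hA : MeasurableSet A)
    {u : Ω → ℝ≥0∞} (hu : Measurable[m] u) (hu1 : ∀ ω, u ω ≤ 1)
    (h : ∀ S, MeasurableSet[m] S → μ (S ∩ A) = ∫⁻ ω in S, u ω ∂μ) :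
    (fun ω => (u ω).toReal) =ᵐ[μ] μ⟦A | m⟧ := by
  have hbd : ∀ ω, ‖(u ω).toReal‖ ≤ 1 := fun ω => by
    rw [Real.norm_of_nonneg ENNReal.toReal_nonneg]
    exact ENNReal.toReal_le_of_le_ofReal zero_le_one (by simpa using hu1 ω)
  have hint : Integrable (fun ω => (u ω).toReal) μ :=
    Integrable.of_bound (hu.mono hm le_rfl).ennreal_toReal.aestronglyMeasurable 1
      (ae_of_all _ hbd)
  refine ae_eq_condExp_of_forall_setIntegral_eq hm ((integrable_const (1 : ℝ)).indicator hA)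
    (fun S _ _ => hint.integrableOn) (fun S hS _ => ?_)
    hu.ennreal_toReal.stronglyMeasurable.aestronglyMeasurable
  rw [integral_toReal (hu.mono hm le_rfl).aemeasurable
    (ae_of_all _ fun ω => (hu1 ω).trans_lt ENNReal.one_lt_top), ← h S hS,
    setIntegral_indicator hA]
  simp [Measure.real]

theorem setLIntegral_condProb (hm : m ≤ mΩ) {A : Set Ω} (hA : MeasurableSet A)
    {u : Ω → ℝ≥0∞} (hu : AEMeasurable u μ) (hu1 : ∀ ω, u ω ≤ 1)
    (h : (fun ω => (u ω).toReal) =ᵐ[μ] μ⟦A | m⟧) {S : Set Ω} (hS : MeasurableSet[m] S) :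
    μ (S ∩ A) = ∫⁻ ω in S, u ω ∂μ := by
  have h1 : ∫ ω in S, (u ω).toReal ∂μ = ∫ ω in S, A.indicator (fun _ => (1 : ℝ)) ω ∂μ := by
    rw [← setIntegral_condExp hm ((integrable_const (1 : ℝ)).indicator hA) hS]
    exact integral_congr_ae (ae_restrict_of_ae h)
  rw [integral_toReal hu.restrict
    (ae_of_all _ fun ω => (hu1 ω).trans_lt ENNReal.one_lt_top), setIntegral_indicator hA] at h1
  have hfin : ∫⁻ ω in S, u ω ∂μ ≠ ∞ := by
    refine ((lintegral_mono fun ω => hu1 ω).trans_lt ?_).ne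
    simp
  simp only [integral_const, measureReal_restrict_apply_univ, smul_eq_mul, mul_one] at h1
  exact ((ENNReal.toReal_eq_toReal_iff' hfin (measure_ne_top _ _)).1 h1).symm

end CondProb

/-! ### Conditional laws of a decoupled pair. -/

section TangentKernel

variable {Ω E : Type*} {mΩ : MeasurableSpace Ω} [NormedAddCommGroup E] [MeasurableSpace E]

/-- `κ n` is a version of the conditional law of `d n` given `ℱ (n - 1)`, and the product of the
measures `κ n` is a version of the conditional law of `e` given `ℱ_∞`. -/
structure IsTangentKernel (μ : Measure Ω) (ℱ : Filtration ℕ mΩ) (d e : ℕ → Ω → E)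
    (κ : ℕ → Ω → Measure E) [∀ n ω, IsProbabilityMeasure (κ n ω)] : Prop where
  measurable : ∀ n, Measurable[ℱ (n - 1)] (κ n)
  lintegral_left : ∀ n, 1 ≤ n → ∀ h : Ω → E → ℝ≥0∞,
    Measurable[(ℱ (n - 1)).prod inferInstance] (Function.uncurry h) →
    ∫⁻ ω, h ω (d n ω) ∂μ = ∫⁻ ω, ∫⁻ x, h ω x ∂κ n ω ∂μ
  lintegral_right : ∀ h : Ω → (ℕ → E) → ℝ≥0∞,
    Measurable[(⨆ k, ℱ k).prod inferInstance] (Function.uncurry h) →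
    ∫⁻ ω, h ω (fun k => e k ω) ∂μ =
      ∫⁻ ω, ∫⁻ x, h ω x ∂(Measure.infinitePi fun k => κ k ω) ∂μ

theorem iSup_filtration_le (ℱ : Filtration ℕ mΩ) : (⨆ k, ℱ k) ≤ mΩ := iSup_le ℱ.le

theorem filtration_le_iSup (ℱ : Filtration ℕ mΩ) (n : ℕ) : ℱ n ≤ ⨆ k, ℱ k :=
  le_iSup (fun k => (ℱ k : MeasurableSpace Ω)) n

variable [BorelSpace E] [SecondCountableTopology E]
  {μ : Measure Ω} [IsProbabilityMeasure μ] {ℱ : Filtration ℕ mΩ} {f g : ℕ → Ω → E}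

theorem IsDecoupledSum.measurable_left (h : IsDecoupledSum μ ℱ f g) (n : ℕ) :
    Measurable[ℱ n] (f n) := (h.adapted n).measurable

theorem IsDecoupledSum.measurable_diff_left (h : IsDecoupledSum μ ℱ f g) (n : ℕ) :
    Measurable[ℱ n] (diffSeq f n) :=
  (h.measurable_left n).sub ((h.measurable_left (n - 1)).mono (ℱ.mono (Nat.sub_le n 1)) le_rfl)

theorem IsDecoupledSum.diff_right_zero (h : IsDecoupledSum μ ℱ f g) : diffSeq g 0 = 0 := by
  ext ω; simp [diffSeq, h.g_zero]

theorem IsDecoupledSum.measurable_diff_right (h : IsDecoupledSum μ ℱ f g) (n : ℕ) :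
    Measurable (diffSeq g n) := by
  rcases Nat.eq_zero_or_pos n with rfl | hn
  · rw [h.diff_right_zero]; exact measurable_zero
  · exact (h.tangent.stronglyMeasurable n hn).measurable

/-- A regular conditional law of `d n` given `ℱ (n - 1)` exists because `E` is Polish. Tangency
identifies it with the conditional law of `e n` given `ℱ_∞`, and conditional independence makes the
joint conditional law of the `e n` the product. -/
theorem exists_isTangentKernel [CompleteSpace E] (hfg : IsDecoupledSum μ ℱ f g) :
    ∃ κ : ℕ → Ω → Measure E, ∃ _ : ∀ n ω, IsProbabilityMeasure (κ n ω),
      IsTangentKernel μ ℱ (diffSeq f) (diffSeq g) κ := by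
  have hd : ∀ n, Measurable (diffSeq f n) := fun n =>
    (hfg.measurable_diff_left n).mono (ℱ.le n) le_rfl
  have he := hfg.measurable_diff_right
  have hid : ∀ m : MeasurableSpace Ω, m ≤ mΩ → @Measurable Ω Ω mΩ m id := fun m hm s hs => hm s hs
  let k : (n : ℕ) → @Kernel Ω E (ℱ (n - 1)) _ := fun n =>
    @condDistrib Ω Ω E _ _ _ mΩ (ℱ (n - 1)) (diffSeq f n) id μ _
  have hk : ∀ n ω, IsProbabilityMeasure (k n ω) := fun n ω => by
    have : @IsMarkovKernel Ω E (ℱ (n - 1)) _ (k n) := by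
      simp only [k]; infer_instance
    exact this.isProbabilityMeasure ω
  -- The product measure also has a coordinate `0`, which must carry the law of `diffSeq g 0 = 0`.
  let κ : ℕ → Ω → Measure E := fun n ω => if n = 0 then Measure.dirac 0 else k n ω
  have hκ : ∀ n ω, IsProbabilityMeasure (κ n ω) := fun n ω => by
    simp only [κ]; split_ifs <;> infer_instance
  have hκm : ∀ n, Measurable[ℱ (n - 1)] (κ n) := fun n => by
    by_cases hn : n = 0
    · simp only [κ, hn, if_true]; exact measurable_const
    · simp only [κ, hn, if_false]; exact (k n).measurable
  have hκm' : ∀ n, Measurable[⨆ k, ℱ k] (κ n) := fun n =>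
    (hκm n).mono (filtration_le_iSup ℱ _) le_rfl
  have hleft : ∀ n, 1 ≤ n → ∀ B : Set E, MeasurableSet B →
      (fun ω => (κ n ω B).toReal) =ᵐ[μ] μ⟦diffSeq f n ⁻¹' B | ℱ (n - 1)⟧ := by
    intro n hn B hB
    have := @condDistrib_ae_eq_condExp Ω Ω E _ _ _ mΩ μ _ id (diffSeq f n) (ℱ (n - 1)) B
      (hid _ (ℱ.le _)) (hd n) hB
    rw [MeasurableSpace.comap_id] at this
    have hn0 : n ≠ 0 := by omega
    simpa [κ, hn0, Measure.real, k] using this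
  have hone : ∀ n ω (B : Set E), κ n ω B ≤ 1 := fun n ω B => prob_le_one
  have hBm : ∀ n (B : Set E), MeasurableSet B → Measurable[⨆ k, ℱ k] fun ω => κ n ω B :=
    fun n B hB => (Measure.measurable_coe hB).comp (hκm' n)
  refine ⟨κ, hκ, hκm, ?_, ?_⟩
  · intro n hn h hh
    refine @lintegral_disintegration Ω E Ω (ℱ (n - 1)) _ mΩ μ _ id (diffSeq f n)
      (hid _ (ℱ.le _)) (hd n) (κ n) _ (hκm n) ?_ h hh
    intro A B hA hB
    exact setLIntegral_condProb (ℱ.le (n - 1)) (hd n hB)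
      ((Measure.measurable_coe hB).comp ((hκm n).mono (ℱ.le _) le_rfl)).aemeasurable
      (fun ω => hone n ω B) (hleft n hn B hB) hA
  · intro h hh
    have hY : Measurable fun ω k => diffSeq g k ω := measurable_pi_lambda _ he
    have hνm : Measurable[⨆ k, ℱ k] fun ω => Measure.infinitePi fun k => κ k ω :=
      @measurable_infinitePi Ω (⨆ k, ℱ k) E _ κ _ hκm'
    have hνm' : Measurable fun ω => Measure.infinitePi fun k => κ k ω :=
      hνm.mono (iSup_filtration_le ℱ) le_rfl
    refine @lintegral_disintegration Ω (ℕ → E) Ω (⨆ k, ℱ k) _ mΩ μ _ id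
      (fun ω k => diffSeq g k ω) (hid _ (iSup_filtration_le ℱ)) hY
      (fun ω => Measure.infinitePi fun k => κ k ω) _ hνm ?_ h hh
    intro A B hA hB
    have hA' : MeasurableSet A := iSup_filtration_le ℱ A hA
    -- For fixed `A` in `ℱ_∞`, both sides are finite measures in the infinite product, so cylinders
    -- suffice. A cylinder is padded by `Set.univ` to one over `0, …, n`, the form used in
    -- `condIndep`.
    have key : (μ.restrict A).map (fun ω k => diffSeq g k ω) =
        (μ.restrict A).bind fun ω => Measure.infinitePi fun k => κ k ω := by
      refine ext_of_generate_finite _ generateFrom_squareCylinders.symm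
        (isPiSystem_squareCylinders (fun _ => MeasurableSpace.isPiSystem_measurableSet)
          (by simp)) ?_ ?_
      · rintro _ ⟨s, t, ht, rfl⟩
        simp only [Set.mem_pi, Set.mem_univ, forall_const, Set.mem_ofPred_eq] at ht
        have hst : MeasurableSet ((s : Set ℕ).pi t) :=
          MeasurableSet.pi s.countable_toSet fun i _ => ht i
        rw [Measure.map_apply hY hst, Measure.bind_apply hst hνm'.aemeasurable,
          Measure.restrict_apply (hY hst)]
        classical
        set n := s.sup id with hn
        set B : ℕ → Set E := fun k => if k ∈ s then t k else Set.univ with hB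
        have hBmeas : ∀ k, MeasurableSet (B k) := fun k => by
          simp only [hB]; split_ifs
          exacts [ht k, MeasurableSet.univ]
        have hpi : (s : Set ℕ).pi t = ((Finset.range (n + 1) : Finset ℕ) : Set ℕ).pi B := by
          ext x
          simp only [Set.mem_pi, Finset.mem_coe, Finset.mem_range, hB]
          constructor
          · intro hx i _
            split_ifs with his
            exacts [hx i his, Set.mem_univ _]
          · intro hx i his
            have := hx i (Nat.lt_succ_of_le (Finset.le_sup (f := id) his))
            simpa [his] using this
        have hrange : Finset.range (n + 1) = insert 0 (Finset.Icc 1 n) := by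
          ext i; simp only [Finset.mem_range, Finset.mem_insert, Finset.mem_Icc]; omega
        have hprod : ∀ ω, Measure.infinitePi (fun k => κ k ω) ((s : Set ℕ).pi t) =
            Measure.dirac (0 : E) (B 0) * ∏ k ∈ Finset.Icc 1 n, κ k ω (B k) := fun ω => by
          rw [hpi, Measure.infinitePi_pi _ fun i _ => hBmeas i, hrange, Finset.prod_insert (by simp)]
          simp [κ]
        simp_rw [hprod]
        have hpre : (fun ω k => diffSeq g k ω) ⁻¹' ((s : Set ℕ).pi t) =
            {ω | (0 : E) ∈ B 0} ∩ ⋂ k ∈ Finset.Icc 1 n, diffSeq g k ⁻¹' B k := by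
          ext ω
          rw [hpi, hrange]
          simp [hfg.diff_right_zero]
        rw [hpre]
        by_cases h0 : (0 : E) ∈ B 0
        · have hd0 : Measure.dirac (0 : E) (B 0) = 1 := by
            rw [Measure.dirac_apply' _ (hBmeas 0)]; simp [h0]
          simp only [h0, hd0, one_mul]
          rw [Set.inter_comm]
          simp only [Set.ofPred_true, Set.univ_inter]
          have hI : MeasurableSet (⋂ k ∈ Finset.Icc 1 n, diffSeq g k ⁻¹' B k) :=
            Finset.measurableSet_biInter _ fun k _ => he k (hBmeas k)
          have hpm : Measurable fun ω => ∏ k ∈ Finset.Icc 1 n, κ k ω (B k) :=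
            Finset.measurable_prod _ fun k _ =>
              (hBm k (B k) (hBmeas k)).mono (iSup_filtration_le ℱ) le_rfl
          rcases Nat.eq_zero_or_pos n with hn0 | hn1
          · simp [hn0]
          · refine setLIntegral_condProb (iSup_filtration_le ℱ) hI hpm.aemeasurable
              (fun ω => Finset.prod_le_one' fun k _ => hone k ω _) ?_ hA
            refine Filter.EventuallyEq.trans ?_ (hfg.tangent.condIndep n hn1 B hBmeas).symm
            have hall : ∀ᵐ ω ∂μ, ∀ k, 1 ≤ k → (κ k ω (B k)).toReal =
                (μ⟦diffSeq g k ⁻¹' B k | ⨆ k, ℱ k⟧) ω := by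
              rw [ae_all_iff]
              intro k
              by_cases hk1 : 1 ≤ k
              · filter_upwards [(hleft k hk1 (B k) (hBmeas k)).trans
                  (hfg.tangent.tangent k hk1 (B k) (hBmeas k))] with ω hω _
                exact hω
              · exact ae_of_all _ fun ω h => absurd h hk1
            filter_upwards [hall] with ω hω
            rw [ENNReal.toReal_prod]
            exact Finset.prod_congr rfl fun k hk => hω k (Finset.mem_Icc.1 hk).1
        · have hd0 : Measure.dirac (0 : E) (B 0) = 0 := by
            rw [Measure.dirac_apply' _ (hBmeas 0)]; simp [h0]
          simp [h0, hd0]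
      · rw [Measure.map_apply hY MeasurableSet.univ,
          Measure.bind_apply MeasurableSet.univ hνm'.aemeasurable]
        simp
    have := congrArg (fun M => M B) key
    simp only [Measure.map_apply hY hB, Measure.bind_apply hB hνm'.aemeasurable,
      Measure.restrict_apply (hY hB)] at this
    rw [Set.preimage_id, Set.inter_comm]
    exact this

end TangentKernel

/-! ### Predictable transforms. -/

section Transform

variable {Ω E : Type*} {mΩ : MeasurableSpace Ω} [NormedAddCommGroup E] [MeasurableSpace E]
  [BorelSpace E] [SecondCountableTopology E]
  {μ : Measure Ω} [IsProbabilityMeasure μ] {ℱ : Filtration ℕ mΩ} {d e : ℕ → Ω → E}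
  {κ : ℕ → Ω → Measure E} [∀ n ω, IsProbabilityMeasure (κ n ω)]

/-- The partial sums of `φ k ω (d k ω)`, `1 ≤ k ≤ n`. -/
def transformSum (φ : ℕ → Ω → E → E) (d : ℕ → Ω → E) (n : ℕ) (ω : Ω) : E :=
  ∑ k ∈ Finset.Icc 1 n, φ k ω (d k ω)

theorem diffSeq_transformSum (φ : ℕ → Ω → E → E) (d : ℕ → Ω → E) {n : ℕ} (hn : 1 ≤ n) :
    diffSeq (transformSum φ d) n = fun ω => φ n ω (d n ω) := by
  ext ω
  obtain ⟨n, rfl⟩ : ∃ k, n = k + 1 := ⟨n - 1, by omega⟩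
  simp only [diffSeq, transformSum, Nat.add_sub_cancel]
  rw [Finset.sum_Icc_succ_top (by omega)]
  abel

theorem measurableSet_section {m : MeasurableSpace Ω} {φ : Ω → E → E}
    (hφ : Measurable[m.prod inferInstance] (Function.uncurry φ)) (ω : Ω) {B : Set E}
    (hB : MeasurableSet B) : MeasurableSet {x | φ ω x ∈ B} :=
  (hφ.comp (@measurable_prodMk_left Ω E m _ ω)) hB

theorem measurable_measure_section {m : MeasurableSpace Ω} {φ : Ω → E → E}
    (hφ : Measurable[m.prod inferInstance] (Function.uncurry φ)) {ν : Ω → Measure E}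
    [∀ ω, IsProbabilityMeasure (ν ω)] (hν : Measurable[m] ν) {B : Set E}
    (hB : MeasurableSet B) : Measurable[m] fun ω => ν ω {x | φ ω x ∈ B} := by
  have := @measurable_lintegral_of_measurable_measure Ω E m _ ν _ hν
    (fun ω x => B.indicator (fun _ => (1 : ℝ≥0∞)) (φ ω x))
    ((measurable_const.indicator hB).comp hφ)
  convert this using 2 with ω
  rw [← lintegral_indicator_one (measurableSet_section hφ ω hB)]
  rfl

/-- Since `φ` is predictable, it can be frozen when conditioning on `ℱ (n - 1)`: the conditional law
of the transformed difference is the image of `κ n` under `φ ω`. -/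
theorem IsTangentKernel.condProb_left (hκ : IsTangentKernel μ ℱ d e κ)
    (hd : ∀ n, Measurable[ℱ n] (d n)) {n : ℕ} (hn : 1 ≤ n) {φ : Ω → E → E}
    (hφ : Measurable[(ℱ (n - 1)).prod inferInstance] (Function.uncurry φ)) {B : Set E}
    (hB : MeasurableSet B) :
    (fun ω => (κ n ω {x | φ ω x ∈ B}).toReal) =ᵐ[μ]
      μ⟦(fun ω => φ ω (d n ω)) ⁻¹' B | ℱ (n - 1)⟧ := by
  have hle : (ℱ (n - 1)).prod inferInstance ≤ mΩ.prod (inferInstance : MeasurableSpace E) :=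
    sup_le_sup (MeasurableSpace.comap_mono (ℱ.le _)) le_rfl
  have hφd : Measurable fun ω => φ ω (d n ω) :=
    (hφ.mono hle le_rfl).comp (measurable_id.prodMk ((hd n).mono (ℱ.le n) le_rfl))
  refine condProb_ae_eq_of_forall_setLIntegral_eq (ℱ.le _) (hφd hB)
    (measurable_measure_section hφ (hκ.measurable n) hB) (fun _ => prob_le_one) fun S hS => ?_
  have hSφ : Measurable[(ℱ (n - 1)).prod inferInstance] (Function.uncurry fun ω x =>
      S.indicator (fun _ => B.indicator (fun _ => (1 : ℝ≥0∞)) (φ ω x)) ω) := by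
    have h1 : Measurable[(ℱ (n - 1)).prod inferInstance] fun z : Ω × E =>
        B.indicator (fun _ => (1 : ℝ≥0∞)) (φ z.1 z.2) :=
      (measurable_const.indicator hB).comp hφ
    exact h1.indicator ((@measurable_fst Ω E (ℱ (n - 1)) _) hS)
  have hS' := ℱ.le _ S hS
  have := hκ.lintegral_left n hn _ hSφ
  rw [← lintegral_indicator_one (hS'.inter (hφd hB)), ← lintegral_indicator hS']
  convert this using 2 with ω ω
  · ext ω
    by_cases h1 : ω ∈ S <;> by_cases h2 : φ ω (d n ω) ∈ B <;> simp [h1, h2]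
  · ext ω
    by_cases h1 : ω ∈ S
    · simp only [h1, Set.indicator_of_mem]
      rw [← lintegral_indicator_one (measurableSet_section hφ ω hB)]
      rfl
    · simp [h1]

/-- Singletons `s` give tangency of the transformed pair, and `s = Finset.Icc 1 n` gives its
conditional independence. -/
theorem IsTangentKernel.condProb_right (hκ : IsTangentKernel μ ℱ d e κ)
    (he : ∀ n, Measurable (e n)) (s : Finset ℕ) {φ : ℕ → Ω → E → E}
    (hφ : ∀ n ∈ s, Measurable[(ℱ (n - 1)).prod inferInstance] (Function.uncurry (φ n)))
    {B : ℕ → Set E} (hB : ∀ n, MeasurableSet (B n)) :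
    (fun ω => ∏ n ∈ s, (κ n ω {x | φ n ω x ∈ B n}).toReal) =ᵐ[μ]
      μ⟦⋂ n ∈ s, (fun ω => φ n ω (e n ω)) ⁻¹' B n | ⨆ k, ℱ k⟧ := by
  have hφ' : ∀ n ∈ s, Measurable[(⨆ k, ℱ k).prod inferInstance] (Function.uncurry (φ n)) :=
    fun n hn => (hφ n hn).mono
      (sup_le_sup (MeasurableSpace.comap_mono (filtration_le_iSup ℱ _)) le_rfl) le_rfl
  have hle : (⨆ k, ℱ k).prod inferInstance ≤ mΩ.prod (inferInstance : MeasurableSpace E) :=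
    sup_le_sup (MeasurableSpace.comap_mono (iSup_filtration_le ℱ)) le_rfl
  have hφe : ∀ n ∈ s, Measurable fun ω => φ n ω (e n ω) := fun n hn =>
    ((hφ' n hn).mono hle le_rfl).comp (measurable_id.prodMk (he n))
  have hA : MeasurableSet (⋂ n ∈ s, (fun ω => φ n ω (e n ω)) ⁻¹' B n) :=
    Finset.measurableSet_biInter _ fun n hn => hφe n hn (hB n)
  have hu : Measurable[⨆ k, ℱ k] fun ω => ∏ n ∈ s, κ n ω {x | φ n ω x ∈ B n} := by
    refine @Finset.measurable_prod _ _ _ _ _ _ (⨆ k, ℱ k) _ _ fun n hn => ?_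
    exact measurable_measure_section (hφ' n hn)
      ((hκ.measurable n).mono (filtration_le_iSup ℱ _) le_rfl) (hB n)
  have key := condProb_ae_eq_of_forall_setLIntegral_eq (μ := μ) (iSup_filtration_le ℱ) hA hu
    (fun ω => Finset.prod_le_one' fun n _ => prob_le_one) fun S hS => ?_
  · refine Filter.EventuallyEq.trans (Filter.Eventually.of_forall fun ω => ?_) key
    exact (ENNReal.toReal_prod ..).symm
  have hset : MeasurableSet[(⨆ k, ℱ k).prod inferInstance]
      {z : Ω × (ℕ → E) | ∀ n ∈ s, φ n z.1 (z.2 n) ∈ B n} := by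
    have : {z : Ω × (ℕ → E) | ∀ n ∈ s, φ n z.1 (z.2 n) ∈ B n} =
        ⋂ n ∈ s, {z : Ω × (ℕ → E) | φ n z.1 (z.2 n) ∈ B n} := by ext; simp
    rw [this]
    refine @Finset.measurableSet_biInter _ _ ((⨆ k, ℱ k).prod inferInstance) _ _ fun n hn => ?_
    have h1 : Measurable[(⨆ k, ℱ k).prod inferInstance, (⨆ k, ℱ k).prod inferInstance]
        fun z : Ω × (ℕ → E) => (z.1, z.2 n) :=
      @Measurable.prodMk _ ((⨆ k, ℱ k).prod inferInstance) _ _ (⨆ k, ℱ k) _ _ _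
        (@measurable_fst _ _ (⨆ k, ℱ k) _)
        ((measurable_pi_apply n).comp (@measurable_snd _ _ (⨆ k, ℱ k) _))
    exact ((hφ' n hn).comp h1) (hB n)
  have hSφ : Measurable[(⨆ k, ℱ k).prod inferInstance] (Function.uncurry fun ω (x : ℕ → E) =>
      S.indicator (fun _ => {z : Ω × (ℕ → E) | ∀ n ∈ s, φ n z.1 (z.2 n) ∈ B n}.indicator
        (fun _ => (1 : ℝ≥0∞)) (ω, x)) ω) := by
    exact (measurable_const.indicator hset).indicator ((@measurable_fst Ω _ (⨆ k, ℱ k) _) hS)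
  have hS' := iSup_filtration_le ℱ S hS
  have := hκ.lintegral_right _ hSφ
  rw [← lintegral_indicator_one (hS'.inter hA), ← lintegral_indicator hS']
  convert this using 2
  · ext ω
    by_cases h1 : ω ∈ S
    · by_cases h2 : ∀ n ∈ s, φ n ω (e n ω) ∈ B n
      · have hmem : ω ∈ S ∩ ⋂ n ∈ s, (fun ω => φ n ω (e n ω)) ⁻¹' B n :=
          ⟨h1, Set.mem_iInter₂.2 h2⟩
        rw [Set.indicator_of_mem hmem, Set.indicator_of_mem h1, Set.indicator_of_mem (by exact h2)]
        rfl
      · simp only [Set.indicator, Set.mem_inter_iff, h1, true_and, Set.mem_iInter,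
          Set.mem_preimage, h2, if_false, if_true, Set.mem_ofPred_eq]
    · simp [h1]
  · ext ω
    by_cases h1 : ω ∈ S
    · simp only [h1, Set.indicator_of_mem]
      rw [← Measure.infinitePi_pi (fun k => κ k ω)
        (fun n hn => measurableSet_section (hφ n hn) ω (hB n)),
        ← lintegral_indicator_one]
      · congr 1
      · exact MeasurableSet.pi s.countable_toSet
          fun n hn => measurableSet_section (hφ n hn) ω (hB n)
    · simp [h1]

/-- Predictable transforms of a decoupled sum sequence are decoupled sum sequences. -/
theorem IsTangentKernel.isDecoupledSum_transformSum (hκ : IsTangentKernel μ ℱ d e κ)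
    (h0 : ℱ 0 = ⊥) (hd : ∀ n, Measurable[ℱ n] (d n)) (he : ∀ n, Measurable (e n))
    {φ : ℕ → Ω → E → E}
    (hφ : ∀ n, 1 ≤ n → Measurable[(ℱ (n - 1)).prod inferInstance] (Function.uncurry (φ n))) :
    IsDecoupledSum μ ℱ (transformSum φ d) (transformSum φ e) where
  filtration_zero := h0
  adapted n := by
    refine Measurable.stronglyMeasurable ?_
    refine @Finset.measurable_sum _ _ _ _ _ _ (ℱ n) _ _ fun k hk => ?_
    obtain ⟨hk1, hkn⟩ := Finset.mem_Icc.1 hk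
    have h1 : Measurable[ℱ n, (ℱ (k - 1)).prod inferInstance] fun ω => (ω, d k ω) :=
      @Measurable.prodMk _ (ℱ n) _ _ (ℱ (k - 1)) _ _ _
        (fun s hs => ℱ.mono (by omega : k - 1 ≤ n) s hs) ((hd k).mono (ℱ.mono hkn) le_rfl)
    exact (hφ k hk1).comp h1
  f_zero := by ext; simp [transformSum]
  g_zero := by ext; simp [transformSum]
  tangent :=
    { stronglyMeasurable := fun n hn => by
        rw [diffSeq_transformSum φ e hn]
        have hle : (ℱ (n - 1)).prod inferInstance ≤ mΩ.prod (inferInstance : MeasurableSpace E) :=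
          sup_le_sup (MeasurableSpace.comap_mono (ℱ.le _)) le_rfl
        exact (((hφ n hn).mono hle le_rfl).comp
          (measurable_id.prodMk (he n))).stronglyMeasurable
      tangent := fun n hn B hB => by
        rw [diffSeq_transformSum φ d hn, diffSeq_transformSum φ e hn]
        refine (hκ.condProb_left hd hn (hφ n hn) hB).symm.trans ?_
        have := hκ.condProb_right he {n} (φ := φ) (by simpa using hφ n hn) (B := fun _ => B)
          (fun _ => hB)
        simpa using this
      condIndep := fun n hn B hB => by
        have h1 : (⋂ k ∈ Finset.Icc 1 n, diffSeq (transformSum φ e) k ⁻¹' B k) =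
            ⋂ k ∈ Finset.Icc 1 n, (fun ω => φ k ω (e k ω)) ⁻¹' B k :=
          Set.iInter₂_congr fun k hk => by
            rw [diffSeq_transformSum φ e (Finset.mem_Icc.1 hk).1]
        rw [h1]
        refine (hκ.condProb_right he (Finset.Icc 1 n)
          (fun k hk => hφ k (Finset.mem_Icc.1 hk).1) hB).symm.trans ?_
        have hall : ∀ᵐ ω ∂μ, ∀ k, 1 ≤ k → (κ k ω {x | φ k ω x ∈ B k}).toReal =
            (μ⟦diffSeq (transformSum φ e) k ⁻¹' B k | ⨆ k, ℱ k⟧) ω := by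
          rw [ae_all_iff]
          intro k
          by_cases hk1 : 1 ≤ k
          · have := hκ.condProb_right he {k} (φ := φ) (by simpa using hφ k hk1) hB
            rw [diffSeq_transformSum φ e hk1]
            simp only [Finset.prod_singleton, Finset.mem_singleton,
              Set.iInter_iInter_eq_left] at this
            filter_upwards [this] with ω hω _
            exact hω
          · exact ae_of_all _ fun ω h => absurd h hk1
        filter_upwards [hall] with ω hω
        exact Finset.prod_congr rfl fun k hk => hω k (Finset.mem_Icc.1 hk).1 }

end Transform

/-! ### Comparison of the largest differences. -/

section TangentMax

variable {Ω E : Type*} {mΩ : MeasurableSpace Ω} [NormedAddCommGroup E] [MeasurableSpace E]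
  [BorelSpace E] [SecondCountableTopology E]
  {μ : Measure Ω} [IsProbabilityMeasure μ] {ℱ : Filtration ℕ mΩ} {d e : ℕ → Ω → E}
  {κ : ℕ → Ω → Measure E} [∀ n ω, IsProbabilityMeasure (κ n ω)]

theorem IsTangentKernel.measurable_infinitePi (hκ : IsTangentKernel μ ℱ d e κ) :
    Measurable[⨆ k, ℱ k] fun ω => Measure.infinitePi fun k => κ k ω :=
  @Decoupling.measurable_infinitePi Ω (⨆ k, ℱ k) E _ κ _ fun n =>
    (hκ.measurable n).mono (filtration_le_iSup ℱ _) le_rfl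

theorem IsTangentKernel.measure_right (hκ : IsTangentKernel μ ℱ d e κ)
    (he : ∀ n, Measurable (e n)) {B : Set (ℕ → E)} (hB : MeasurableSet B) :
    μ {ω | (fun k => e k ω) ∈ B} = ∫⁻ ω, Measure.infinitePi (fun k => κ k ω) B ∂μ := by
  have hY : Measurable fun ω k => e k ω := measurable_pi_lambda _ he
  have := hκ.lintegral_right (fun _ x => B.indicator 1 x)
    ((measurable_one.indicator hB).comp (@measurable_snd _ _ (⨆ k, ℱ k) _))
  simp_rw [lintegral_indicator_one hB] at this
  rw [← this, show {ω | (fun k => e k ω) ∈ B} = (fun ω k => e k ω) ⁻¹' B from rfl,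
    ← lintegral_indicator_one (hY hB)]
  rfl

/-- A conditional probability given `ℱ_∞` of an event that depends only on `e 0, …, e n` is
`ℱ (n - 1)`-measurable. -/
theorem IsTangentKernel.measurable_measure_of_trunc (hκ : IsTangentKernel μ ℱ d e κ) (n : ℕ)
    {B : Set (ℕ → E)} (hB : MeasurableSet B)
    (hBn : ∀ x : ℕ → E, (fun k => if k ≤ n then x k else 0) ∈ B ↔ x ∈ B) :
    Measurable[ℱ (n - 1)] fun ω => Measure.infinitePi (fun k => κ k ω) B := by
  -- Replacing the later coordinates by `0` turns their laws into Dirac masses, so that only `κ 0,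
  -- …, κ n` remain, all of them `ℱ (n - 1)`-measurable.
  let τ : ℕ → E → E := fun k x => if k ≤ n then x else 0
  have hτ : ∀ k, Measurable (τ k) := fun k => by
    by_cases hk : k ≤ n
    · simpa [τ, hk] using measurable_id'
    · simp [τ, hk]
  have hprob : ∀ k ω, IsProbabilityMeasure ((κ k ω).map (τ k)) := fun k ω =>
    Measure.isProbabilityMeasure_map (hτ k).aemeasurable
  have h1 : ∀ ω, Measure.infinitePi (fun k => κ k ω) B =
      Measure.infinitePi (fun k => (κ k ω).map (τ k)) B := fun ω => by
    have hm : Measurable fun (x : ℕ → E) k => τ k (x k) :=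
      measurable_pi_lambda _ fun k => (hτ k).comp (measurable_pi_apply k)
    rw [← Measure.infinitePi_map_pi _ hτ, Measure.map_apply hm hB]
    congr 1
    ext x
    exact (hBn x).symm
  simp_rw [h1]
  refine (Measure.measurable_coe hB).comp
    (@Decoupling.measurable_infinitePi Ω (ℱ (n - 1)) E _ (fun k ω => (κ k ω).map (τ k)) _ fun k => ?_)
  by_cases hk : k ≤ n
  · exact (Measure.measurable_map _ (hτ k)).comp
      ((hκ.measurable k).mono (ℱ.mono (by omega)) le_rfl)
  · have : (fun ω => (κ k ω).map (τ k)) = fun _ => Measure.dirac 0 := by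
      ext1 ω
      have : τ k = fun _ => 0 := by ext; simp [τ, hk]
      rw [this, Measure.map_const]; simp
    rw [this]
    exact measurable_const

/-- Let `u n` be the conditional probability that `e 1, …, e n` stay below `a`, and `i n` the
indicator of the same event for `d`. Induction on `2 E u n ≤ 1 + E (i n * u n)` works because `u (n
+ 1)` is `ℱ n`-measurable. Bounding the last `u N` by `1` gives the claim. -/
theorem IsTangentKernel.measure_exists_norm_gt_le (hκ : IsTangentKernel μ ℱ d e κ)
    (hd : ∀ n, Measurable[ℱ n] (d n)) (he : ∀ n, Measurable (e n)) (a : ℝ) (N : ℕ) :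
    μ {ω | ∃ k ∈ Finset.Icc 1 N, a < ‖d k ω‖} ≤ 2 * μ {ω | ∃ k ∈ Finset.Icc 1 N, a < ‖e k ω‖} := by
  set q : ℕ → Ω → ℝ≥0∞ := fun k ω => κ k ω {x | ‖x‖ ≤ a} with hq
  set p : ℕ → Ω → ℝ≥0∞ := fun k ω => κ k ω {x | a < ‖x‖} with hp
  have hsq : MeasurableSet {x : E | ‖x‖ ≤ a} := measurableSet_le measurable_norm measurable_const
  have hsp : MeasurableSet {x : E | a < ‖x‖} := measurableSet_lt measurable_const measurable_norm
  have hqp : ∀ k ω, q k ω + p k ω = 1 := fun k ω => by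
    have : {x : E | a < ‖x‖} = {x : E | ‖x‖ ≤ a}ᶜ := by ext; simp
    simp only [hq, hp, this]
    exact prob_add_prob_compl hsq
  have hqm : ∀ k, Measurable[ℱ (k - 1)] (q k) := fun k =>
    (Measure.measurable_coe hsq).comp (hκ.measurable k)
  have hpm : ∀ k, Measurable[ℱ (k - 1)] (p k) := fun k =>
    (Measure.measurable_coe hsp).comp (hκ.measurable k)
  set u : ℕ → Ω → ℝ≥0∞ := fun n ω => ∏ k ∈ Finset.Icc 1 n, q k ω with hu
  have hum : ∀ n, Measurable[ℱ (n - 1)] (u n) := fun n =>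
    @Finset.measurable_prod _ _ _ _ _ _ (ℱ (n - 1)) _ _ fun k hk =>
      (hqm k).mono (ℱ.mono (by have := Finset.mem_Icc.1 hk; omega)) le_rfl
  have hus : ∀ n ω, u (n + 1) ω = u n ω * q (n + 1) ω := fun n ω => by
    simp only [hu]; rw [Finset.prod_Icc_succ_top (by omega)]
  have hu1 : ∀ n ω, u n ω ≤ 1 := fun n ω => Finset.prod_le_one' fun k _ => prob_le_one
  set I : ℕ → Set Ω := fun n => {ω | ∀ k ∈ Finset.Icc 1 n, ‖d k ω‖ ≤ a} with hI
  have hIm : ∀ n, MeasurableSet[ℱ n] (I n) := fun n => by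
    have : I n = ⋂ k ∈ Finset.Icc 1 n, {ω | ‖d k ω‖ ≤ a} := by ext; simp [hI]
    rw [this]
    exact @Finset.measurableSet_biInter _ _ (ℱ n) _ _ fun k hk =>
      ((hd k).mono (ℱ.mono (Finset.mem_Icc.1 hk).2) le_rfl) hsq
  set i : ℕ → Ω → ℝ≥0∞ := fun n => (I n).indicator 1 with hi
  have him : ∀ n, Measurable[ℱ n] (i n) := fun n =>
    Measurable.indicator (@measurable_const _ _ _ (ℱ n) 1) (hIm n)
  have hi1 : ∀ n ω, i n ω ≤ 1 := fun n ω => Set.indicator_le_self' (by simp) ω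
  have his : ∀ n ω, i (n + 1) ω = i n ω * {x : E | ‖x‖ ≤ a}.indicator 1 (d (n + 1) ω) := by
    intro n ω
    have h1 : ω ∈ I (n + 1) ↔ ω ∈ I n ∧ ‖d (n + 1) ω‖ ≤ a := by
      simp only [hI, Finset.mem_Icc, Set.mem_ofPred_eq]
      constructor
      · exact fun h => ⟨fun k hk => h k ⟨hk.1, by omega⟩, h (n + 1) ⟨by omega, le_rfl⟩⟩
      · rintro ⟨h, h'⟩ k ⟨hk1, hk2⟩
        rcases Nat.lt_or_ge k (n + 1) with hlt | hge
        · exact h k ⟨hk1, by omega⟩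
        · obtain rfl : k = n + 1 := by omega
          exact h'
    simp only [hi, Set.indicator, h1, Set.mem_ofPred_eq]
    by_cases h2 : ω ∈ I n <;> by_cases h3 : ‖d (n + 1) ω‖ ≤ a <;> simp [h2, h3]
  have hmeas : ∀ {k} {h : Ω → ℝ≥0∞}, Measurable[ℱ k] h → Measurable h :=
    fun h => h.mono (ℱ.le _) le_rfl
  have hind : ∀ n, 2 * ∫⁻ ω, u n ω ∂μ ≤ 1 + ∫⁻ ω, i n ω * u n ω ∂μ := by
    intro n
    induction n with
    | zero =>
      have h0 : I 0 = Set.univ := Set.eq_univ_of_forall fun ω k hk => by simp at hk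
      simp only [hu, hi, h0, Finset.Icc_eq_empty_of_lt zero_lt_one, Finset.prod_empty]
      simp [one_add_one_eq_two]
    | succ n ih =>
      have h1 : ∫⁻ ω, i (n + 1) ω * u (n + 1) ω ∂μ =
          ∫⁻ ω, i n ω * u (n + 1) ω * q (n + 1) ω ∂μ := by
        have hm : Measurable[(ℱ (n + 1 - 1)).prod inferInstance] (Function.uncurry
            fun ω (x : E) => i n ω * u (n + 1) ω * {x : E | ‖x‖ ≤ a}.indicator 1 x) := by
          have h2 : Measurable[ℱ n] fun ω => i n ω * u (n + 1) ω := (him n).mul (hum (n + 1))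
          exact (h2.comp (@measurable_fst Ω E (ℱ n) _)).mul
            ((measurable_one.indicator hsq).comp (@measurable_snd Ω E (ℱ n) _))
        have := hκ.lintegral_left (n + 1) (by omega) _ hm
        calc _ = _ := lintegral_congr fun ω => by rw [his]; ring
          _ = _ := this
          _ = _ := lintegral_congr fun ω => by
            rw [lintegral_const_mul _ (measurable_one.indicator hsq),
              lintegral_indicator_one hsq]
      have h2 : ∫⁻ ω, u n ω ∂μ = ∫⁻ ω, u (n + 1) ω ∂μ + ∫⁻ ω, p (n + 1) ω * u n ω ∂μ := by
        rw [← lintegral_add_left (hmeas (hum (n + 1)))]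
        refine lintegral_congr fun ω => ?_
        rw [hus, mul_comm (p _ _), ← mul_add, hqp, mul_one]
      -- With `p = 1 - q`, the loss is `i u (1 - q ^ 2) = i u p (1 + q) ≤ 2 p u`, which is exactly
      -- the decrease of `2 u` in `h2`.
      have h3 : ∫⁻ ω, i n ω * u n ω ∂μ ≤
          ∫⁻ ω, i (n + 1) ω * u (n + 1) ω ∂μ + 2 * ∫⁻ ω, p (n + 1) ω * u n ω ∂μ := by
        have hm1 : Measurable fun ω => p (n + 1) ω * u n ω :=
          (hmeas (hpm (n + 1))).mul (hmeas (hum n))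
        have hm2 : Measurable fun ω => i n ω * u (n + 1) ω * q (n + 1) ω :=
          ((hmeas (him n)).mul (hmeas (hum (n + 1)))).mul (hmeas (hqm (n + 1)))
        rw [h1, ← lintegral_const_mul _ hm1, ← lintegral_add_left hm2]
        refine lintegral_mono fun ω => ?_
        have hQ : q (n + 1) ω ≤ 1 := prob_le_one
        calc i n ω * u n ω
            = i n ω * u n ω * ((q (n + 1) ω + p (n + 1) ω) * q (n + 1) ω + p (n + 1) ω) := by
              rw [hqp, one_mul, hqp, mul_one]
          _ = i n ω * (u n ω * q (n + 1) ω) * q (n + 1) ω +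
              i n ω * q (n + 1) ω * (p (n + 1) ω * u n ω) + i n ω * (p (n + 1) ω * u n ω) := by
              ring
          _ ≤ i n ω * (u n ω * q (n + 1) ω) * q (n + 1) ω +
              1 * 1 * (p (n + 1) ω * u n ω) + 1 * (p (n + 1) ω * u n ω) := by
              gcongr <;> exact hi1 n ω
          _ = i n ω * u (n + 1) ω * q (n + 1) ω + 2 * (p (n + 1) ω * u n ω) := by
              rw [hus]; ring
      have hfin : 2 * ∫⁻ ω, p (n + 1) ω * u n ω ∂μ ≠ ∞ := by
        refine ENNReal.mul_ne_top (by simp) (ne_top_of_le_ne_top ENNReal.one_ne_top ?_)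
        calc ∫⁻ ω, p (n + 1) ω * u n ω ∂μ ≤ ∫⁻ _, 1 * 1 ∂μ :=
              lintegral_mono fun ω => mul_le_mul' prob_le_one (hu1 n ω)
          _ = 1 := by simp
      refine (ENNReal.add_le_add_iff_right hfin).1 ?_
      calc _ = 2 * ∫⁻ ω, u n ω ∂μ := by rw [h2, mul_add]
        _ ≤ 1 + ∫⁻ ω, i n ω * u n ω ∂μ := ih
        _ ≤ 1 + (_ + _) := by gcongr
        _ = _ := by rw [add_assoc]
  have hEc : μ {ω | ∃ k ∈ Finset.Icc 1 N, a < ‖e k ω‖} + ∫⁻ ω, u N ω ∂μ = 1 := by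
    have hB : MeasurableSet ((Finset.Icc 1 N : Set ℕ).pi fun _ => {x : E | ‖x‖ ≤ a}) :=
      MeasurableSet.pi (Set.to_countable _) fun _ _ => hsq
    have h1 : ∫⁻ ω, u N ω ∂μ = μ {ω | ∃ k ∈ Finset.Icc 1 N, a < ‖e k ω‖}ᶜ := by
      have := hκ.measure_right he hB
      simp_rw [Measure.infinitePi_pi _ fun _ _ => hsq] at this
      rw [← this]
      congr 1
      ext ω
      simp
    rw [h1]
    refine prob_add_prob_compl ?_
    have : {ω | ∃ k ∈ Finset.Icc 1 N, a < ‖e k ω‖} =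
        ⋃ k ∈ Finset.Icc 1 N, e k ⁻¹' {x | a < ‖x‖} := by ext; simp
    rw [this]
    exact Finset.measurableSet_biUnion _ fun k _ => he k hsp
  have hDc : μ {ω | ∃ k ∈ Finset.Icc 1 N, a < ‖d k ω‖} + μ (I N) = 1 := by
    have : {ω | ∃ k ∈ Finset.Icc 1 N, a < ‖d k ω‖} = (I N)ᶜ := by
      ext; simp [hI, and_assoc]
    rw [this, add_comm]
    exact prob_add_prob_compl (ℱ.le _ _ (hIm N))
  have hfinal : 2 * ∫⁻ ω, u N ω ∂μ ≤ 1 + μ (I N) := by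
    refine (hind N).trans ?_
    gcongr
    rw [← lintegral_indicator_one (ℱ.le _ _ (hIm N))]
    exact lintegral_mono fun ω => mul_le_of_le_one_right' (hu1 N ω)
  have hIfin : 1 + μ (I N) ≠ ∞ := by finiteness
  refine (ENNReal.add_le_add_iff_right hIfin).1 ?_
  calc μ {ω | ∃ k ∈ Finset.Icc 1 N, a < ‖d k ω‖} + (1 + μ (I N))
      = 1 + (μ {ω | ∃ k ∈ Finset.Icc 1 N, a < ‖d k ω‖} + μ (I N)) := by ring
    _ = 2 * (μ {ω | ∃ k ∈ Finset.Icc 1 N, a < ‖e k ω‖} + ∫⁻ ω, u N ω ∂μ) := by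
      rw [hDc, hEc]; norm_num
    _ ≤ _ := by rw [mul_add]; gcongr

end TangentMax

/-! ### Maximal sums of independent variables. -/

section Independent

variable {Ω E : Type*} {mΩ : MeasurableSpace Ω} [NormedAddCommGroup E] [MeasurableSpace E]
  [BorelSpace E] [SecondCountableTopology E] {P : Measure Ω} [IsProbabilityMeasure P]

/-- The partial sums `x 1 + … + x n`. -/
def partialSum {E : Type*} [AddCommGroup E] (x : ℕ → E) (n : ℕ) : E := ∑ k ∈ Finset.Icc 1 n, x k

theorem partialSum_zero (x : ℕ → E) : partialSum x 0 = 0 := by simp [partialSum]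

theorem partialSum_succ (x : ℕ → E) (n : ℕ) :
    partialSum x (n + 1) = partialSum x n + x (n + 1) := by
  rw [partialSum, Finset.sum_Icc_succ_top (by omega), partialSum]

theorem partialSum_sub (x : ℕ → E) {k j : ℕ} (h : k ≤ j) :
    partialSum x j - partialSum x k = ∑ i ∈ Finset.Ioc k j, x i := by
  induction j, h using Nat.le_induction with
  | base => simp
  | succ j hkj ih =>
    rw [partialSum_succ, Finset.sum_Ioc_succ_top hkj, ← ih]
    abel

theorem measurable_partialSum {m : MeasurableSpace Ω} {x : ℕ → Ω → E} (n : ℕ)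
    (hx : ∀ k, 1 ≤ k → k ≤ n → Measurable[m] (x k)) :
    Measurable[m] fun ω => partialSum (fun k => x k ω) n :=
  @Finset.measurable_sum _ _ _ _ _ _ m _ _ fun k hk =>
    hx k (Finset.mem_Icc.1 hk).1 (Finset.mem_Icc.1 hk).2

theorem measurableSet_lt_norm {m : MeasurableSpace Ω} {h : Ω → E} (hh : Measurable[m] h) (s : ℝ) :
    MeasurableSet[m] {ω | s < ‖h ω‖} :=
  hh (measurableSet_lt measurable_const measurable_norm)

/-- Split according to the first `k` with `A k`. These events are disjoint and belong to the past of
`k`, hence are independent of the future event `R k`. -/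
theorem measure_first_inter_le {m : ℕ → MeasurableSpace Ω} (hm : ∀ i, m i ≤ mΩ)
    (hind : iIndep m P) {A R : ℕ → Set Ω} {a b : ℕ}
    (hA : ∀ k ∈ Finset.Icc a b, MeasurableSet[⨆ i ∈ Set.Iic k, m i] (A k))
    (hR : ∀ k ∈ Finset.Icc a b, MeasurableSet[⨆ i ∈ Set.Ioi k, m i] (R k)) {θ : ℝ≥0∞}
    (hθ : ∀ k ∈ Finset.Icc a b, P (R k) ≤ θ) :
    P {ω | ∃ k ∈ Finset.Icc a b, ω ∈ A k ∧ (∀ j ∈ Finset.Ico a k, ω ∉ A j) ∧ ω ∈ R k} ≤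
      θ * P {ω | ∃ k ∈ Finset.Icc a b, ω ∈ A k} := by
  set F : ℕ → Set Ω := fun k => A k ∩ ⋂ j ∈ Finset.Ico a k, (A j)ᶜ with hF
  have hFm : ∀ k ∈ Finset.Icc a b, MeasurableSet[⨆ i ∈ Set.Iic k, m i] (F k) := fun k hk => by
    refine (hA k hk).inter (@Finset.measurableSet_biInter _ _ (⨆ i ∈ Set.Iic k, m i) _ _ ?_)
    intro j hj
    have h1 := Finset.mem_Icc.1 hk
    have h2 := Finset.mem_Ico.1 hj
    have h3 : (⨆ i ∈ Set.Iic j, m i) ≤ ⨆ i ∈ Set.Iic k, m i :=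
      biSup_mono fun i hi => le_trans hi h2.2.le
    exact (h3 _ (hA j (Finset.mem_Icc.2 ⟨h2.1, by omega⟩))).compl
  have hle : ∀ s : Set ℕ, (⨆ i ∈ s, m i) ≤ mΩ := fun s => iSup₂_le fun i _ => hm i
  have hdisj : (Finset.Icc a b : Set ℕ).PairwiseDisjoint F := by
    have aux : ∀ i ∈ Finset.Icc a b, ∀ j, i < j → Disjoint (F i) (F j) := by
      intro i hi j hij
      rw [Set.disjoint_left]
      rintro ω ⟨h1, _⟩ ⟨_, h2⟩
      exact Set.mem_iInter₂.1 h2 i (Finset.mem_Ico.2 ⟨(Finset.mem_Icc.1 hi).1, hij⟩) h1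
    intro i hi j hj hij
    rcases lt_or_gt_of_ne hij with h | h
    · exact aux i hi j h
    · exact (aux j hj i h).symm
  calc _ ≤ P (⋃ k ∈ Finset.Icc a b, F k ∩ R k) := by
        refine measure_mono ?_
        rintro ω ⟨k, hk, h1, h2, h3⟩
        exact Set.mem_iUnion₂.2 ⟨k, hk, ⟨h1, Set.mem_iInter₂.2 h2⟩, h3⟩
    _ ≤ ∑ k ∈ Finset.Icc a b, P (F k ∩ R k) := measure_biUnion_finset_le _ _
    _ ≤ ∑ k ∈ Finset.Icc a b, θ * P (F k) := by
        refine Finset.sum_le_sum fun k hk => ?_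
        have hindk : Indep (⨆ i ∈ Set.Iic k, m i) (⨆ i ∈ Set.Ioi k, m i) P :=
          indep_iSup_of_disjoint hm hind (Set.disjoint_left.2 fun i hi hi' =>
            absurd (lt_of_lt_of_le (Set.mem_Ioi.1 hi') (Set.mem_Iic.1 hi)) (lt_irrefl _))
        rw [(Indep_iff _ _ _).1 hindk _ _ (hFm k hk) (hR k hk), mul_comm]
        gcongr
        exact hθ k hk
    _ = θ * P (⋃ k ∈ Finset.Icc a b, F k) := by
        rw [measure_biUnion_finset hdisj fun k hk => hle _ _ (hFm k hk), Finset.mul_sum]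
    _ ≤ _ := by
        gcongr
        refine Set.iUnion₂_subset fun k hk ω hω => ⟨k, hk, hω.1⟩

variable {x : ℕ → Ω → E}

theorem measurable_of_mem_iSup_comap {s : Set ℕ} {k : ℕ} (hk : k ∈ s) :
    Measurable[⨆ i ∈ s, MeasurableSpace.comap (x i) inferInstance] (x k) := by
  have h1 : MeasurableSpace.comap (x k) inferInstance ≤
      ⨆ i ∈ s, MeasurableSpace.comap (x i) inferInstance :=
    le_iSup₂ (f := fun i (_ : i ∈ s) =>
      MeasurableSpace.comap (x i) (inferInstance : MeasurableSpace E)) k hk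
  exact (comap_measurable (x k)).mono h1 le_rfl

theorem norm_partialSum_sub_le_of_forall_le {y : ℕ → E} {m : ℝ} {b j k : ℕ} (hj : 1 ≤ j)
    (hjb : j ≤ b) (hkb : k ≤ b) (hm : 0 ≤ m)
    (h : ∀ i ∈ Finset.Icc 1 b, ‖partialSum y i‖ ≤ m) :
    ‖partialSum y j - partialSum y k‖ ≤ 2 * m := by
  have h1 := h j (Finset.mem_Icc.2 ⟨hj, hjb⟩)
  have h2 : ‖partialSum y k‖ ≤ m := by
    rcases Nat.eq_zero_or_pos k with rfl | hk
    · simpa [partialSum_zero] using hm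
    · exact h k (Finset.mem_Icc.2 ⟨hk, hkb⟩)
  linarith [norm_sub_le (partialSum y j) (partialSum y k)]

/-- At the first passage above `s` the increment is at most `s + 2 * m`, as one step is at most `2 *
m`. Reaching `s + 4 * m` takes a later increment above `2 * m`, which is independent of the passage
and forces some partial sum above `m`. -/
theorem measure_exists_increment_gt_le (hx : ∀ k, Measurable (x k)) (hind : iIndepFun x P)
    {m : ℝ} (hm : 0 ≤ m) (hxm : ∀ k ω, ‖x k ω‖ ≤ 2 * m) {a b : ℕ} {θ : ℝ≥0∞}
    (hθ : P {ω | ∃ k ∈ Finset.Icc 1 b, m < ‖partialSum (x · ω) k‖} ≤ θ) {s : ℝ} (hs : 0 ≤ s) :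
    P {ω | ∃ k ∈ Finset.Icc (a + 1) b,
        s + 4 * m < ‖partialSum (x · ω) k - partialSum (x · ω) a‖} ≤
      θ * P {ω | ∃ k ∈ Finset.Icc (a + 1) b,
        s < ‖partialSum (x · ω) k - partialSum (x · ω) a‖} := by
  set A : ℕ → Set Ω := fun k => {ω | s < ‖partialSum (x · ω) k - partialSum (x · ω) a‖} with hA
  set R : ℕ → Set Ω := fun k =>
    {ω | ∃ j ∈ Finset.Icc (k + 1) b, 2 * m < ‖partialSum (x · ω) j - partialSum (x · ω) k‖} with hR
  refine le_trans (measure_mono ?_) (measure_first_inter_le (A := A) (R := R)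
    (fun i => (hx i).comap_le) hind.iIndep ?_ ?_ ?_)
  · rintro ω ⟨j, hj, hjs⟩
    obtain ⟨hj1, hjb⟩ := Finset.mem_Icc.1 hj
    have hex : ∃ k, a + 1 ≤ k ∧ ω ∈ A k := ⟨j, hj1, by
      have : s ≤ s + 4 * m := by linarith
      exact this.trans_lt hjs⟩
    classical
    set k := Nat.find hex with hk
    obtain ⟨hk1, hkA⟩ : a + 1 ≤ k ∧ ω ∈ A k := Nat.find_spec hex
    have hkj : k ≤ j := Nat.find_min' hex ⟨hj1, by
      have : s ≤ s + 4 * m := by linarith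
      exact this.trans_lt hjs⟩
    have hbefore : ∀ i ∈ Finset.Ico (a + 1) k, ω ∉ A i := fun i hi hiA =>
      Nat.find_min hex (Finset.mem_Ico.1 hi).2 ⟨(Finset.mem_Ico.1 hi).1, hiA⟩
    have hkle : ‖partialSum (x · ω) k - partialSum (x · ω) a‖ ≤ s + 2 * m := by
      obtain ⟨l, hl⟩ : ∃ l, k = l + 1 := ⟨k - 1, by omega⟩
      have hprev : ‖partialSum (x · ω) l - partialSum (x · ω) a‖ ≤ s := by
        rcases Nat.lt_or_ge l (a + 1) with h | h
        · obtain rfl : l = a := by omega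
          simpa using hs
        · have := hbefore l (Finset.mem_Ico.2 ⟨h, by omega⟩)
          simpa [hA] using this
      rw [hl, partialSum_succ]
      calc _ = ‖(partialSum (x · ω) l - partialSum (x · ω) a) + x (l + 1) ω‖ := by congr 1; abel
        _ ≤ _ := (norm_add_le _ _).trans (add_le_add hprev (hxm _ _))
    refine ⟨k, Finset.mem_Icc.2 ⟨hk1, hkj.trans hjb⟩, hkA, hbefore, j, ?_, ?_⟩
    · refine Finset.mem_Icc.2 ⟨?_, hjb⟩
      rcases hkj.lt_or_eq with h | h
      · exact h
      · rw [h] at hkle; linarith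
    · have h1 : ‖partialSum (x · ω) j - partialSum (x · ω) a‖ ≤
          ‖partialSum (x · ω) j - partialSum (x · ω) k‖ +
          ‖partialSum (x · ω) k - partialSum (x · ω) a‖ := norm_sub_le_norm_sub_add_norm_sub ..
      linarith
  · intro k hk
    have hk' := Finset.mem_Icc.1 hk
    refine measurableSet_lt_norm (Measurable.sub ?_ ?_) s <;>
      refine measurable_partialSum _ fun i _ hi => measurable_of_mem_iSup_comap ?_
    · exact hi
    · exact Set.mem_Iic.2 (by omega)
  · intro k hk
    have : R k = ⋃ j ∈ Finset.Icc (k + 1) b, {ω | 2 * m < ‖∑ i ∈ Finset.Ioc k j, x i ω‖} := by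
      ext ω
      simp only [hR, Set.mem_ofPred_eq, Set.mem_iUnion, exists_prop]
      refine exists_congr fun j => and_congr_right fun hj => ?_
      rw [partialSum_sub _ (by have := Finset.mem_Icc.1 hj; omega)]
    rw [this]
    refine @Finset.measurableSet_biUnion _ _ (⨆ i ∈ Set.Ioi k, _) _ _ fun j hj => ?_
    refine measurableSet_lt_norm ?_ _
    exact @Finset.measurable_sum _ _ _ _ _ _ (⨆ i ∈ Set.Ioi k, _) _ _ fun i hi =>
      measurable_of_mem_iSup_comap (Finset.mem_Ioc.1 hi).1
  · intro k hk
    have hk' := Finset.mem_Icc.1 hk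
    refine le_trans (measure_mono ?_) hθ
    rintro ω ⟨j, hj, hjk⟩
    have hj' := Finset.mem_Icc.1 hj
    by_contra hcon
    simp only [Set.mem_ofPred_eq, not_exists, not_and, not_lt] at hcon
    exact absurd (norm_partialSum_sub_le_of_forall_le (by omega) hj'.2 hk'.2 hm hcon)
      (not_le.2 hjk)

/-- The ratio `3 / 2` cancels the factor `(2 / 3) ^ p` in the threshold `(2 / 3) ^ p / 2`, which
leaves a geometric series of ratio `1 / 2` in the moment bound. -/
theorem two_mul_add_one_le (j : ℕ) : (2 * j + 1 : ℝ) ≤ 9 / 4 * (3 / 2) ^ j := by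
  rcases Nat.lt_or_ge j 2 with h | h
  · interval_cases j <;> norm_num
  · induction j, h using Nat.le_induction with
    | base => norm_num
    | succ j hj ih =>
      have : (2 : ℝ) ≤ j := by exact_mod_cast hj
      push_cast
      rw [pow_succ]
      nlinarith

/-- A Hoffmann-Jørgensen type moment bound: the tail of the maximal partial sum of independent
bounded variables decays geometrically once it is small at one level. -/
theorem lintegral_norm_increment_rpow_le (hx : ∀ k, Measurable (x k)) (hind : iIndepFun x P)
    {m : ℝ} (hm : 0 < m) (hxm : ∀ k ω, ‖x k ω‖ ≤ 2 * m) {a b : ℕ} (hab : a < b) {p : ℝ}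
    (hp : 0 < p)
    (hθ : P {ω | ∃ k ∈ Finset.Icc 1 b, m < ‖partialSum (x · ω) k‖} ≤
      ENNReal.ofReal ((2 / 3) ^ p / 2)) :
    ∫⁻ ω, ENNReal.ofReal (‖partialSum (x · ω) b - partialSum (x · ω) a‖ ^ p) ∂P ≤
      ENNReal.ofReal (2 * (9 / 2 * m) ^ p) := by
  set θ : ℝ := (2 / 3) ^ p / 2 with hθdef
  have hθ0 : 0 ≤ θ := by positivity
  set T : ℝ → Set Ω := fun s => {ω | ∃ k ∈ Finset.Icc (a + 1) b,
        s < ‖partialSum (x · ω) k - partialSum (x · ω) a‖} with hT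
  have hT0 : ∀ j : ℕ, P (T (2 * m + 4 * m * j)) ≤ ENNReal.ofReal θ ^ (j + 1) := by
    intro j
    induction j with
    | zero =>
      rw [zero_add, pow_one]
      refine le_trans (measure_mono ?_) hθ
      rintro ω ⟨k, hk, hka⟩
      have hk' := Finset.mem_Icc.1 hk
      by_contra hcon
      simp only [Set.mem_ofPred_eq, not_exists, not_and, not_lt] at hcon
      refine absurd (norm_partialSum_sub_le_of_forall_le (by omega) hk'.2 hab.le hm.le hcon)
        (not_le.2 ?_)
      simpa using hka
    | succ j ih =>
      have := measure_exists_increment_gt_le hx hind hm.le hxm (a := a) hθ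
        (s := 2 * m + 4 * m * j) (by positivity)
      rw [pow_succ', show 2 * m + 4 * m * ((j + 1 : ℕ) : ℝ) = 2 * m + 4 * m * j + 4 * m by
        push_cast; ring]
      exact this.trans (mul_le_mul_right ih _)
  set Z : Ω → ℝ := fun ω => ‖partialSum (x · ω) b - partialSum (x · ω) a‖ with hZ
  have hZm : Measurable Z :=
    ((measurable_partialSum b fun k _ _ => hx k).sub
      (measurable_partialSum a fun k _ _ => hx k)).norm
  -- For `j = 0` the level is negative, so this is the whole space, with the trivial bound `θ ^ 0`.
  set W : ℕ → Set Ω := fun j => {ω | 2 * m * (2 * j - 1) < Z ω} with hW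
  have hWm : ∀ j, MeasurableSet (W j) := fun j => measurableSet_lt measurable_const hZm
  have hWP : ∀ j, P (W j) ≤ ENNReal.ofReal θ ^ j := by
    intro j
    rcases j with _ | j
    · simpa using prob_le_one
    · refine le_trans (measure_mono ?_) (hT0 j)
      intro ω hω
      refine ⟨b, Finset.mem_Icc.2 ⟨hab, le_rfl⟩, ?_⟩
      simp only [hW, Set.mem_ofPred_eq, hZ] at hω
      push_cast at hω
      linarith
  have hpt : ∀ ω, ENNReal.ofReal (Z ω ^ p) ≤
      ∑' j : ℕ, (W j).indicator (fun _ => ENNReal.ofReal ((2 * m * (2 * j + 1)) ^ p)) ω := by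
    intro ω
    have hZ0 : 0 ≤ Z ω := norm_nonneg _
    have hex : ∃ j : ℕ, Z ω ≤ 2 * m * (2 * j + 1) := by
      obtain ⟨j, hj⟩ := exists_nat_ge (Z ω / (2 * m))
      refine ⟨j, ?_⟩
      rw [div_le_iff₀ (by positivity)] at hj
      nlinarith [hm, (Nat.cast_nonneg j : (0 : ℝ) ≤ j)]
    classical
    set j := Nat.find hex with hj
    have hj1 : Z ω ≤ 2 * m * (2 * j + 1) := Nat.find_spec hex
    have hmem : ω ∈ W j := by
      simp only [hW, Set.mem_ofPred_eq]
      rcases Nat.eq_zero_or_pos j with h0 | h0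
      · rw [h0]; push_cast; nlinarith
      · have := Nat.find_min hex (m := j - 1) (by omega)
        rw [not_le] at this
        rw [Nat.cast_sub h0] at this
        push_cast at this
        linarith
    refine le_trans ?_ (ENNReal.le_tsum j)
    rw [Set.indicator_of_mem hmem]
    gcongr
  have hterm : ∀ j : ℕ, ENNReal.ofReal ((2 * m * (2 * j + 1)) ^ p) * P (W j) ≤
      ENNReal.ofReal ((9 / 2 * m) ^ p) * (2⁻¹ : ℝ≥0∞) ^ j := by
    intro j
    calc _ ≤ ENNReal.ofReal ((2 * m * (2 * j + 1)) ^ p) * ENNReal.ofReal θ ^ j := by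
          gcongr; exact hWP j
      _ = ENNReal.ofReal ((2 * m * (2 * j + 1)) ^ p * θ ^ j) := by
          rw [← ENNReal.ofReal_pow hθ0, ← ENNReal.ofReal_mul (by positivity)]
      _ ≤ ENNReal.ofReal ((9 / 2 * m) ^ p * (1 / 2) ^ j) := by
          refine ENNReal.ofReal_le_ofReal ?_
          have h1 : (2 * m * (2 * j + 1)) ^ p ≤ (9 / 2 * m * (3 / 2) ^ j) ^ p := by
            refine Real.rpow_le_rpow (by positivity) ?_ hp.le
            nlinarith [two_mul_add_one_le j]
          calc _ ≤ (9 / 2 * m * (3 / 2) ^ j) ^ p * θ ^ j := by gcongr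
            _ = (9 / 2 * m) ^ p * (((3 / 2 : ℝ) ^ j) ^ p * ((2 / 3) ^ p) ^ j) * (1 / 2) ^ j := by
              have : θ ^ j = ((2 / 3) ^ p) ^ j * (1 / 2) ^ j := by
                rw [hθdef, div_eq_mul_one_div, mul_pow]
              rw [Real.mul_rpow (by positivity) (by positivity), this]
              ring
            _ = _ := by
              have : ((3 / 2 : ℝ) ^ j) ^ p * ((2 / 3) ^ p) ^ j = 1 := by
                rw [← Real.rpow_natCast, ← Real.rpow_natCast, ← Real.rpow_mul (by norm_num),
                  ← Real.rpow_mul (by norm_num), mul_comm p,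
                  ← Real.mul_rpow (by norm_num) (by norm_num)]
                norm_num
              rw [this, mul_one]
      _ = _ := by
          rw [ENNReal.ofReal_mul (by positivity), ENNReal.ofReal_pow (by norm_num)]
          congr 2
          rw [one_div, ENNReal.ofReal_inv_of_pos (by norm_num)]
          norm_num
  calc ∫⁻ ω, ENNReal.ofReal (Z ω ^ p) ∂P
      ≤ ∫⁻ ω, ∑' j : ℕ, (W j).indicator
          (fun _ => ENNReal.ofReal ((2 * m * (2 * j + 1)) ^ p)) ω ∂P := lintegral_mono hpt
    _ = ∑' j : ℕ, ENNReal.ofReal ((2 * m * (2 * j + 1)) ^ p) * P (W j) := by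
        rw [lintegral_tsum fun j => (measurable_const.indicator (hWm j)).aemeasurable]
        simp_rw [lintegral_indicator_const (hWm _)]
    _ ≤ ∑' j : ℕ, ENNReal.ofReal ((9 / 2 * m) ^ p) * (2⁻¹ : ℝ≥0∞) ^ j :=
        ENNReal.tsum_le_tsum hterm
    _ = _ := by
        rw [ENNReal.tsum_mul_left, ENNReal.tsum_geometric, ENNReal.one_sub_inv_two, inv_inv,
          mul_comm, ENNReal.ofReal_mul (by norm_num)]
        norm_num

end Independent

/-! ### Truncation of independent variables. -/

section Truncation

variable {Ω E : Type*} {mΩ : MeasurableSpace Ω} [NormedAddCommGroup E] [MeasurableSpace E]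
  [BorelSpace E] [SecondCountableTopology E] {P : Measure Ω} [IsProbabilityMeasure P]

open Classical in
/-- Truncation of a vector at norm `c`. -/
noncomputable def trunc (c : ℝ) (x : E) : E := if ‖x‖ ≤ c then x else 0

theorem measurable_trunc (c : ℝ) : Measurable (trunc c : E → E) :=
  Measurable.ite (measurableSet_le measurable_norm measurable_const) measurable_id measurable_const

theorem norm_trunc_le {c : ℝ} (hc : 0 ≤ c) (x : E) : ‖trunc c x‖ ≤ c := by
  unfold trunc; split_ifs with h
  · exact h
  · simpa using hc

theorem norm_le_two_mul_of_norm_partialSum_le {y : ℕ → E} {m : ℝ} (hm : 0 ≤ m) {b : ℕ}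
    (h : ∀ i ∈ Finset.Icc 1 b, ‖partialSum y i‖ ≤ m) {k : ℕ} (hk : k ∈ Finset.Icc 1 b) :
    ‖y k‖ ≤ 2 * m := by
  obtain ⟨hk1, hkb⟩ := Finset.mem_Icc.1 hk
  have := norm_partialSum_sub_le_of_forall_le hk1 hkb (by omega : k - 1 ≤ b) hm h
  obtain ⟨l, rfl⟩ : ∃ l, k = l + 1 := ⟨k - 1, by omega⟩
  rwa [partialSum_succ, Nat.add_sub_cancel, add_sub_cancel_left] at this

/-- If all partial sums stay below `m`, the terms are at most `2 * m` and truncation changes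
nothing. So truncating at `2 * m` does not enlarge the exceptional event. -/
theorem exists_lt_norm_partialSum_of_trunc {y : ℕ → E} {m : ℝ} (hm : 0 ≤ m) {b : ℕ}
    (h : ∃ k ∈ Finset.Icc 1 b, m < ‖partialSum (fun k => trunc (2 * m) (y k)) k‖) :
    ∃ k ∈ Finset.Icc 1 b, m < ‖partialSum y k‖ := by
  by_contra hcon
  simp only [not_exists, not_and, not_lt] at hcon
  obtain ⟨k, hk, hmk⟩ := h
  have : partialSum (fun k => trunc (2 * m) (y k)) k = partialSum y k := by
    refine Finset.sum_congr rfl fun i hi => if_pos ?_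
    refine norm_le_two_mul_of_norm_partialSum_le hm hcon ?_
    rw [Finset.mem_Icc] at hi hk ⊢
    omega
  rw [this] at hmk
  exact absurd (hcon k hk) (not_le.2 hmk)

theorem lintegral_norm_trunc_increment_rpow_le {e : ℕ → Ω → E} (he : ∀ k, Measurable (e k))
    (hind : iIndepFun e P) {m : ℝ} (hm : 0 < m) {a b : ℕ} (hab : a < b) {p : ℝ} (hp : 0 < p)
    (hθ : P {ω | ∃ k ∈ Finset.Icc 1 b, m < ‖partialSum (e · ω) k‖} ≤
      ENNReal.ofReal ((2 / 3) ^ p / 2)) :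
    ∫⁻ ω, ENNReal.ofReal (‖∑ k ∈ Finset.Ioc a b, trunc (2 * m) (e k ω)‖ ^ p) ∂P ≤
      ENNReal.ofReal (2 * (9 / 2 * m) ^ p) := by
  have h := lintegral_norm_increment_rpow_le (x := fun k ω => trunc (2 * m) (e k ω)) (P := P)
    (fun k => (measurable_trunc _).comp (he k))
    (hind.comp (fun _ => trunc (2 * m)) fun _ => measurable_trunc _) hm
    (fun k ω => norm_trunc_le (by linarith) _) hab hp
    (le_trans (measure_mono fun ω => exists_lt_norm_partialSum_of_trunc hm.le) hθ)
  refine le_trans (le_of_eq ?_) h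
  refine lintegral_congr fun ω => ?_
  rw [partialSum_sub _ hab.le]

end Truncation

/-! ### The good-λ inequality. -/

section GoodLambda

variable {Ω E : Type*} {mΩ : MeasurableSpace Ω} [NormedAddCommGroup E] [MeasurableSpace E]
  [BorelSpace E] [SecondCountableTopology E]
  {μ : Measure Ω} [IsProbabilityMeasure μ] {ℱ : Filtration ℕ mΩ} {f g : ℕ → Ω → E}

/-- The event that `max_{1 ≤ k ≤ N} ‖f k‖ > s`. -/
def exceedSet (f : ℕ → Ω → E) (N : ℕ) (s : ℝ) : Set Ω := {ω | ∃ k ∈ Finset.Icc 1 N, s < ‖f k ω‖}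

theorem measurableSet_exceedSet {m : MeasurableSpace Ω} {f : ℕ → Ω → E} {N : ℕ}
    (hf : ∀ k ≤ N, Measurable[m] (f k)) (s : ℝ) : MeasurableSet[m] (exceedSet f N s) := by
  have : exceedSet f N s = ⋃ k ∈ Finset.Icc 1 N, {ω | s < ‖f k ω‖} := by ext; simp [exceedSet]
  rw [this]
  exact @Finset.measurableSet_biUnion _ _ m _ _ fun k hk =>
    measurableSet_lt_norm (hf k (Finset.mem_Icc.1 hk).2) s

theorem exceedSet_mono (f : ℕ → Ω → E) {M N : ℕ} (h : M ≤ N) (s : ℝ) :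
    exceedSet f M s ⊆ exceedSet f N s := fun _ ⟨k, hk, hs⟩ =>
  ⟨k, Finset.Icc_subset_Icc_right h hk, hs⟩

theorem partialSum_diffSeq {f : ℕ → Ω → E} (h0 : f 0 = 0) (n : ℕ) (ω : Ω) :
    partialSum (fun k => diffSeq f k ω) n = f n ω := by
  induction n with
  | zero => simp [partialSum_zero, h0]
  | succ n ih => rw [partialSum_succ, ih]; simp [diffSeq]

/-- The decoupling inequality for all bounded adapted sequences on a fixed filtered space. -/
def BoundedDecoupling (E : Type*) [NormedAddCommGroup E] [MeasurableSpace E] (μ : Measure Ω)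
    (ℱ : Filtration ℕ mΩ) (p D : ℝ) : Prop :=
  ∀ f g : ℕ → Ω → E, IsDecoupledSum μ ℱ f g → (∀ n, ∃ C, ∀ ω, ‖f n ω‖ ≤ C) → ∀ n, 1 ≤ n →
    ∫⁻ ω, ENNReal.ofReal (‖f n ω‖ ^ p) ∂μ ≤
      ENNReal.ofReal (D ^ p) * ∫⁻ ω, ENNReal.ofReal (‖g n ω‖ ^ p) ∂μ

/-- For fixed `ω`, the indices kept by the transform form one block, so the transformed sum is a
single increment of partial sums. -/
theorem filter_Icc_eq_Ioc_of_ordConnected {N : ℕ} {V : ℕ → Prop} [DecidablePred V]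
    (hV : ∀ i j k, i ≤ j → j ≤ k → V i → V k → V j)
    (hne : ((Finset.Icc 1 N).filter V).Nonempty) :
    ∃ a b, a < b ∧ b ∈ Finset.Icc 1 N ∧ V b ∧ (Finset.Icc 1 N).filter V = Finset.Ioc a b := by
  set s := (Finset.Icc 1 N).filter V with hs
  have hmin := Finset.mem_filter.1 (s.min'_mem hne)
  have hmax := Finset.mem_filter.1 (s.max'_mem hne)
  have hmm : s.min' hne ≤ s.max' hne := s.min'_le_max' hne
  rw [Finset.mem_Icc] at hmin hmax
  refine ⟨s.min' hne - 1, s.max' hne, by omega, Finset.mem_Icc.2 hmax.1, hmax.2, ?_⟩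
  ext k
  rw [Finset.mem_Ioc]
  constructor
  · intro hk
    have h1 := s.min'_le k hk
    have h2 := s.le_max' k hk
    omega
  · rintro ⟨h1, h2⟩
    rw [hs, Finset.mem_filter, Finset.mem_Icc]
    exact ⟨by omega, hV _ _ _ (by omega) h2 hmin.2 hmax.2⟩

end GoodLambda

section GoodLambdaInequality

variable {Ω E : Type*} {mΩ : MeasurableSpace Ω} [NormedAddCommGroup E] [MeasurableSpace E]
  [BorelSpace E] [SecondCountableTopology E] [CompleteSpace E]
  {μ : Measure Ω} [IsProbabilityMeasure μ] {ℱ : Filtration ℕ mΩ} {f g : ℕ → Ω → E}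

/-- Here `t` and `s` are the first passages above `l` and `β * l`. The overshoot at `t` is at most
`2 * m`. Membership in `(t, s]` is described through indices up to `k - 1` only, hence predictably.
-/
theorem norm_sub_first_passage_ge {y : ℕ → E} (h0 : y 0 = 0) {N : ℕ} {l β m : ℝ} (hl : 0 < l)
    (hβ : 1 ≤ β) (hd : ∀ k ∈ Finset.Icc 1 N, ‖y k - y (k - 1)‖ ≤ 2 * m)
    (hex : ∃ k ∈ Finset.Icc 1 N, β * l < ‖y k‖) :
    ∃ t s, t ≤ s ∧ s ≤ N ∧ (β - 1) * l - 2 * m ≤ ‖y s - y t‖ ∧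
      ∀ k, (t < k ∧ k ≤ s ↔ (∃ j ∈ Finset.Icc 1 (k - 1), l < ‖y j‖) ∧
        ∀ j ∈ Finset.Icc 1 (k - 1), ‖y j‖ ≤ β * l) := by
  classical
  have hlβ : l ≤ β * l := by nlinarith
  have hs : ∃ k, 1 ≤ k ∧ β * l < ‖y k‖ := by
    obtain ⟨k, hk, h⟩ := hex
    exact ⟨k, (Finset.mem_Icc.1 hk).1, h⟩
  have ht : ∃ k, 1 ≤ k ∧ l < ‖y k‖ := hs.imp fun k h => ⟨h.1, hlβ.trans_lt h.2⟩
  set s := Nat.find hs with hsdef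
  set t := Nat.find ht with htdef
  obtain ⟨hs1, hsβ⟩ : 1 ≤ s ∧ β * l < ‖y s‖ := Nat.find_spec hs
  obtain ⟨ht1, htl⟩ : 1 ≤ t ∧ l < ‖y t‖ := Nat.find_spec ht
  have hsmin : ∀ j, 1 ≤ j → j < s → ‖y j‖ ≤ β * l := fun j hj hjs => by
    by_contra hcon
    exact Nat.find_min hs hjs ⟨hj, not_le.1 hcon⟩
  have htmin : ∀ j, 1 ≤ j → j < t → ‖y j‖ ≤ l := fun j hj hjt => by
    by_contra hcon
    exact Nat.find_min ht hjt ⟨hj, not_le.1 hcon⟩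
  have hts : t ≤ s := Nat.find_min' ht ⟨hs1, hlβ.trans_lt hsβ⟩
  have hsN : s ≤ N := by
    obtain ⟨k, hk, h⟩ := hex
    exact (Nat.find_min' hs ⟨(Finset.mem_Icc.1 hk).1, h⟩).trans (Finset.mem_Icc.1 hk).2
  refine ⟨t, s, hts, hsN, ?_, fun k => ?_⟩
  · have h1 : ‖y (t - 1)‖ ≤ l := by
      rcases Nat.eq_zero_or_pos (t - 1) with h | h
      · rw [h, h0, norm_zero]; exact hl.le
      · exact htmin _ h (by omega)
    have h2 := hd t (Finset.mem_Icc.2 ⟨ht1, hts.trans hsN⟩)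
    have h3 : ‖y t‖ ≤ ‖y t - y (t - 1)‖ + ‖y (t - 1)‖ := by
      simpa using norm_add_le (y t - y (t - 1)) (y (t - 1))
    have h4 : ‖y s‖ ≤ ‖y s - y t‖ + ‖y t‖ := by
      simpa using norm_add_le (y s - y t) (y t)
    nlinarith
  · constructor
    · rintro ⟨h1, h2⟩
      refine ⟨⟨t, Finset.mem_Icc.2 ⟨ht1, by omega⟩, htl⟩, fun j hj => ?_⟩
      rw [Finset.mem_Icc] at hj
      exact hsmin j hj.1 (by omega)
    · rintro ⟨⟨j, hj, hjl⟩, h2⟩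
      rw [Finset.mem_Icc] at hj
      have h3 : t ≤ j := Nat.find_min' ht ⟨hj.1, hjl⟩
      refine ⟨by omega, ?_⟩
      by_contra hcon
      exact absurd (h2 s (Finset.mem_Icc.2 ⟨hs1, by omega⟩)) (not_le.2 hsβ)

theorem measure_exceedSet_le (hfg : IsDecoupledSum μ ℱ f g) {p D : ℝ} (hp : 0 < p) (hD : 0 ≤ D)
    (H : BoundedDecoupling E μ ℱ p D) {N : ℕ} (hN : 1 ≤ N) {l β δ : ℝ} (hl : 0 < l)
    (hδ : 0 < δ) (hδβ : 4 * δ ≤ β - 1) :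
    μ (exceedSet f N (β * l)) ≤
      ENNReal.ofReal (2 * (9 * D * δ / (β - 1)) ^ p) * μ (exceedSet f N l) +
      ENNReal.ofReal (2 + 2 * (3 / 2) ^ p) * μ (exceedSet g N (δ * l)) := by
  classical
  obtain ⟨κ, _, hκ⟩ := exists_isTangentKernel hfg
  set m : ℝ := δ * l with hm
  have hm0 : 0 < m := by positivity
  have hβ : 1 < β := by linarith
  set d := diffSeq f with hd
  set e := diffSeq g with he
  have hdm : ∀ n, Measurable[ℱ n] (d n) := hfg.measurable_diff_left
  have hem : ∀ n, Measurable (e n) := hfg.measurable_diff_right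
  have hfm : ∀ n, Measurable[ℱ n] (f n) := hfg.measurable_left
  -- The threshold required by the moment bound for independent variables.
  set θ : ℝ := (2 / 3) ^ p / 2 with hθ
  have hθ0 : 0 < θ := by positivity
  set ν : Ω → Measure (ℕ → E) := fun ω => Measure.infinitePi fun k => κ k ω with hν
  set B : ℕ → Set (ℕ → E) := fun n => {x | ∃ k ∈ Finset.Icc 1 n, m < ‖partialSum x k‖} with hB
  have hBm : ∀ n, MeasurableSet (B n) := fun n => by
    have : B n = exceedSet (fun k (x : ℕ → E) => partialSum x k) n m := rfl
    rw [this]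
    exact measurableSet_exceedSet (fun k _ =>
      measurable_partialSum (x := fun i (x : ℕ → E) => x i) k fun i _ _ => measurable_pi_apply i) m
  have hBmono : ∀ {i j}, i ≤ j → B i ⊆ B j := fun h =>
    exceedSet_mono (fun k (x : ℕ → E) => partialSum x k) h m
  set G : ℕ → Ω → ℝ≥0∞ := fun n ω => ν ω (B n) with hG
  have hGm : ∀ n, Measurable[ℱ (n - 1)] (G n) := fun n => by
    refine hκ.measurable_measure_of_trunc n (hBm n) fun x => ?_
    simp only [hB, Set.mem_ofPred_eq]
    refine exists_congr fun k => and_congr_right fun hk => ?_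
    have : partialSum (fun k => if k ≤ n then x k else 0) k = partialSum x k :=
      Finset.sum_congr rfl fun i hi => if_pos (by rw [Finset.mem_Icc] at hi hk; omega)
    rw [this]
  have hGmono : ∀ {i j} ω, i ≤ j → G i ω ≤ G j ω := fun ω h => measure_mono (hBmono h)
  -- The first condition is increasing in `k` and the other two are decreasing, so the active
  -- indices form an interval. At its last index `b` the condition on `G b` bounds the conditional
  -- probability for the whole block.
  set V : ℕ → Set Ω := fun k => exceedSet f (k - 1) l ∩ (exceedSet f (k - 1) (β * l))ᶜ ∩
    {ω | G k ω ≤ ENNReal.ofReal θ} with hV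
  have hVm : ∀ k, MeasurableSet[ℱ (k - 1)] (V k) := fun k => by
    have h1 : ∀ i ≤ k - 1, Measurable[ℱ (k - 1)] (f i) := fun i hi =>
      (hfm i).mono (ℱ.mono hi) le_rfl
    exact ((measurableSet_exceedSet h1 l).inter (measurableSet_exceedSet h1 (β * l)).compl).inter
      (hGm k measurableSet_Iic)
  have hVoc : ∀ ω i j k, i ≤ j → j ≤ k → ω ∈ V i → ω ∈ V k → ω ∈ V j := by
    rintro ω i j k hij hjk ⟨⟨h1, -⟩, -⟩ ⟨⟨-, h2⟩, h3⟩
    exact ⟨⟨exceedSet_mono f (by omega) l h1, fun h => h2 (exceedSet_mono f (by omega) _ h)⟩,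
      (hGmono ω hjk).trans h3⟩
  set φ : ℕ → Ω → E → E := fun k ω x => if ω ∈ V k then trunc (2 * m) x else 0 with hφ
  have hφm : ∀ k, 1 ≤ k → Measurable[(ℱ (k - 1)).prod inferInstance] (Function.uncurry (φ k)) :=
    fun k _ => Measurable.ite ((@measurable_fst Ω E (ℱ (k - 1)) _) (hVm k))
      ((measurable_trunc _).comp (@measurable_snd Ω E (ℱ (k - 1)) _)) measurable_const
  have hdec : IsDecoupledSum μ ℱ (transformSum φ d) (transformSum φ e) :=
    hκ.isDecoupledSum_transformSum hfg.filtration_zero hdm hem hφm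
  have hsum : ∀ (y : ℕ → E) ω, ∑ k ∈ Finset.Icc 1 N, φ k ω (y k) =
      ∑ k ∈ (Finset.Icc 1 N).filter (fun k => ω ∈ V k), trunc (2 * m) (y k) := fun y ω => by
    rw [Finset.sum_filter]
  -- Truncation makes the transformed sequence bounded, so no integrability of `f` is needed.
  have hH := H _ _ hdec (fun n => ⟨∑ k ∈ Finset.Icc 1 n, 2 * m, fun ω => by
    refine (norm_sum_le _ _).trans (Finset.sum_le_sum fun k _ => ?_)
    simp only [hφ]
    split_ifs
    · exact norm_trunc_le (by linarith) _
    · simpa using hm0.le⟩) N hN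
  -- upper bound for the transformed decoupled sum
  have hupper : ∫⁻ ω, ENNReal.ofReal (‖transformSum φ e N ω‖ ^ p) ∂μ ≤
      ENNReal.ofReal (2 * (9 / 2 * m) ^ p) * μ (exceedSet f N l) := by
    have hmeas : Measurable[(⨆ k, ℱ k).prod inferInstance] (Function.uncurry
        fun ω (x : ℕ → E) => ENNReal.ofReal (‖∑ k ∈ Finset.Icc 1 N, φ k ω (x k)‖ ^ p)) := by
      have h1 : Measurable[(⨆ k, ℱ k).prod inferInstance]
          fun z : Ω × (ℕ → E) => ∑ k ∈ Finset.Icc 1 N, φ k z.1 (z.2 k) := by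
        refine @Finset.measurable_sum _ _ _ _ _ _ ((⨆ k, ℱ k).prod inferInstance) _ _ fun k hk => ?_
        have h2 : Measurable[(⨆ k, ℱ k).prod inferInstance, (ℱ (k - 1)).prod inferInstance]
            fun z : Ω × (ℕ → E) => (z.1, z.2 k) :=
          @Measurable.prodMk _ ((⨆ k, ℱ k).prod inferInstance) _ _ (ℱ (k - 1)) _ _ _
            ((@measurable_fst _ _ (⨆ k, ℱ k) _).mono le_rfl (filtration_le_iSup ℱ _))
            ((measurable_pi_apply k).comp (@measurable_snd _ _ (⨆ k, ℱ k) _))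
        exact (hφm k (Finset.mem_Icc.1 hk).1).comp h2
      exact (ENNReal.measurable_ofReal.comp ((measurable_norm.comp h1).pow_const p))
    have := hκ.lintegral_right _ hmeas
    rw [show (∫⁻ ω, ENNReal.ofReal (‖transformSum φ e N ω‖ ^ p) ∂μ) =
      ∫⁻ ω, ENNReal.ofReal (‖∑ k ∈ Finset.Icc 1 N, φ k ω (e k ω)‖ ^ p) ∂μ from rfl, this]
    have hEm : MeasurableSet (exceedSet f N l) :=
      measurableSet_exceedSet (fun k _ => (hfm k).mono (ℱ.le k) le_rfl) l
    rw [← lintegral_indicator_const hEm]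
    refine lintegral_mono fun ω => ?_
    simp only [hsum]
    rcases ((Finset.Icc 1 N).filter (fun k => ω ∈ V k)).eq_empty_or_nonempty with hemp | hne
    · simp [hemp, Real.zero_rpow hp.ne']
    · obtain ⟨a, b, hab, hb, hVb, heq⟩ :=
        filter_Icc_eq_Ioc_of_ordConnected (hVoc ω) hne
      have hmem : ω ∈ exceedSet f N l :=
        exceedSet_mono f (by have := Finset.mem_Icc.1 hb; omega) l hVb.1.1
      rw [heq, Set.indicator_of_mem hmem]
      exact lintegral_norm_trunc_increment_rpow_le (e := fun k (x : ℕ → E) => x k)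
        (fun k => measurable_pi_apply k)
        (iIndepFun_infinitePi (P := fun k => κ k ω) (X := fun _ x => x) fun _ => measurable_id)
        hm0 hab hp hVb.2
  -- lower bound for the transformed sum on the good event
  set A : Set Ω := exceedSet f N (β * l) ∩ (exceedSet d N (2 * m))ᶜ ∩
    {ω | G N ω ≤ ENNReal.ofReal θ} with hA
  have hAlow : ∀ ω ∈ A, (β - 1) / 2 * l ≤ ‖transformSum φ d N ω‖ := by
    rintro ω ⟨⟨h1, h2⟩, h3⟩
    simp only [exceedSet, Set.mem_compl_iff, Set.mem_ofPred_eq, not_exists, not_and, not_lt] at h2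
    obtain ⟨t, s, hts, hsN, hlow, hiff⟩ := norm_sub_first_passage_ge (y := fun k => f k ω) (m := m)
      (by simp [hfg.f_zero]) hl hβ.le h2 h1
    have hfilter : (Finset.Icc 1 N).filter (fun k => ω ∈ V k) = Finset.Ioc t s := by
      ext k
      rw [Finset.mem_filter, Finset.mem_Icc, Finset.mem_Ioc, hiff k]
      have hVk : ω ∈ V k ↔ ((∃ j ∈ Finset.Icc 1 (k - 1), l < ‖f j ω‖) ∧
          ∀ j ∈ Finset.Icc 1 (k - 1), ‖f j ω‖ ≤ β * l) ∧ G k ω ≤ ENNReal.ofReal θ := by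
        simp only [hV, exceedSet, Set.mem_inter_iff, Set.mem_compl_iff, Set.mem_ofPred_eq,
          not_exists, not_and, not_lt]
      rw [hVk]
      constructor
      · exact fun h => h.2.1
      · intro h
        have hk := (hiff k).2 h
        exact ⟨⟨by omega, by omega⟩, h, (hGmono ω (by omega)).trans h3⟩
    have htr : transformSum φ d N ω = f s ω - f t ω := by
      rw [transformSum, hsum (fun k => d k ω), hfilter, ← partialSum_diffSeq hfg.f_zero s,
        ← partialSum_diffSeq hfg.f_zero t, partialSum_sub _ hts]
      refine Finset.sum_congr rfl fun k hk => if_pos (h2 k ?_)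
      rw [Finset.mem_Ioc] at hk
      exact Finset.mem_Icc.2 ⟨by omega, by omega⟩
    rw [htr]
    refine le_trans ?_ hlow
    rw [hm]
    -- The assumption `4 * δ ≤ β - 1` absorbs the overshoot `2 * m` into half of `(β - 1) * l`.
    nlinarith
  have hc0 : 0 < ((β - 1) / 2 * l) ^ p := by
    have : 0 < (β - 1) / 2 * l := mul_pos (by linarith) hl
    positivity
  have hAmeas : μ A ≤ ENNReal.ofReal (2 * (9 * D * δ / (β - 1)) ^ p) * μ (exceedSet f N l) := by
    have h1 : ENNReal.ofReal (((β - 1) / 2 * l) ^ p) * μ A ≤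
        ∫⁻ ω, ENNReal.ofReal (‖transformSum φ d N ω‖ ^ p) ∂μ := by
      have hm1 : Measurable fun ω => ENNReal.ofReal (‖transformSum φ d N ω‖ ^ p) :=
        (((hdec.measurable_left N).mono (ℱ.le N) le_rfl).norm.pow_const p).ennreal_ofReal
      refine le_trans ?_ (mul_meas_ge_le_lintegral hm1
        (ENNReal.ofReal (((β - 1) / 2 * l) ^ p)))
      gcongr
      intro ω hω
      refine ENNReal.ofReal_le_ofReal (Real.rpow_le_rpow ?_ (hAlow ω hω) hp.le)
      exact mul_nonneg (by linarith) hl.le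
    have h2 := h1.trans (hH.trans (mul_le_mul_right hupper _))
    rw [← mul_assoc, ← ENNReal.ofReal_mul (by positivity)] at h2
    rw [mul_comm, ← ENNReal.le_div_iff_mul_le (by simp [hc0]) (by simp)] at h2
    refine h2.trans (le_of_eq ?_)
    rw [mul_comm, mul_div_assoc, mul_comm, ← ENNReal.ofReal_div_of_pos hc0]
    congr 2
    rw [mul_left_comm, ← Real.mul_rpow hD (by positivity), mul_div_assoc, ← Real.div_rpow
      (by positivity) (mul_nonneg (by linarith) hl.le)]
    congr 2
    have : β - 1 ≠ 0 := by linarith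
    rw [hm]
    field_simp
  -- the exceptional events
  have hgm : ∀ n, Measurable (g n) := fun n => by
    have : g n = fun ω => partialSum (fun k => e k ω) n :=
      funext fun ω => (partialSum_diffSeq hfg.g_zero n ω).symm
    rw [this]
    exact measurable_partialSum n fun k _ _ => hem k
  have hgB : exceedSet g N m = {ω | (fun k => e k ω) ∈ B N} := by
    ext ω
    simp only [exceedSet, hB, Set.mem_ofPred_eq, he, partialSum_diffSeq hfg.g_zero]
  -- Jumps of `f` are compared with jumps of `g`, and a jump of `g` above `2 * m` needs one of its
  -- two adjacent values to exceed `m`.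
  have hjump : μ (exceedSet d N (2 * m)) ≤ 2 * μ (exceedSet g N m) := by
    refine (hκ.measure_exists_norm_gt_le hdm hem (2 * m) N).trans ?_
    gcongr
    rintro ω ⟨k, hk, hke⟩
    by_contra hcon
    simp only [exceedSet, Set.mem_ofPred_eq, not_exists, not_and, not_lt] at hcon
    refine absurd (norm_le_two_mul_of_norm_partialSum_le (y := fun k => e k ω) hm0.le
      (b := N) (fun i hi => ?_) hk) (not_le.2 hke)
    rw [he, partialSum_diffSeq hfg.g_zero]
    exact hcon i hi
  have hGint : ∫⁻ ω, G N ω ∂μ = μ (exceedSet g N m) := by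
    rw [hgB, hκ.measure_right hem (hBm N)]
  -- Markov's inequality for the conditional probability `G N`, with `1 / θ = 2 * (3 / 2) ^ p`.
  have hGbad : μ {ω | G N ω ≤ ENNReal.ofReal θ}ᶜ ≤
      ENNReal.ofReal (2 * (3 / 2) ^ p) * μ (exceedSet g N m) := by
    have h1 := mul_meas_ge_le_lintegral (μ := μ) ((hGm N).mono (ℱ.le _) le_rfl) (ENNReal.ofReal θ)
    rw [hGint, mul_comm, ← ENNReal.le_div_iff_mul_le (by simp [hθ0]) (by simp)] at h1
    refine le_trans (measure_mono fun ω hω => ?_) (h1.trans (le_of_eq ?_))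
    · simp only [Set.mem_compl_iff, Set.mem_ofPred_eq, not_le] at hω ⊢
      exact hω.le
    · rw [ENNReal.div_eq_inv_mul, ← ENNReal.ofReal_inv_of_pos hθ0, hθ, inv_div,
        div_eq_mul_inv, ← Real.inv_rpow (by norm_num)]
      norm_num
  calc μ (exceedSet f N (β * l))
      ≤ μ (A ∪ (exceedSet d N (2 * m) ∪ {ω | G N ω ≤ ENNReal.ofReal θ}ᶜ)) := by
        refine measure_mono fun ω hω => ?_
        by_cases h1 : ω ∈ exceedSet d N (2 * m)
        · exact Or.inr (Or.inl h1)
        · by_cases h2 : G N ω ≤ ENNReal.ofReal θ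
          · exact Or.inl ⟨⟨hω, h1⟩, h2⟩
          · exact Or.inr (Or.inr h2)
    _ ≤ μ A + (μ (exceedSet d N (2 * m)) + μ {ω | G N ω ≤ ENNReal.ofReal θ}ᶜ) :=
        (measure_union_le _ _).trans (add_le_add le_rfl (measure_union_le _ _))
    _ ≤ _ := by
        refine add_le_add hAmeas ((add_le_add hjump hGbad).trans (le_of_eq ?_))
        rw [ENNReal.ofReal_add (by norm_num) (by positivity), add_mul]
        norm_num

end GoodLambdaInequality

/-! ### Recentered sums of independent variables. -/

section Recentering

variable {Ω E : Type*} {mΩ : MeasurableSpace Ω} [NormedAddCommGroup E] [MeasurableSpace E]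
  [BorelSpace E] [SecondCountableTopology E] {P : Measure Ω} [IsProbabilityMeasure P]

theorem indepFun_partialSum_increment {x : ℕ → Ω → E} (hx : ∀ k, Measurable (x k))
    (hind : iIndepFun x P) (k N : ℕ) :
    IndepFun (fun ω => partialSum (x · ω) k) (fun ω => ∑ i ∈ Finset.Ioc k N, x i ω) P := by
  rw [IndepFun_iff_Indep]
  have h := indep_iSup_of_disjoint (fun i => (hx i).comap_le) hind.iIndep
    (S := Set.Iic k) (T := Set.Ioi k) (Set.disjoint_left.2 fun i hi hi' =>
      absurd (lt_of_lt_of_le (Set.mem_Ioi.1 hi') (Set.mem_Iic.1 hi)) (lt_irrefl _))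
  refine indep_of_indep_of_le_left (indep_of_indep_of_le_right h ?_) ?_
  · refine Measurable.comap_le ?_
    exact @Finset.measurable_sum _ _ _ _ _ _ (⨆ i ∈ Set.Ioi k, _) _ _ fun i hi =>
      measurable_of_mem_iSup_comap (Finset.mem_Ioc.1 hi).1
  · exact Measurable.comap_le
      (measurable_partialSum _ fun i _ hi => measurable_of_mem_iSup_comap hi)

/-- By Fubini the right-hand side is the average of the left-hand side over the law of `Z`, and some
value does not exceed the average. -/
theorem IndepFun.exists_measure_norm_add_gt_le {Y Z : Ω → E} (hY : Measurable Y)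
    (hZ : Measurable Z) (h : IndepFun Y Z P) (t : ℝ) :
    ∃ z : E, P {ω | t < ‖Y ω + z‖} ≤ P {ω | t < ‖Y ω + Z ω‖} := by
  have hPZ : IsProbabilityMeasure (P.map Z) := Measure.isProbabilityMeasure_map hZ.aemeasurable
  have hPY : IsProbabilityMeasure (P.map Y) := Measure.isProbabilityMeasure_map hY.aemeasurable
  have hset : MeasurableSet {z : E × E | t < ‖z.1 + z.2‖} :=
    measurableSet_lt measurable_const (measurable_fst.add measurable_snd).norm
  have hmap := (indepFun_iff_map_prod_eq_prod_map_map hY.aemeasurable hZ.aemeasurable).1 h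
  have h1 : P {ω | t < ‖Y ω + Z ω‖} = ∫⁻ z, P {ω | t < ‖Y ω + z‖} ∂(P.map Z) := by
    calc _ = P.map (fun ω => (Y ω, Z ω)) {z : E × E | t < ‖z.1 + z.2‖} := by
          rw [Measure.map_apply (hY.prodMk hZ) hset]; rfl
      _ = _ := by
          rw [hmap, Measure.prod_apply_symm hset]
          refine lintegral_congr fun z => ?_
          rw [Measure.map_apply hY (measurable_prodMk_right hset)]
          rfl
  rw [h1]
  refine exists_le_lintegral (Measurable.aemeasurable ?_)
  have : ∀ z, P {ω | t < ‖Y ω + z‖} = P.map Y ((fun y => (y, z)) ⁻¹' {z : E × E | t < ‖z.1 + z.2‖}) :=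
    fun z => by rw [Measure.map_apply hY (measurable_prodMk_right hset)]; rfl
  simp_rw [this]
  exact measurable_measure_prodMk_right hset

theorem exists_center {x : ℕ → Ω → E} (hx : ∀ k, Measurable (x k))
    (hind : iIndepFun x P) {N k : ℕ} (hkN : k ≤ N) (t : ℝ) :
    ∃ s : E, P {ω | t < ‖partialSum (x · ω) k - s‖} ≤ P {ω | t < ‖partialSum (x · ω) N‖} := by
  obtain ⟨z, hz⟩ := IndepFun.exists_measure_norm_add_gt_le
    (measurable_partialSum k fun i _ _ => hx i)
    (Finset.measurable_sum _ fun i _ => hx i) (indepFun_partialSum_increment hx hind k N) t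
  refine ⟨-z, ?_⟩
  simp only [sub_neg_eq_add]
  refine hz.trans (le_of_eq ?_)
  congr 1
  ext ω
  simp only [Set.mem_ofPred_eq]
  rw [← partialSum_sub _ hkN, add_sub_cancel]

/-- The two events together have probability below `1`; compare `s` and `c` through the value of `Y`
at a point outside both. -/
theorem norm_sub_le_of_measure_gt_le_quarter {Y : Ω → E} {s c : E} {t u : ℝ}
    (hs : P {ω | t < ‖Y ω - s‖} ≤ 4⁻¹) (hc : P {ω | u < ‖Y ω - c‖} ≤ 4⁻¹) :
    ‖s - c‖ ≤ t + u := by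
  have h2 : P ({ω | t < ‖Y ω - s‖} ∪ {ω | u < ‖Y ω - c‖}) < 1 := by
    refine (measure_union_le _ _).trans_lt ((add_le_add hs hc).trans_lt ?_)
    rw [← two_mul, show (4 : ℝ≥0∞) = 2 * 2 by norm_num,
      ENNReal.mul_inv (by simp) (by simp), ← mul_assoc,
      ENNReal.mul_inv_cancel (by simp) (by simp), one_mul]
    exact ENNReal.inv_lt_one.2 (by norm_num)
  obtain ⟨ω, hω⟩ : ∃ ω, ω ∉ {ω | t < ‖Y ω - s‖} ∪ {ω | u < ‖Y ω - c‖} := by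
    by_contra hcon
    push Not at hcon
    rw [Set.eq_univ_of_forall hcon, measure_univ] at h2
    exact lt_irrefl _ h2
  simp only [Set.mem_union, Set.mem_ofPred_eq, not_or, not_lt] at hω
  have h3 : ‖s - c‖ ≤ ‖s - Y ω‖ + ‖Y ω - c‖ := norm_sub_le_norm_sub_add_norm_sub ..
  rw [norm_sub_rev s (Y ω)] at h3
  linarith [hω.1, hω.2]

/-- An Ottaviani type inequality for recentered partial sums of independent variables. -/
theorem measure_exists_centered_gt_le {x : ℕ → Ω → E} (hx : ∀ k, Measurable (x k))
    (hind : iIndepFun x P) {N : ℕ} {t : ℝ} {s : ℕ → E}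
    (hs : ∀ k ∈ Finset.Icc 1 N,
      P {ω | t < ‖partialSum (x · ω) k - s k‖} ≤ P {ω | t < ‖partialSum (x · ω) N‖})
    (hsmall : P {ω | t < ‖partialSum (x · ω) N‖} ≤ 4⁻¹) :
    P {ω | ∃ k ∈ Finset.Icc 1 N, 3 * t < ‖partialSum (x · ω) k - s k‖} ≤
      2 * P {ω | t < ‖partialSum (x · ω) N‖} := by
  obtain ⟨ψ, hψ⟩ : ∃ ψ, ψ = P {ω | t < ‖partialSum (x · ω) N‖} := ⟨_, rfl⟩
  rw [← hψ] at hs hsmall ⊢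
  obtain ⟨A, hA⟩ : ∃ A : ℕ → Set Ω, A = fun k => {ω | 3 * t < ‖partialSum (x · ω) k - s k‖} :=
    ⟨_, rfl⟩
  obtain ⟨R, hR⟩ : ∃ R : ℕ → Set Ω,
    R = fun k => {ω | 2 * t < ‖(∑ i ∈ Finset.Ioc k N, x i ω) + s k‖} := ⟨_, rfl⟩
  have hAm : ∀ k ∈ Finset.Icc 1 N, MeasurableSet[⨆ i ∈ Set.Iic k,
      MeasurableSpace.comap (x i) inferInstance] (A k) := fun k _ => by
    rw [hA]
    exact measurableSet_lt_norm ((measurable_partialSum k fun i _ hi =>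
      measurable_of_mem_iSup_comap hi).sub measurable_const) _
  have hRm : ∀ k ∈ Finset.Icc 1 N, MeasurableSet[⨆ i ∈ Set.Ioi k,
      MeasurableSpace.comap (x i) inferInstance] (R k) := fun k _ => by
    rw [hR]
    refine measurableSet_lt_norm (Measurable.add ?_ measurable_const) _
    exact @Finset.measurable_sum _ _ _ _ _ _ (⨆ i ∈ Set.Ioi k, _) _ _ fun i hi =>
        measurable_of_mem_iSup_comap (Finset.mem_Ioc.1 hi).1
  -- The vector defining `R k` is the difference of `partialSum (x · ω) N` and the centered `k`-th
  -- sum; each has norm above `t` with probability at most `ψ`.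
  have hRP : ∀ k ∈ Finset.Icc 1 N, P (R k) ≤ 2 * ψ := fun k hk => by
    calc P (R k) ≤ P ({ω | t < ‖partialSum (x · ω) N‖} ∪
          {ω | t < ‖partialSum (x · ω) k - s k‖}) := by
          refine measure_mono fun ω hω => ?_
          by_contra hcon
          simp only [Set.mem_union, Set.mem_ofPred_eq, not_or, not_lt] at hcon
          simp only [hR, Set.mem_ofPred_eq] at hω
          rw [← partialSum_sub _ (Finset.mem_Icc.1 hk).2] at hω
          have : partialSum (x · ω) N - partialSum (x · ω) k + s k =
            partialSum (x · ω) N - (partialSum (x · ω) k - s k) := by abel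
          rw [this] at hω
          linarith [norm_sub_le (partialSum (x · ω) N) (partialSum (x · ω) k - s k),
            hcon.1, hcon.2]
      _ ≤ ψ + ψ := (measure_union_le _ _).trans (add_le_add hψ.ge (hs k hk))
      _ = 2 * ψ := (two_mul ψ).symm
  have hfirst := measure_first_inter_le (fun i => (hx i).comap_le) hind.iIndep hAm hRm hRP
  have hgoal : {ω | ∃ k ∈ Finset.Icc 1 N, 3 * t < ‖partialSum (x · ω) k - s k‖} =
      {ω | ∃ k ∈ Finset.Icc 1 N, ω ∈ A k} := by rw [hA]; rfl
  rw [hgoal]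
  obtain ⟨Q, hQ⟩ : ∃ Q, Q = P {ω | ∃ k ∈ Finset.Icc 1 N, ω ∈ A k} := ⟨_, rfl⟩
  -- At the first `k` with `A k`, either the final sum exceeds `t` or the independent event `R k`
  -- occurs. Since `ψ ≤ 1 / 4`, this yields `Q ≤ 2 * ψ`.
  have hQle : Q ≤ ψ + 2 * ψ * Q := by
    rw [← hQ] at hfirst
    rw [hQ]
    refine le_trans (measure_mono ?_) ((measure_union_le {ω | t < ‖partialSum (x · ω) N‖} _).trans
      (add_le_add hψ.ge (hQ ▸ hfirst)))
    intro ω hω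
    by_cases hN : t < ‖partialSum (x · ω) N‖
    · exact Or.inl hN
    right
    classical
    have hex : ∃ k, 1 ≤ k ∧ k ≤ N ∧ ω ∈ A k := by
      obtain ⟨k, hk, h⟩ := hω
      exact ⟨k, (Finset.mem_Icc.1 hk).1, (Finset.mem_Icc.1 hk).2, h⟩
    obtain ⟨h1, h2, h3⟩ := Nat.find_spec hex
    refine ⟨Nat.find hex, Finset.mem_Icc.2 ⟨h1, h2⟩, h3, fun j hj hjA => ?_, ?_⟩
    · rw [Finset.mem_Ico] at hj
      exact Nat.find_min hex hj.2 ⟨hj.1, by omega, hjA⟩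
    · generalize Nat.find hex = k at h1 h2 h3 ⊢
      simp only [hR, hA, Set.mem_ofPred_eq] at h3 ⊢
      rw [← partialSum_sub _ h2]
      have : partialSum (x · ω) k - s k =
        partialSum (x · ω) N - (partialSum (x · ω) N - partialSum (x · ω) k + s k) := by abel
      rw [this] at h3
      linarith [norm_sub_le (partialSum (x · ω) N)
        (partialSum (x · ω) N - partialSum (x · ω) k + s k)]
  rw [← hQ]
  have hψt : ψ ≠ ∞ := hψ ▸ measure_ne_top _ _
  have hQt : Q ≠ ∞ := hQ ▸ measure_ne_top _ _
  have h1 : ψ.toReal ≤ 1 / 4 := by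
    have := ENNReal.toReal_mono (by simp) hsmall
    simpa using this
  have h2 : Q.toReal ≤ ψ.toReal + 2 * ψ.toReal * Q.toReal := by
    have := ENNReal.toReal_mono (by finiteness) hQle
    rwa [ENNReal.toReal_add hψt (by finiteness), ENNReal.toReal_mul, ENNReal.toReal_mul,
      ENNReal.toReal_ofNat] at this
  rw [← ENNReal.toReal_le_toReal hQt (by finiteness), ENNReal.toReal_mul, ENNReal.toReal_ofNat]
  nlinarith [ENNReal.toReal_nonneg (a := Q), ENNReal.toReal_nonneg (a := ψ)]

/-- The optimal centers depend on `t`, while `c` must serve all levels. Both are near-medians, so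
they differ by at most `2 * t + 2 * η`, which is added to the `3 * t` of the centered inequality. If
the final tail exceeds `1 / 4`, the factor `4` makes the claim trivial. -/
theorem measure_exists_recentered_gt_le {x : ℕ → Ω → E} (hx : ∀ k, Measurable (x k))
    (hind : iIndepFun x P) {N : ℕ} {t η : ℝ} (ht : 0 ≤ t) (hη : 0 ≤ η) {c : ℕ → E} (hcN : c N = 0)
    (hc : ∀ k, 1 ≤ k → k < N → ∀ s : E, P {ω | t < ‖partialSum (x · ω) k - s‖} ≤ 4⁻¹ →
      P {ω | t + 2 * η < ‖partialSum (x · ω) k - c k‖} ≤ 4⁻¹) :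
    P {ω | ∃ k ∈ Finset.Icc 1 N, 5 * t + 2 * η < ‖partialSum (x · ω) k - c k‖} ≤
      4 * P {ω | t < ‖partialSum (x · ω) N‖} := by
  rcases lt_or_ge (4⁻¹ : ℝ≥0∞) (P {ω | t < ‖partialSum (x · ω) N‖}) with hbig | hsmall
  · refine prob_le_one.trans ?_
    calc (1 : ℝ≥0∞) = 4 * 4⁻¹ := (ENNReal.mul_inv_cancel (by simp) (by simp)).symm
      _ ≤ _ := by gcongr
  have hcenter : ∀ k, ∃ s : E, (k ∈ Finset.Icc 1 N →
      P {ω | t < ‖partialSum (x · ω) k - s‖} ≤ P {ω | t < ‖partialSum (x · ω) N‖} ∧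
        ‖s - c k‖ ≤ 2 * t + 2 * η) := by
    intro k
    by_cases hkN : k ∈ Finset.Icc 1 N
    swap
    · exact ⟨0, fun h => absurd h hkN⟩
    rw [Finset.mem_Icc] at hkN
    rcases hkN.2.lt_or_eq with hlt | rfl
    · obtain ⟨s, hs⟩ := exists_center hx hind hkN.2 t
      refine ⟨s, fun _ => ⟨hs, ?_⟩⟩
      refine (norm_sub_le_of_measure_gt_le_quarter (hs.trans hsmall)
        (hc k hkN.1 hlt s (hs.trans hsmall))).trans (le_of_eq (by ring))
    · exact ⟨0, fun _ => ⟨by simp, by rw [hcN]; simp; positivity⟩⟩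
  choose s hs using hcenter
  calc _ ≤ P {ω | ∃ k ∈ Finset.Icc 1 N, 3 * t < ‖partialSum (x · ω) k - s k‖} := by
        refine measure_mono ?_
        rintro ω ⟨k, hk, h⟩
        refine ⟨k, hk, ?_⟩
        have h3 : ‖partialSum (x · ω) k - c k‖ ≤ ‖partialSum (x · ω) k - s k‖ + ‖s k - c k‖ :=
          norm_sub_le_norm_sub_add_norm_sub ..
        linarith [(hs k hk).2]
    _ ≤ 2 * _ := measure_exists_centered_gt_le hx hind (fun k hk => (hs k hk).1) hsmall
    _ ≤ 4 * _ := by gcongr; norm_num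

/-- Take the least admissible level, then the least index at that level; both are measurable. -/
theorem exists_measurable_minimal_index {α : Type*} [MeasurableSpace α] {Q : ℕ → ℕ → Set α}
    (hQ : ∀ l i, MeasurableSet (Q l i)) (hex : ∀ a, ∃ l i, a ∈ Q l i) :
    ∃ idx : α → ℕ, Measurable idx ∧ ∀ a l i, a ∈ Q l i → ∃ l' ≤ l, a ∈ Q l' (idx a) := by
  classical
  have hLm : Measurable fun a => Nat.find (hex a) := measurable_find hex fun l => by
    have : {a | ∃ i, a ∈ Q l i} = ⋃ i, Q l i := by ext; simp
    rw [this]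
    exact MeasurableSet.iUnion (hQ l)
  have hI : ∀ a, ∃ i, a ∈ Q (Nat.find (hex a)) i := fun a => Nat.find_spec (hex a)
  refine ⟨fun a => Nat.find (hI a), measurable_find hI fun i => ?_, fun a l i h =>
    ⟨Nat.find (hex a), Nat.find_min' (hex a) ⟨i, h⟩, Nat.find_spec (hI a)⟩⟩
  have : {a | a ∈ Q (Nat.find (hex a)) i} = ⋃ l, {a | Nat.find (hex a) = l} ∩ Q l i := by
    ext a; simp
  rw [this]
  exact MeasurableSet.iUnion fun l => (hLm (measurableSet_singleton l)).inter (hQ l i)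

theorem exists_nat_measure_gt_le {h : Ω → ℝ} (hh : Measurable h) {η : ℝ} (hη : 0 < η) :
    ∃ l : ℕ, P {ω | η * l < h ω} ≤ 4⁻¹ := by
  have h1 := tendsto_measure_iInter_atTop (μ := P) (s := fun l : ℕ => {ω | η * l < h ω})
    (fun l => (measurableSet_lt measurable_const hh).nullMeasurableSet)
    (fun i j hij ω hω => by
      have : (i : ℝ) ≤ j := by exact_mod_cast hij
      simp only [Set.mem_ofPred_eq] at hω ⊢
      nlinarith) ⟨0, measure_ne_top _ _⟩
  have h2 : (⋂ l : ℕ, {ω | η * l < h ω}) = ∅ := by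
    ext ω
    simp only [Set.mem_iInter, Set.mem_ofPred_eq, Set.mem_empty_iff_false, iff_false, not_forall,
      not_lt]
    obtain ⟨l, hl⟩ := exists_nat_ge (h ω / η)
    exact ⟨l, by rwa [div_le_iff₀' hη] at hl⟩
  rw [h2, measure_empty] at h1
  exact (h1.eventually (ge_mem_nhds (by simp : (0 : ℝ≥0∞) < 4⁻¹))).exists

end Recentering

/-! ### Predictable recentering of a decoupled pair. -/

section RecenteredPair

variable {Ω E : Type*} {mΩ : MeasurableSpace Ω} [NormedAddCommGroup E] [MeasurableSpace E]
  [BorelSpace E] [SecondCountableTopology E]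
  {μ : Measure Ω} [IsProbabilityMeasure μ] {ℱ : Filtration ℕ mΩ} {f g d e : ℕ → Ω → E}
  {κ : ℕ → Ω → Measure E} [∀ n ω, IsProbabilityMeasure (κ n ω)]

theorem measurable_partialSum_apply (k : ℕ) : Measurable fun x : ℕ → E => partialSum x k :=
  measurable_partialSum (x := fun i (x : ℕ → E) => x i) k fun i _ _ => measurable_pi_apply i

/-- A predictable approximate center of the conditional law of the `k`-th decoupled sum. -/
theorem IsTangentKernel.exists_measurable_center (hκ : IsTangentKernel μ ℱ d e κ) (k : ℕ)
    {η : ℝ} (hη : 0 < η) :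
    ∃ c : Ω → E, Measurable[ℱ (k - 1)] c ∧ ∀ ω (t : ℝ), 0 ≤ t → ∀ s : E,
      Measure.infinitePi (fun i => κ i ω) {x | t < ‖partialSum x k - s‖} ≤ 4⁻¹ →
      Measure.infinitePi (fun i => κ i ω) {x | t + 2 * η < ‖partialSum x k - c ω‖} ≤ 4⁻¹ := by
  have hset : ∀ (u : ℝ) (s : E), MeasurableSet {x : ℕ → E | u < ‖partialSum x k - s‖} :=
    fun u s => measurableSet_lt_norm ((measurable_partialSum_apply k).sub measurable_const) u
  let Q : ℕ → ℕ → Set Ω := fun l i => {ω | Measure.infinitePi (fun i => κ i ω)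
    {x : ℕ → E | η * l < ‖partialSum x k - TopologicalSpace.denseSeq E i‖} ≤ 4⁻¹}
  have hQ : ∀ l i, MeasurableSet[ℱ (k - 1)] (Q l i) := fun l i => by
    refine (hκ.measurable_measure_of_trunc k (hset (η * l) _) fun x => ?_) measurableSet_Iic
    have : partialSum (fun i => if i ≤ k then x i else 0) k = partialSum x k :=
      Finset.sum_congr rfl fun i hi => if_pos (Finset.mem_Icc.1 hi).2
    simp only [Set.mem_ofPred_eq, this]
  have hex : ∀ ω, ∃ l i, ω ∈ Q l i := fun ω => by
    obtain ⟨l, hl⟩ := exists_nat_measure_gt_le (P := Measure.infinitePi fun i => κ i ω)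
      (h := fun x => ‖partialSum x k - TopologicalSpace.denseSeq E 0‖)
      ((measurable_partialSum_apply k).sub measurable_const).norm hη
    exact ⟨l, 0, hl⟩
  obtain ⟨idx, hidx, hmin⟩ := @exists_measurable_minimal_index Ω (ℱ (k - 1)) Q hQ hex
  refine ⟨fun ω => TopologicalSpace.denseSeq E (idx ω), measurable_from_top.comp hidx, ?_⟩
  intro ω t ht s hs
  obtain ⟨i, hi⟩ : ∃ i, ‖s - TopologicalSpace.denseSeq E i‖ < η := by
    obtain ⟨i, h⟩ := (TopologicalSpace.denseRange_denseSeq E).exists_dist_lt s hη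
    exact ⟨i, by rwa [dist_eq_norm] at h⟩
  have hl1 : t + η ≤ η * ⌈(t + η) / η⌉₊ := by
    rw [← div_le_iff₀' hη]; exact Nat.le_ceil _
  have hl2 : η * ⌈(t + η) / η⌉₊ ≤ t + 2 * η := by
    have h1 := (Nat.ceil_lt_add_one (a := (t + η) / η) (by positivity)).le
    calc η * ⌈(t + η) / η⌉₊ ≤ η * ((t + η) / η + 1) := by gcongr
      _ = t + 2 * η := by field_simp; ring
  -- A dense point within `η` of `s` is admissible at this level, so the minimal level is no larger.
  -- Passing to the dense sequence and rounding to multiples of `η` cost `η` each.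
  obtain ⟨l', hl', hmem⟩ := hmin ω ⌈(t + η) / η⌉₊ i (by
    refine le_trans (measure_mono fun x hx => ?_) hs
    simp only [Set.mem_ofPred_eq] at hx ⊢
    have : ‖partialSum x k - TopologicalSpace.denseSeq E i‖ ≤
      ‖partialSum x k - s‖ + ‖s - TopologicalSpace.denseSeq E i‖ :=
      norm_sub_le_norm_sub_add_norm_sub ..
    linarith)
  refine le_trans (measure_mono fun x hx => ?_) hmem
  simp only [Set.mem_ofPred_eq] at hx ⊢
  refine lt_of_le_of_lt ?_ hx
  have : (l' : ℝ) ≤ ⌈(t + η) / η⌉₊ := by exact_mod_cast hl'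
  nlinarith

/-- Subtracting a predictable sequence is a predictable transform of the differences, so the pair
stays decoupled. The tail bound is the inequality for independent variables, applied conditionally
on `ℱ_∞` and integrated. -/
theorem exists_recentered [CompleteSpace E] (hfg : IsDecoupledSum μ ℱ f g) (N : ℕ) {η : ℝ}
    (hη : 0 < η) :
    ∃ f' g' : ℕ → Ω → E, IsDecoupledSum μ ℱ f' g' ∧ f' N = f N ∧
      ∀ t : ℝ, 0 ≤ t → μ (exceedSet g' N (5 * t + 2 * η)) ≤ 4 * μ {ω | t < ‖g N ω‖} := by
  classical
  obtain ⟨κ, _, hκ⟩ := exists_isTangentKernel hfg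
  choose b hbm hb using fun k => hκ.exists_measurable_center k hη
  -- Vanishing at `N` keeps the final values of both sequences; vanishing at `0` makes the
  -- subtracted differences sum to `c`.
  let c : ℕ → Ω → E := fun k => if 1 ≤ k ∧ k < N then b k else 0
  have hcm : ∀ k, Measurable[ℱ (k - 1)] (c k) := fun k => by
    by_cases hk : 1 ≤ k ∧ k < N
    · simp only [c, hk, and_self, if_true]; exact hbm k
    · simp only [c, if_neg hk]; exact measurable_const
  have hc0 : c 0 = 0 := by simp [c]
  have hcN : c N = 0 := by simp [c]
  let φ : ℕ → Ω → E → E := fun k ω x => x - (c k ω - c (k - 1) ω)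
  have hφ : ∀ k, 1 ≤ k → Measurable[(ℱ (k - 1)).prod inferInstance] (Function.uncurry (φ k)) := by
    intro k _
    have h1 : Measurable[ℱ (k - 1)] fun ω => c k ω - c (k - 1) ω :=
      (hcm k).sub ((hcm (k - 1)).mono (ℱ.mono (by omega)) le_rfl)
    exact (@measurable_snd Ω E (ℱ (k - 1)) _).sub (h1.comp (@measurable_fst Ω E (ℱ (k - 1)) _))
  have hdec := hκ.isDecoupledSum_transformSum hfg.filtration_zero hfg.measurable_diff_left
    hfg.measurable_diff_right hφ
  have hsum : ∀ h : ℕ → Ω → E, h 0 = 0 → ∀ n ω,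
      transformSum φ (diffSeq h) n ω = h n ω - c n ω := by
    intro h h0 n ω
    have h1 := partialSum_diffSeq h0 n ω
    have h2 := partialSum_diffSeq hc0 n ω
    rw [← h1, ← h2, partialSum, partialSum, ← Finset.sum_sub_distrib]
    rfl
  refine ⟨_, _, hdec, ?_, fun t ht => ?_⟩
  · ext ω; rw [hsum f hfg.f_zero, hcN]; simp
  have hset : MeasurableSet[(⨆ k, ℱ k).prod inferInstance] {z : Ω × (ℕ → E) |
      ∃ k ∈ Finset.Icc 1 N, 5 * t + 2 * η < ‖partialSum z.2 k - c k z.1‖} := by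
    refine measurableSet_exceedSet (f := fun k (z : Ω × (ℕ → E)) => partialSum z.2 k - c k z.1)
      (m := (⨆ k, ℱ k).prod inferInstance) (fun k _ => ?_) _
    exact ((measurable_partialSum_apply k).comp (@measurable_snd _ _ (⨆ k, ℱ k) _)).sub
      (((hcm k).mono (filtration_le_iSup ℱ _) le_rfl).comp (@measurable_fst _ _ (⨆ k, ℱ k) _))
  have hright := hκ.lintegral_right (fun ω x => {z : Ω × (ℕ → E) |
      ∃ k ∈ Finset.Icc 1 N, 5 * t + 2 * η < ‖partialSum z.2 k - c k z.1‖}.indicator 1 (ω, x))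
      (Measurable.indicator (@measurable_const _ _ _ ((⨆ k, ℱ k).prod inferInstance) 1) hset)
  have hem := hfg.measurable_diff_right
  have hlhs : μ (exceedSet (transformSum φ (diffSeq g)) N (5 * t + 2 * η)) =
      ∫⁻ ω, {z : Ω × (ℕ → E) | ∃ k ∈ Finset.Icc 1 N,
        5 * t + 2 * η < ‖partialSum z.2 k - c k z.1‖}.indicator 1 (ω, fun k => diffSeq g k ω) ∂μ := by
    have hm : MeasurableSet (exceedSet (transformSum φ (diffSeq g)) N (5 * t + 2 * η)) := by
      refine measurableSet_exceedSet (fun k _ => ?_) _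
      have : transformSum φ (diffSeq g) k = fun ω => partialSum (fun i => diffSeq g i ω) k - c k ω :=
        funext fun ω => by rw [hsum g hfg.g_zero, partialSum_diffSeq hfg.g_zero]
      rw [this]
      exact (measurable_partialSum k fun i _ _ => hem i).sub ((hcm k).mono (ℱ.le _) le_rfl)
    rw [← lintegral_indicator_one hm]
    refine lintegral_congr fun ω => ?_
    simp only [Set.indicator, exceedSet, Set.mem_ofPred_eq, hsum g hfg.g_zero,
      partialSum_diffSeq hfg.g_zero]
    rfl
  have hBm : MeasurableSet {x : ℕ → E | t < ‖partialSum x N‖} :=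
    measurableSet_lt_norm (measurable_partialSum_apply N) t
  have hrhs := hκ.measure_right hem hBm
  simp only [Set.mem_ofPred_eq, partialSum_diffSeq hfg.g_zero] at hrhs
  have hνm : Measurable fun ω => Measure.infinitePi (fun i => κ i ω) {x | t < ‖partialSum x N‖} :=
    (Measure.measurable_coe hBm).comp (hκ.measurable_infinitePi.mono (iSup_filtration_le ℱ) le_rfl)
  rw [hlhs, hright, hrhs, ← lintegral_const_mul _ hνm]
  refine lintegral_mono fun ω => ?_
  have hsec : MeasurableSet {x : ℕ → E |
      ∃ k ∈ Finset.Icc 1 N, 5 * t + 2 * η < ‖partialSum x k - c k ω‖} :=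
    measurableSet_exceedSet (f := fun k (x : ℕ → E) => partialSum x k - c k ω)
      (fun k _ => (measurable_partialSum_apply k).sub measurable_const) _
  refine le_trans (le_of_eq (lintegral_indicator_one hsec)) ?_
  refine measure_exists_recentered_gt_le (x := fun i (x : ℕ → E) => x i)
    (fun i => measurable_pi_apply i)
    (iIndepFun_infinitePi (P := fun k => κ k ω) (X := fun _ x => x) fun _ => measurable_id)
    ht hη.le (c := fun k => c k ω) (by simp [hcN]) fun k hk1 hkN s hs => ?_
  simp only [c, hk1, hkN, and_self, if_true]
  exact hb k ω t ht s hs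

end RecenteredPair

/-! ### Integration against growth functions. -/

section Integration

variable {Ω : Type*} {mΩ : MeasurableSpace Ω} {μ : Measure Ω} [IsProbabilityMeasure μ]
  {q : ℝ} {Φ : ℝ≥0 → ℝ≥0}

/-- Turns superlevel sets of `Φ` into tails, so a good-λ inequality can be integrated without
differentiating or inverting `Φ`. Continuity makes the level exact, and `Φ 0 = 0` makes it positive.
-/
theorem IsGrowthFunction.exists_level (hΦ : IsGrowthFunction q Φ) {u : ℝ≥0} (hu : 0 < u) :
    (∀ x, Φ x ≤ u) ∨ ∃ s, 0 < s ∧ ∀ x, u < Φ x ↔ s < x := by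
  by_cases hbdd : BddAbove {x | Φ x ≤ u}
  · right
    have hcl : IsClosed {x | Φ x ≤ u} := isClosed_le hΦ.continuous continuous_const
    have hne : {x | Φ x ≤ u}.Nonempty := ⟨0, by simp [hΦ.map_zero]⟩
    have hmem : Φ (sSup {x | Φ x ≤ u}) ≤ u := hcl.csSup_mem hne hbdd
    refine ⟨sSup {x | Φ x ≤ u}, ?_, fun x => ⟨fun h => ?_, fun h => ?_⟩⟩
    · have h0 : ∀ᶠ x in nhds (0 : ℝ≥0), Φ x < u :=
        hΦ.continuous.continuousAt.eventually (gt_mem_nhds (by rwa [hΦ.map_zero]))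
      obtain ⟨ε, hε, hball⟩ := Metric.eventually_nhds_iff.1 h0
      have hx : Φ (Real.toNNReal (ε / 2)) < u := hball (by
        rw [NNReal.dist_eq, Real.coe_toNNReal _ (half_pos hε).le, NNReal.coe_zero, sub_zero,
          abs_of_pos (half_pos hε)]
        exact half_lt_self hε)
      exact lt_of_lt_of_le (by simpa using hε) (le_csSup hbdd hx.le)
    · by_contra hcon
      exact absurd ((hΦ.monotone (not_lt.1 hcon)).trans hmem) (not_le.2 h)
    · by_contra hcon
      exact absurd (le_csSup hbdd (show x ∈ {x | Φ x ≤ u} from not_lt.1 hcon)) (not_le.2 h)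
  · left
    intro x
    rw [not_bddAbove_iff] at hbdd
    obtain ⟨y, hy, hxy⟩ := hbdd x
    exact (hΦ.monotone hxy.le).trans hy

theorem lintegral_nnreal_eq_lintegral_measure_lt {h : Ω → ℝ≥0} (hh : Measurable h) :
    ∫⁻ ω, (h ω : ℝ≥0∞) ∂μ = ∫⁻ t in Set.Ioi (0 : ℝ), μ {ω | t < h ω} := by
  rw [← lintegral_eq_lintegral_meas_lt μ (ae_of_all _ fun ω => NNReal.coe_nonneg (h ω))
    hh.coe_nnreal_real.aemeasurable]
  simp

theorem lintegral_le_of_measure_lt_le {F F' G : Ω → ℝ≥0} (hF : Measurable F) (hF' : Measurable F')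
    (hG : Measurable G) {ε c : ℝ≥0∞}
    (h : ∀ u : ℝ≥0, 0 < u → μ {ω | u < F ω} ≤ ε * μ {ω | u < F' ω} + c * μ {ω | u < G ω}) :
    ∫⁻ ω, (F ω : ℝ≥0∞) ∂μ ≤ ε * ∫⁻ ω, (F' ω : ℝ≥0∞) ∂μ + c * ∫⁻ ω, (G ω : ℝ≥0∞) ∂μ := by
  have hanti : ∀ H : Ω → ℝ≥0, Measurable fun t : ℝ => μ {ω | t < H ω} := fun H =>
    Antitone.measurable fun s t hst => measure_mono fun ω hω => lt_of_le_of_lt hst hω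
  rw [lintegral_nnreal_eq_lintegral_measure_lt hF, lintegral_nnreal_eq_lintegral_measure_lt hF',
    lintegral_nnreal_eq_lintegral_measure_lt hG, ← lintegral_const_mul _ (hanti F'),
    ← lintegral_const_mul _ (hanti G), ← lintegral_add_left ((hanti F').const_mul ε)]
  refine setLIntegral_mono' measurableSet_Ioi fun t ht => ?_
  have := h t.toNNReal (by simpa using ht)
  have hiff : ∀ H : Ω → ℝ≥0, {ω | t.toNNReal < H ω} = {ω | t < H ω} := fun H => by
    ext ω
    rw [Set.mem_ofPred_eq, Set.mem_ofPred_eq, ← NNReal.coe_lt_coe,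
      Real.coe_toNNReal _ (le_of_lt ht)]
  simpa only [hiff] using this

/-- Integration of a good-`λ` inequality against a growth function. -/
theorem IsGrowthFunction.lintegral_le_of_good_lambda (hΦ : IsGrowthFunction q Φ)
    {F G : Ω → ℝ≥0} (hF : Measurable F) (hG : Measurable G) {β δ : ℝ≥0} (hβ : 1 ≤ β)
    (hδ0 : 0 < δ) (hδ1 : δ ≤ 1) {ε c : ℝ≥0∞} (hε : (β : ℝ≥0∞) ^ q * ε ≤ 2⁻¹)
    (h : ∀ l : ℝ≥0, 0 < l →
      μ {ω | β * l < F ω} ≤ ε * μ {ω | l < F ω} + c * μ {ω | δ * l < G ω}) :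
    ∫⁻ ω, (Φ (F ω) : ℝ≥0∞) ∂μ ≤
      2 * (β : ℝ≥0∞) ^ q * c * (δ⁻¹ : ℝ≥0) ^ q * ∫⁻ ω, (Φ (G ω) : ℝ≥0∞) ∂μ := by
  have hβ0 : 0 < β := lt_of_lt_of_le one_pos hβ
  have hΦm : Measurable Φ := hΦ.continuous.measurable
  have hgr : ∀ s t : ℝ≥0, 1 ≤ s → (Φ (s * t) : ℝ≥0∞) ≤ (s : ℝ≥0∞) ^ q * Φ t := fun s t hs => by
    rw [← ENNReal.coe_rpow_of_ne_zero (by positivity), ← ENNReal.coe_mul, ENNReal.coe_le_coe]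
    exact hΦ.growth s t hs
  have hcomp : ∀ {H : Ω → ℝ≥0}, Measurable H → Measurable fun ω => (Φ (H ω) : ℝ≥0∞) :=
    fun hH => (hΦm.comp hH).coe_nnreal_ennreal
  -- Cutting `F` at `M` preserves the good-λ inequality and makes the left-hand side finite, so half
  -- of it can be absorbed; then `M` tends to infinity.
  have htrunc : ∀ M : ℝ≥0, ∫⁻ ω, (Φ (min (F ω) M) : ℝ≥0∞) ∂μ ≤
      2 * (β : ℝ≥0∞) ^ q * c * (δ⁻¹ : ℝ≥0) ^ q * ∫⁻ ω, (Φ (G ω) : ℝ≥0∞) ∂μ := by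
    intro M
    set FM : Ω → ℝ≥0 := fun ω => min (F ω) M with hFM
    have hFMm : Measurable FM := hF.min measurable_const
    have h1 : ∀ l : ℝ≥0, 0 < l →
        μ {ω | β * l < FM ω} ≤ ε * μ {ω | l < FM ω} + c * μ {ω | δ * l < G ω} := by
      intro l hl
      by_cases hM : β * l < M
      · have hlM : l < M := lt_of_le_of_lt (le_mul_of_one_le_left' hβ) hM
        simpa only [hFM, lt_min_iff, hM, hlM, and_true] using h l hl
      · have : {ω | β * l < FM ω} = ∅ := by
          ext ω; simp [hFM, hM]
        rw [this]; simp
    have h2 := lintegral_le_of_measure_lt_le (μ := μ) (F := fun ω => Φ (FM ω / β))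
      (F' := fun ω => Φ (FM ω)) (G := fun ω => Φ (G ω / δ)) (ε := ε) (c := c)
      (hΦm.comp (hFMm.div_const β)) (hΦm.comp hFMm) (hΦm.comp (hG.div_const δ)) (by
        intro u hu
        rcases hΦ.exists_level hu with hle | ⟨s, hs, hiff⟩
        · have : {ω | u < Φ (FM ω / β)} = ∅ := by
            ext ω; simpa using hle _
          rw [this]; simp
        · simp only [hiff, lt_div_iff₀ hβ0, lt_div_iff₀ hδ0]
          simpa only [mul_comm] using h1 s hs)
    set X := ∫⁻ ω, (Φ (FM ω) : ℝ≥0∞) ∂μ with hX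
    set Y := ∫⁻ ω, (Φ (G ω) : ℝ≥0∞) ∂μ with hY
    have hXfin : X ≠ ∞ := by
      refine ne_top_of_le_ne_top (b := (Φ M : ℝ≥0∞)) (by simp) ?_
      calc X ≤ ∫⁻ _, (Φ M : ℝ≥0∞) ∂μ :=
            lintegral_mono fun ω => ENNReal.coe_le_coe.2 (hΦ.monotone (min_le_right _ _))
        _ = _ := by simp
    have h3 : X ≤ (β : ℝ≥0∞) ^ q * ∫⁻ ω, (Φ (FM ω / β) : ℝ≥0∞) ∂μ := by
      rw [← lintegral_const_mul _ (hcomp (hFMm.div_const β))]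
      refine lintegral_mono fun ω => ?_
      have := hgr β (FM ω / β) hβ
      rwa [mul_div_cancel₀ _ hβ0.ne'] at this
    have h4 : ∫⁻ ω, (Φ (G ω / δ) : ℝ≥0∞) ∂μ ≤ (δ⁻¹ : ℝ≥0) ^ q * Y := by
      rw [← lintegral_const_mul _ (hcomp hG)]
      refine lintegral_mono fun ω => ?_
      rw [div_eq_inv_mul]
      exact hgr _ _ ((one_le_inv₀ hδ0).2 hδ1)
    have h5 : X ≤ 2⁻¹ * X + (β : ℝ≥0∞) ^ q * c * (δ⁻¹ : ℝ≥0) ^ q * Y := by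
      calc X ≤ (β : ℝ≥0∞) ^ q * (ε * X + c * ((δ⁻¹ : ℝ≥0) ^ q * Y)) :=
            h3.trans (by gcongr; exact h2.trans (by gcongr))
        _ = ((β : ℝ≥0∞) ^ q * ε) * X + (β : ℝ≥0∞) ^ q * c * (δ⁻¹ : ℝ≥0) ^ q * Y := by ring
        _ ≤ _ := by gcongr
    have h6 : 2⁻¹ * X + 2⁻¹ * X = X := by
      rw [← add_mul, ENNReal.inv_two_add_inv_two, one_mul]
    have h7 : 2⁻¹ * X ≤ (β : ℝ≥0∞) ^ q * c * (δ⁻¹ : ℝ≥0) ^ q * Y := by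
      refine (ENNReal.add_le_add_iff_left (a := 2⁻¹ * X) (by finiteness)).1 ?_
      rwa [h6]
    calc X = 2 * (2⁻¹ * X) := by
          rw [← mul_assoc, ENNReal.mul_inv_cancel (by simp) (by simp), one_mul]
      _ ≤ 2 * ((β : ℝ≥0∞) ^ q * c * (δ⁻¹ : ℝ≥0) ^ q * Y) := by gcongr
      _ = _ := by ring
  have hsup : ∀ ω, (Φ (F ω) : ℝ≥0∞) = ⨆ n : ℕ, (Φ (min (F ω) n) : ℝ≥0∞) := fun ω => by
    refine le_antisymm ?_ (iSup_le fun n => ENNReal.coe_le_coe.2 (hΦ.monotone (min_le_left _ _)))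
    obtain ⟨n, hn⟩ := exists_nat_ge (F ω)
    refine le_iSup_of_le n ?_
    rw [min_eq_left hn]
  simp_rw [hsup]
  rw [lintegral_iSup (fun n => hcomp (hF.min measurable_const))
    (fun i j hij ω => ENNReal.coe_le_coe.2 (hΦ.monotone
      (min_le_min le_rfl (by exact_mod_cast hij))))]
  exact iSup_le fun n => htrunc n

end Integration

/-! ### Choice of the constants. -/

section Constants

/-- The ratio of the two levels in the good-`λ` inequality. -/
noncomputable def levelRatio (p q : ℝ) : ℝ := 1 + 1 / (q / p + 1 / 9)

/-- The ratio of the levels of the decoupled sum and the sum in the good-`λ` inequality. -/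
noncomputable def decoupledRatio (p q D : ℝ) : ℝ :=
  (levelRatio p q - 1) / (9 * D * 4 ^ (1 / p) * levelRatio p q ^ (q / p))

/-- The constant in the decoupling inequality for growth functions. -/
noncomputable def phiConst (p q D : ℝ) : ℝ :=
  2 * levelRatio p q ^ q * (8 + 8 * (3 / 2) ^ p) * (5 / decoupledRatio p q D) ^ q

variable {p q D : ℝ}

theorem one_lt_levelRatio (hp : 0 < p) (hq : 0 < q) : 1 < levelRatio p q := by
  have : 0 < 1 / (q / p + 1 / 9) := by positivity
  unfold levelRatio; linarith

/-- This is what the summand `1 / 9` in `levelRatio` is for: with `nine_mul_decoupledRatio_le` it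
gives `decoupledRatio p q D ≤ 1`. -/
theorem levelRatio_sub_one_le (hp : 0 < p) (hq : 0 < q) : levelRatio p q - 1 ≤ 9 := by
  have : 0 < q / p := by positivity
  unfold levelRatio
  rw [add_sub_cancel_left, div_le_iff₀ (by positivity)]
  linarith

theorem decoupledRatio_pos (hp : 0 < p) (hq : 0 < q) (hD : 1 ≤ D) : 0 < decoupledRatio p q D := by
  have h1 := one_lt_levelRatio hp hq
  unfold decoupledRatio
  have : 0 < levelRatio p q - 1 := by linarith
  positivity

theorem nine_mul_decoupledRatio_le (hp : 0 < p) (hq : 0 < q) (hD : 1 ≤ D) :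
    9 * decoupledRatio p q D ≤ levelRatio p q - 1 := by
  have h1 := one_lt_levelRatio hp hq
  have h2 : (1 : ℝ) ≤ 4 ^ (1 / p) := Real.one_le_rpow (by norm_num) (by positivity)
  have h3 : 1 ≤ levelRatio p q ^ (q / p) := Real.one_le_rpow h1.le (by positivity)
  have h4 : 1 ≤ D * 4 ^ (1 / p) * levelRatio p q ^ (q / p) :=
    one_le_mul_of_one_le_of_one_le (one_le_mul_of_one_le_of_one_le hD h2) h3
  unfold decoupledRatio
  rw [← mul_div_assoc, div_le_iff₀ (by positivity)]
  nlinarith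

/-- The equation that determines `decoupledRatio`: the absorbed term in the integrated good-λ
inequality has coefficient exactly `1 / 2`. -/
theorem rpow_mul_good_lambda_coeff (hp : 0 < p) (hq : 0 < q) (hD : 1 ≤ D) :
    levelRatio p q ^ q * (2 * (9 * D * decoupledRatio p q D / (levelRatio p q - 1)) ^ p) =
      1 / 2 := by
  have h1 := one_lt_levelRatio hp hq
  have hb : 0 < levelRatio p q - 1 := by linarith
  have h2 : 9 * D * decoupledRatio p q D / (levelRatio p q - 1) =
      (4 ^ (1 / p) * levelRatio p q ^ (q / p))⁻¹ := by
    unfold decoupledRatio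
    have : 0 < levelRatio p q ^ (q / p) := by positivity
    field_simp
  rw [h2, Real.inv_rpow (by positivity), Real.mul_rpow (by positivity) (by positivity),
    ← Real.rpow_mul (by norm_num), ← Real.rpow_mul (by positivity), one_div_mul_cancel hp.ne',
    div_mul_cancel₀ _ hp.ne', Real.rpow_one]
  have : 0 < levelRatio p q ^ q := by positivity
  field_simp
  norm_num

end Constants

/-! ### Growth function inequalities in separable normed groups. -/

section Normed

variable {Ω E : Type*} {mΩ : MeasurableSpace Ω} [NormedAddCommGroup E] [MeasurableSpace E]
  [BorelSpace E] [SecondCountableTopology E] [CompleteSpace E]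
  {μ : Measure Ω} [IsProbabilityMeasure μ] {ℱ : Filtration ℕ mΩ} {f g : ℕ → Ω → E}
  {p q D : ℝ} {Φ : ℝ≥0 → ℝ≥0}

/-- The maximal function `max_{1 ≤ k ≤ N} ‖f k‖`. -/
def supNorm {E : Type*} [NormedAddCommGroup E] (f : ℕ → Ω → E) (N : ℕ) (ω : Ω) : ℝ≥0 :=
  (Finset.Icc 1 N).sup fun k => ‖f k ω‖₊

theorem setOf_lt_supNorm (f : ℕ → Ω → E) (N : ℕ) (s : ℝ≥0) :
    {ω | s < supNorm f N ω} = exceedSet f N s := by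
  ext ω
  simp [supNorm, exceedSet, Finset.lt_sup_iff, ← NNReal.coe_lt_coe]

theorem measurable_supNorm {f : ℕ → Ω → E} (hf : ∀ k, Measurable (f k)) (N : ℕ) :
    Measurable (supNorm f N) := by
  refine measurable_of_Ioi fun s => ?_
  have : supNorm f N ⁻¹' Set.Ioi s = exceedSet f N s := setOf_lt_supNorm f N s
  rw [this]
  exact measurableSet_exceedSet (fun k _ => hf k) s

theorem IsDecoupledSum.measurable_right (h : IsDecoupledSum μ ℱ f g) (n : ℕ) :
    Measurable (g n) := by
  have : g n = fun ω => partialSum (fun k => diffSeq g k ω) n :=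
    funext fun ω => (partialSum_diffSeq h.g_zero n ω).symm
  rw [this]
  exact measurable_partialSum n fun k _ _ => h.measurable_diff_right k

/-- The control variable `G` is left free: it is the maximal function of `g` with `a = 1`, or, for a
recentered pair, a function of the final value with `a = 4`. -/
theorem lintegral_supNorm_le (hp : 0 < p) (hq : 0 < q) (hD : 1 ≤ D)
    (H : BoundedDecoupling E μ ℱ p D) (hfg : IsDecoupledSum μ ℱ f g)
    (hΦ : IsGrowthFunction q Φ) {N : ℕ} (hN : 1 ≤ N) {G : Ω → ℝ≥0} (hG : Measurable G) {a : ℝ}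
    (ha : 0 ≤ a) (hgG : ∀ l : ℝ≥0, 0 < l → μ (exceedSet g N l) ≤ ENNReal.ofReal a * μ {ω | l < G ω}) :
    ∫⁻ ω, (Φ (supNorm f N ω) : ℝ≥0∞) ∂μ ≤
      ENNReal.ofReal (2 * levelRatio p q ^ q * ((2 + 2 * (3 / 2) ^ p) * a) *
        (1 / decoupledRatio p q D) ^ q) * ∫⁻ ω, (Φ (G ω) : ℝ≥0∞) ∂μ := by
  have hβ := one_lt_levelRatio hp hq
  have hδ := decoupledRatio_pos hp hq hD
  have hδβ := nine_mul_decoupledRatio_le hp hq hD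
  have hβ9 := levelRatio_sub_one_le hp hq
  have hid := rpow_mul_good_lambda_coeff hp hq hD
  generalize levelRatio p q = β at *
  generalize decoupledRatio p q D = δ at *
  have hβ0 : 0 < β := by linarith
  have hβ1 : 0 < β - 1 := by linarith
  refine (hΦ.lintegral_le_of_good_lambda
    (measurable_supNorm (fun k => (hfg.measurable_left k).mono (ℱ.le k) le_rfl) N) hG
    (β := β.toNNReal) (δ := δ.toNNReal)
    (ε := ENNReal.ofReal (2 * (9 * D * δ / (β - 1)) ^ p))
    (c := ENNReal.ofReal ((2 + 2 * (3 / 2) ^ p) * a)) (by simpa using hβ.le)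
    (by simpa using hδ) (by simpa using (by linarith : δ ≤ 1)) (le_of_eq ?_) ?_).trans
    (le_of_eq ?_)
  · change ENNReal.ofReal β ^ q * _ = _
    rw [ENNReal.ofReal_rpow_of_pos hβ0, ← ENNReal.ofReal_mul (by positivity), hid, one_div,
      ENNReal.ofReal_inv_of_pos (by norm_num)]
    norm_num
  · intro l hl
    have h := measure_exceedSet_le hfg hp (by linarith : 0 ≤ D) H hN (l := l) (β := β) (δ := δ)
      (by exact_mod_cast hl) hδ (by linarith)
    rw [setOf_lt_supNorm, setOf_lt_supNorm]
    have h2 := hgG (δ.toNNReal * l) (by have := Real.toNNReal_pos.2 hδ; positivity)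
    push_cast [Real.coe_toNNReal _ hδ.le, Real.coe_toNNReal _ hβ0.le] at h2 ⊢
    refine h.trans (add_le_add le_rfl ?_)
    rw [ENNReal.ofReal_mul (by positivity), mul_assoc]
    gcongr
  · change 2 * ENNReal.ofReal β ^ q * _ * _ * _ = _
    congr 1
    rw [← Real.toNNReal_inv]
    change 2 * ENNReal.ofReal β ^ q * _ * ENNReal.ofReal δ⁻¹ ^ q = _
    rw [ENNReal.ofReal_rpow_of_pos hβ0, ENNReal.ofReal_rpow_of_pos (by positivity),
      show (2 : ℝ≥0∞) = ENNReal.ofReal 2 by norm_num, ← ENNReal.ofReal_mul (by norm_num),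
      ← ENNReal.ofReal_mul (by positivity), ← ENNReal.ofReal_mul (by positivity), one_div]

theorem lintegral_phi_supNorm_le (hp : 0 < p) (hq : 0 < q) (hD : 1 ≤ D)
    (H : BoundedDecoupling E μ ℱ p D) (hfg : IsDecoupledSum μ ℱ f g)
    (hΦ : IsGrowthFunction q Φ) {N : ℕ} (hN : 1 ≤ N) :
    ∫⁻ ω, (Φ (supNorm f N ω) : ℝ≥0∞) ∂μ ≤
      ENNReal.ofReal (phiConst p q D) * ∫⁻ ω, (Φ (supNorm g N ω) : ℝ≥0∞) ∂μ := by
  have hβ := one_lt_levelRatio hp hq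
  have hδ := decoupledRatio_pos hp hq hD
  refine (lintegral_supNorm_le hp hq hD H hfg hΦ hN (measurable_supNorm hfg.measurable_right N)
    zero_le_one fun l _ => by rw [setOf_lt_supNorm]; simp).trans ?_
  gcongr ENNReal.ofReal ?_ * _
  unfold phiConst
  have : (0 : ℝ) ≤ (3 / 2) ^ p := by positivity
  gcongr
  · linarith
  · norm_num

theorem IsGrowthFunction.map_add_le (hΦ : IsGrowthFunction q Φ) (x y : ℝ≥0) :
    Φ (x + y) ≤ Φ (2 * x) + Φ (2 * y) := by
  rcases le_total x y with h | h
  · exact (hΦ.monotone (by rw [two_mul]; gcongr)).trans le_add_self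
  · exact (hΦ.monotone (by rw [two_mul]; gcongr)).trans le_self_add

/-- Recentering with `η = 1 / (n + 1)` bounds the maximal function of a new pair with the same `f
N`. The error `2 * η` disappears in the limit, and the growth of `Φ` turns the factor `5` into `5 ^
q`. -/
theorem lintegral_phi_norm_le (hp : 0 < p) (hq : 0 < q) (hD : 1 ≤ D)
    (H : BoundedDecoupling E μ ℱ p D) (hfg : IsDecoupledSum μ ℱ f g)
    (hΦ : IsGrowthFunction q Φ) {N : ℕ} (hN : 1 ≤ N) :
    ∫⁻ ω, (Φ ‖f N ω‖₊ : ℝ≥0∞) ∂μ ≤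
      ENNReal.ofReal (phiConst p q D) * ∫⁻ ω, (Φ ‖g N ω‖₊ : ℝ≥0∞) ∂μ := by
  have hβ := one_lt_levelRatio hp hq
  have hδ := decoupledRatio_pos hp hq hD
  have hβ0 : 0 < levelRatio p q := by linarith
  have hΦm : Measurable Φ := hΦ.continuous.measurable
  have hgN : Measurable fun ω => ‖g N ω‖₊ := (hfg.measurable_right N).nnnorm
  have hKpos : 0 < phiConst p q D := by unfold phiConst; positivity
  have hgr : ∀ s t : ℝ≥0, 1 ≤ s → (Φ (s * t) : ℝ≥0∞) ≤ (s : ℝ≥0∞) ^ q * Φ t := fun s t hs => by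
    rw [← ENNReal.coe_rpow_of_ne_zero (by positivity), ← ENNReal.coe_mul, ENNReal.coe_le_coe]
    exact hΦ.growth s t hs
  by_cases hfin : ∫⁻ ω, (Φ ‖g N ω‖₊ : ℝ≥0∞) ∂μ = ∞
  · rw [hfin, ENNReal.mul_top (by simpa using hKpos)]
    exact le_top
  set K' : ℝ := 2 * levelRatio p q ^ q * ((2 + 2 * (3 / 2) ^ p) * 4) *
    (1 / decoupledRatio p q D) ^ q with hK'
  have hη : ∀ n : ℕ, ∫⁻ ω, (Φ ‖f N ω‖₊ : ℝ≥0∞) ∂μ ≤ ENNReal.ofReal K' *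
      ∫⁻ ω, (Φ (5 * ‖g N ω‖₊ + 2 * ((n : ℝ≥0) + 1)⁻¹) : ℝ≥0∞) ∂μ := by
    intro n
    have hηpos : 0 < (((n : ℝ≥0) + 1)⁻¹ : ℝ) := by positivity
    obtain ⟨f', g', hfg', hfN, ht⟩ := exists_recentered hfg N hηpos
    refine le_trans ?_ (lintegral_supNorm_le hp hq hD H hfg' hΦ hN
      (G := fun ω => 5 * ‖g N ω‖₊ + 2 * ((n : ℝ≥0) + 1)⁻¹)
      ((hgN.const_mul 5).add_const _) (a := 4) (by norm_num) ?_)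
    · refine lintegral_mono fun ω => ENNReal.coe_le_coe.2 (hΦ.monotone ?_)
      rw [← hfN]
      exact Finset.le_sup (f := fun k => ‖f' k ω‖₊) (Finset.mem_Icc.2 ⟨hN, le_rfl⟩)
    · intro l hl
      rcases le_or_gt (2 * (((n : ℝ≥0) + 1)⁻¹ : ℝ)) l with hle | hlt
      · have := ht ((l - 2 * (((n : ℝ≥0) + 1)⁻¹ : ℝ)) / 5) (by linarith)
        rw [show 5 * ((l - 2 * (((n : ℝ≥0) + 1)⁻¹ : ℝ)) / 5) + 2 * (((n : ℝ≥0) + 1)⁻¹ : ℝ) = l by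
          ring] at this
        refine this.trans (le_of_eq ?_)
        congr 1
        · norm_num
        · congr 1
          ext ω
          rw [Set.mem_ofPred_eq, Set.mem_ofPred_eq, ← NNReal.coe_lt_coe, div_lt_iff₀ (by norm_num)]
          push_cast
          constructor <;> intro h <;> linarith
      -- Below `2 * η` the recentering bound has no admissible `t`, but the comparison event is the
      -- whole space.
      · have huniv : {ω | l < 5 * ‖g N ω‖₊ + 2 * ((n : ℝ≥0) + 1)⁻¹} = Set.univ := by
          refine Set.eq_univ_of_forall fun ω => ?_
          rw [Set.mem_ofPred_eq, ← NNReal.coe_lt_coe]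
          push_cast at hlt ⊢
          linarith [norm_nonneg (g N ω)]
        rw [huniv, measure_univ, mul_one]
        refine prob_le_one.trans ?_
        rw [← ENNReal.ofReal_one]
        exact ENNReal.ofReal_le_ofReal (by norm_num)
  have hΦg : Measurable fun ω => (Φ ‖g N ω‖₊ : ℝ≥0∞) := (hΦm.comp hgN).coe_nnreal_ennreal
  have hlim : Filter.Tendsto (fun n : ℕ =>
      ∫⁻ ω, (Φ (5 * ‖g N ω‖₊ + 2 * ((n : ℝ≥0) + 1)⁻¹) : ℝ≥0∞) ∂μ) Filter.atTop
      (nhds (∫⁻ ω, (Φ (5 * ‖g N ω‖₊) : ℝ≥0∞) ∂μ)) := by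
    refine tendsto_lintegral_of_dominated_convergence
      (fun ω => ((10 : ℝ≥0) : ℝ≥0∞) ^ q * Φ ‖g N ω‖₊ + Φ 4)
      (fun n => (hΦm.comp ((hgN.const_mul 5).add_const _)).coe_nnreal_ennreal)
      (fun n => ae_of_all _ fun ω => ?_) ?_ (ae_of_all _ fun ω => ?_)
    · have h1 := hΦ.map_add_le (5 * ‖g N ω‖₊) (2 * ((n : ℝ≥0) + 1)⁻¹)
      calc (Φ (5 * ‖g N ω‖₊ + 2 * ((n : ℝ≥0) + 1)⁻¹) : ℝ≥0∞)
          ≤ Φ (2 * (5 * ‖g N ω‖₊)) + Φ (2 * (2 * ((n : ℝ≥0) + 1)⁻¹)) := by exact_mod_cast h1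
        _ ≤ _ := by
          refine add_le_add ?_ (ENNReal.coe_le_coe.2 (hΦ.monotone ?_))
          · rw [← mul_assoc, show (2 * 5 : ℝ≥0) = 10 by norm_num]
            exact hgr _ _ (by norm_num)
          · have : ((n : ℝ≥0) + 1)⁻¹ ≤ 1 := inv_le_one_of_one_le₀ (by simp)
            calc 2 * (2 * ((n : ℝ≥0) + 1)⁻¹) ≤ 2 * (2 * 1) := by gcongr
              _ = 4 := by norm_num
    · rw [lintegral_add_right _ measurable_const,
        lintegral_const_mul _ hΦg]
      have : ((10 : ℝ≥0) : ℝ≥0∞) ^ q ≠ ∞ := ENNReal.rpow_ne_top_of_nonneg hq.le (by simp)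
      simp only [lintegral_const, measure_univ, mul_one]
      exact ENNReal.add_ne_top.2 ⟨ENNReal.mul_ne_top this hfin, by simp⟩
    · refine ENNReal.tendsto_coe.2 ((hΦ.continuous.tendsto _).comp ?_)
      have h1 : Filter.Tendsto (fun n : ℕ => ((n : ℝ≥0) + 1)⁻¹) Filter.atTop (nhds 0) := by
        rw [← NNReal.tendsto_coe]
        push_cast
        simpa [one_div] using tendsto_one_div_add_atTop_nhds_zero_nat (𝕜 := ℝ)
      simpa using (h1.const_mul 2).const_add (5 * ‖g N ω‖₊)
  have hlim' := ENNReal.Tendsto.const_mul (a := ENNReal.ofReal K') hlim (Or.inr (by simp))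
  refine (ge_of_tendsto' hlim' hη).trans ?_
  calc ENNReal.ofReal K' * ∫⁻ ω, (Φ (5 * ‖g N ω‖₊) : ℝ≥0∞) ∂μ
      ≤ ENNReal.ofReal K' * (ENNReal.ofReal (5 ^ q) * ∫⁻ ω, (Φ ‖g N ω‖₊ : ℝ≥0∞) ∂μ) := by
        gcongr
        rw [← lintegral_const_mul _ hΦg]
        refine lintegral_mono fun ω => (hgr 5 _ (by norm_num)).trans (le_of_eq ?_)
        rw [← ENNReal.ofReal_rpow_of_pos (by norm_num)]
        norm_num
    _ = _ := by
        rw [← mul_assoc, ← ENNReal.ofReal_mul (by positivity)]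
        congr 2
        rw [hK', phiConst, Real.div_rpow (by norm_num) hδ.le, Real.div_rpow (by norm_num) hδ.le,
          Real.one_rpow]
        ring

end Normed

/-! ### The explicit constant. -/

section ConstantBound

variable {p q D : ℝ}

/-- With `x = q / p` this is `(1 + 1 / x) ^ x ≤ e`; the extra `1 / 9` only helps. -/
theorem levelRatio_rpow_le_exp (hp : 0 < p) (hq : 0 < q) :
    levelRatio p q ^ (q / p) ≤ Real.exp 1 := by
  have hx : 0 < q / p := by positivity
  have h1 : levelRatio p q ≤ Real.exp (1 / (q / p)) := by
    have : 1 / (q / p + 1 / 9) ≤ 1 / (q / p) := by gcongr; linarith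
    rw [levelRatio]
    linarith [Real.add_one_le_exp (1 / (q / p))]
  refine (Real.rpow_le_rpow (by linarith [one_lt_levelRatio hp hq]) h1 hx.le).trans (le_of_eq ?_)
  rw [← Real.exp_mul]
  congr 1
  field_simp

theorem levelRatio_mul_five_div_le (hp : 0 < p) (hq : 0 < q) (hD : 1 ≤ D) :
    levelRatio p q * (5 / decoupledRatio p q D) ≤
      Real.exp 1 * D * 4 ^ (1 / p) * (50 * (1 + q / p)) := by
  have hx : 0 < q / p := by positivity
  have h1 : levelRatio p q / (levelRatio p q - 1) ≤ 10 / 9 * (1 + q / p) := by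
    have : levelRatio p q / (levelRatio p q - 1) = q / p + 1 / 9 + 1 := by
      have : q / p + 1 / 9 ≠ 0 := by positivity
      unfold levelRatio
      rw [add_sub_cancel_left]
      generalize q / p + 1 / 9 = y at *
      field_simp
    rw [this]; linarith
  calc levelRatio p q * (5 / decoupledRatio p q D)
      = 45 * (levelRatio p q ^ (q / p) * D * 4 ^ (1 / p) *
          (levelRatio p q / (levelRatio p q - 1))) := by
        have : levelRatio p q - 1 ≠ 0 := by linarith [one_lt_levelRatio hp hq]
        unfold decoupledRatio
        generalize levelRatio p q ^ (q / p) = b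
        generalize (4 : ℝ) ^ (1 / p) = c
        generalize levelRatio p q - 1 = d at *
        field_simp
        ring
    _ ≤ 45 * (Real.exp 1 * D * 4 ^ (1 / p) * (10 / 9 * (1 + q / p))) := by
        have := levelRatio_rpow_le_exp hp hq
        have := one_lt_levelRatio hp hq
        have : 0 < levelRatio p q - 1 := by linarith
        gcongr
    _ = _ := by ring

/-- Use `y ≤ 2 * exp (y / 2 - 1)`. In the exponent the coefficient of `q` is `log 2 + 50 / 256 - 1 <
0`, and `exp (50 / 256) ≤ 4 / 3` handles the rest. This removes the `1` from `1 + q / p` when `q /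
p` is small. -/
theorem rpow_le_four_thirds_rpow (hp : 0 < p) (hq : 0 < q) :
    (50 / 128 * (1 + p / q)) ^ q ≤ (4 / 3 : ℝ) ^ p := by
  have h2 : (2 : ℝ) = Real.exp (Real.log 2) := (Real.exp_log (by norm_num)).symm
  have hy : 50 / 128 * (1 + p / q) ≤
      Real.exp (Real.log 2 + (50 / 256 * (1 + p / q) - 1)) := by
    rw [Real.exp_add, ← h2]
    linarith [Real.add_one_le_exp (50 / 256 * (1 + p / q) - 1)]
  have h3 : Real.exp (50 / 256) ≤ 4 / 3 := by
    have := Real.exp_bound_div_one_sub_of_interval (x := 50 / 256) (by norm_num) (by norm_num)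
    refine this.trans (by norm_num)
  calc (50 / 128 * (1 + p / q)) ^ q
      ≤ Real.exp (Real.log 2 + (50 / 256 * (1 + p / q) - 1)) ^ q :=
        Real.rpow_le_rpow (by positivity) hy hq.le
    _ = Real.exp (q * (Real.log 2 + 50 / 256 - 1) + 50 / 256 * p) := by
        rw [← Real.exp_mul]
        congr 1
        field_simp
        ring
    _ ≤ Real.exp (50 / 256 * p) := by
        apply Real.exp_le_exp.2
        nlinarith [Real.log_two_lt_d9]
    _ = Real.exp (50 / 256) ^ p := by rw [Real.exp_mul]
    _ ≤ _ := Real.rpow_le_rpow (Real.exp_pos _).le h3 hp.le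

theorem phiConst_le (hp : 0 < p) (hq : 0 < q) (hD : 1 ≤ D) :
    phiConst p q D ≤ Real.exp q * 2 ^ (3 * q / p + p + 7 * q + 7) * D ^ q * (q / p) ^ q := by
  have hD0 : 0 < D := by linarith
  have hβ := one_lt_levelRatio hp hq
  have hδ := decoupledRatio_pos hp hq hD
  have hx : 0 < q / p := by positivity
  have hc : (1 : ℝ) ≤ (3 / 2) ^ p := Real.one_le_rpow (by norm_num) hp.le
  have h4 : ((4 : ℝ) ^ (1 / p)) ^ q = 2 ^ (2 * q / p) := by
    rw [← Real.rpow_mul (by norm_num), show (4 : ℝ) = 2 ^ (2 : ℝ) by norm_num,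
      ← Real.rpow_mul (by norm_num)]
    congr 1
    ring
  have h7 : (128 : ℝ) ^ q = 2 ^ (7 * q) := by
    rw [show (128 : ℝ) = 2 ^ (7 : ℝ) by norm_num, ← Real.rpow_mul (by norm_num)]
  -- The factor `4 / 3` fills the gap between the `(3 / 2) ^ p` of the good-λ inequality and the `2
  -- ^ p` of the claim.
  have h2 : (2 : ℝ) ^ p = (3 / 2) ^ p * (4 / 3) ^ p := by
    rw [← Real.mul_rpow (by norm_num) (by norm_num)]; norm_num
  have hsplit : 50 * (1 + q / p) = 128 * (q / p) * (50 / 128 * (1 + p / q)) := by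
    field_simp
    ring
  calc phiConst p q D
      = 2 * (8 + 8 * (3 / 2) ^ p) * (levelRatio p q * (5 / decoupledRatio p q D)) ^ q := by
        rw [phiConst, Real.mul_rpow (by linarith) (by positivity)]; ring
    _ ≤ 2 * (8 * (3 / 2) ^ p + 8 * (3 / 2) ^ p) *
        (Real.exp 1 * D * 4 ^ (1 / p) * (50 * (1 + q / p))) ^ q := by
        refine mul_le_mul (by linarith) (Real.rpow_le_rpow (by positivity)
          (levelRatio_mul_five_div_le hp hq hD) hq.le) (by positivity) (by positivity)
    _ = 32 * (3 / 2) ^ p * (Real.exp q * D ^ q * 2 ^ (2 * q / p) *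
        (2 ^ (7 * q) * (q / p) ^ q * (50 / 128 * (1 + p / q)) ^ q)) := by
        rw [hsplit, Real.mul_rpow (by positivity) (by positivity),
          Real.mul_rpow (by positivity) (by positivity),
          Real.mul_rpow (by positivity) (by positivity),
          Real.mul_rpow (by positivity) (by positivity),
          Real.mul_rpow (by positivity) (by positivity), h4, h7, ← Real.exp_mul, one_mul]
        ring
    _ ≤ 32 * (3 / 2) ^ p * (Real.exp q * D ^ q * 2 ^ (2 * q / p) *
        (2 ^ (7 * q) * (q / p) ^ q * (4 / 3) ^ p)) := by
        gcongr
        exact rpow_le_four_thirds_rpow hp hq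
    _ = Real.exp q * (2 ^ (2 * q / p) * 2 ^ p * 2 ^ (7 * q) * 2 ^ (5 : ℝ)) * D ^ q *
          (q / p) ^ q := by
        rw [h2, show (2 : ℝ) ^ (5 : ℝ) = 32 by norm_num]; ring
    _ = Real.exp q * 2 ^ (2 * q / p + p + 7 * q + 5) * D ^ q * (q / p) ^ q := by
        rw [Real.rpow_add (by norm_num), Real.rpow_add (by norm_num), Real.rpow_add (by norm_num)]
    _ ≤ _ := by
        gcongr
        · norm_num
        · norm_num
        · norm_num

end ConstantBound

/-! ### Reduction to separable range. -/

section Separable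

variable {Ω E : Type*} {mΩ : MeasurableSpace Ω} [NormedAddCommGroup E] [MeasurableSpace E]
  [BorelSpace E] {μ : Measure Ω} {ℱ : Filtration ℕ mΩ} {f g : ℕ → Ω → E}
  {p q D : ℝ} {Φ : ℝ≥0 → ℝ≥0}

/-- Integer combinations of a countable dense set are countable; take the closure of the subgroup
they form. Scalars are not needed. -/
theorem exists_isClosed_addSubgroup_isSeparable {s : Set E}
    (hs : TopologicalSpace.IsSeparable s) :
    ∃ S : AddSubgroup E, IsClosed (S : Set E) ∧ TopologicalSpace.IsSeparable (S : Set E) ∧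
      s ⊆ S := by
  obtain ⟨c, hc, hsc⟩ := hs
  have := hc.to_subtype
  let L : Submodule ℤ E := LinearMap.range (Finsupp.linearCombination ℤ (Subtype.val : c → E))
  have hL : (L : Set E).Countable := by
    rw [LinearMap.coe_range]
    exact Set.countable_range _
  refine ⟨L.toAddSubgroup.topologicalClosure, AddSubgroup.isClosed_topologicalClosure _, ?_, ?_⟩
  · rw [AddSubgroup.topologicalClosure_coe]
    exact hL.isSeparable.closure
  · refine hsc.trans ?_
    rw [AddSubgroup.topologicalClosure_coe]
    refine closure_mono fun x hx => ⟨Finsupp.single ⟨x, hx⟩ 1, by simp⟩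

theorem IsDecoupledSum.stronglyMeasurable_right (h : IsDecoupledSum μ ℱ f g) (n : ℕ) :
    StronglyMeasurable (g n) := by
  induction n with
  | zero => rw [h.g_zero]; exact stronglyMeasurable_zero
  | succ n ih =>
    have : g (n + 1) = g n + diffSeq g (n + 1) := by ext ω; simp [diffSeq]
    rw [this]
    exact ih.add (h.tangent.stronglyMeasurable (n + 1) (by omega))

variable {S : AddSubgroup E}

/-- The pair of sequences remains decoupled when its values are regarded as elements of a larger
group. -/
theorem IsDecoupledSum.coe_addSubgroup {f g : ℕ → Ω → S} (h : IsDecoupledSum μ ℱ f g) :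
    IsDecoupledSum μ ℱ (fun n ω => (f n ω : E)) (fun n ω => (g n ω : E)) where
  filtration_zero := h.filtration_zero
  adapted n := continuous_subtype_val.comp_stronglyMeasurable (h.adapted n)
  f_zero := by ext ω; simp [h.f_zero]
  g_zero := by ext ω; simp [h.g_zero]
  tangent :=
    { stronglyMeasurable := fun n hn =>
        continuous_subtype_val.comp_stronglyMeasurable (h.tangent.stronglyMeasurable n hn)
      tangent := fun n hn B hB => h.tangent.tangent n hn _ (measurable_subtype_coe hB)
      condIndep := fun n hn B hB =>
        h.tangent.condIndep n hn (fun k => Subtype.val ⁻¹' B k)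
          fun k => measurable_subtype_coe (hB k) }

/-- A decoupled pair of sequences with values in a separable subgroup is decoupled there. -/
theorem IsDecoupledSum.codRestrict [SecondCountableTopology S] (h : IsDecoupledSum μ ℱ f g)
    (hf : ∀ n ω, f n ω ∈ S) (hg : ∀ n ω, g n ω ∈ S) :
    IsDecoupledSum μ ℱ (fun n ω => (⟨f n ω, hf n ω⟩ : S)) (fun n ω => (⟨g n ω, hg n ω⟩ : S)) where
  filtration_zero := h.filtration_zero
  adapted n := ((h.adapted n).measurable.subtype_mk).stronglyMeasurable
  f_zero := by ext ω; simp [h.f_zero]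
  g_zero := by ext ω; simp [h.g_zero]
  tangent :=
    { stronglyMeasurable := fun n hn =>
        (Measurable.subtype_mk (p := (· ∈ S)) (f := diffSeq g n)
          (h := fun ω => S.sub_mem (hg n ω) (hg (n - 1) ω))
          (h.tangent.stronglyMeasurable n hn).measurable).stronglyMeasurable
      tangent := fun n hn B hB => by
        obtain ⟨B', hB', rfl⟩ := hB
        exact h.tangent.tangent n hn B' hB'
      condIndep := fun n hn B hB => by
        choose B' hB' hBB using hB
        obtain rfl : (fun k => Subtype.val ⁻¹' B' k) = B := funext hBB
        exact h.tangent.condIndep n hn B' hB' }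

theorem BoundedDecoupling.addSubgroup (H : BoundedDecoupling E μ ℱ p D) (S : AddSubgroup E) :
    BoundedDecoupling S μ ℱ p D :=
  fun _ _ hfg hb n hn => H _ _ hfg.coe_addSubgroup hb n hn

theorem lintegral_phi_le [CompleteSpace E] [IsProbabilityMeasure μ] (hp : 0 < p) (hq : 0 < q)
    (hD : 1 ≤ D) (H : BoundedDecoupling E μ ℱ p D) (hfg : IsDecoupledSum μ ℱ f g)
    (hΦ : IsGrowthFunction q Φ) {N : ℕ} (hN : 1 ≤ N) :
    (∫⁻ ω, (Φ ‖f N ω‖₊ : ℝ≥0∞) ∂μ ≤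
      ENNReal.ofReal (phiConst p q D) * ∫⁻ ω, (Φ ‖g N ω‖₊ : ℝ≥0∞) ∂μ) ∧
    ∫⁻ ω, (Φ (supNorm f N ω) : ℝ≥0∞) ∂μ ≤
      ENNReal.ofReal (phiConst p q D) * ∫⁻ ω, (Φ (supNorm g N ω) : ℝ≥0∞) ∂μ := by
  obtain ⟨S, hSc, hSs, hS⟩ := exists_isClosed_addSubgroup_isSeparable
    (s := (⋃ n, Set.range (f n)) ∪ ⋃ n, Set.range (g n))
    ((TopologicalSpace.IsSeparable.iUnion fun n => (hfg.adapted n).isSeparable_range).union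
      (TopologicalSpace.IsSeparable.iUnion fun n =>
        (hfg.stronglyMeasurable_right n).isSeparable_range))
  have hf : ∀ n ω, f n ω ∈ S := fun n ω => hS (.inl (Set.mem_iUnion.2 ⟨n, ω, rfl⟩))
  have hg : ∀ n ω, g n ω ∈ S := fun n ω => hS (.inr (Set.mem_iUnion.2 ⟨n, ω, rfl⟩))
  have : CompleteSpace S := hSc.completeSpace_coe
  have : SecondCountableTopology S := hSs.secondCountableTopology
  have hfg' := hfg.codRestrict hf hg
  exact ⟨lintegral_phi_norm_le hp hq hD (H.addSubgroup S) hfg' hΦ hN,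
    lintegral_phi_supNorm_le hp hq hD (H.addSubgroup S) hfg' hΦ hN⟩

end Separable

/-! ### The normed group of an `r`-normable space. -/

section Renorming

variable {X : Type*} [AddCommGroup X] [Module ℝ X] [UniformSpace X] [QuasiBanachSpace X]

theorem qn_zero : qn (0 : X) = 0 := (QuasiBanachSpace.qnorm_eq_zero_iff _).2 rfl

theorem qn_neg (x : X) : qn (-x) = qn x := by
  have := QuasiBanachSpace.qnorm_smul (-1) x
  simpa using this

theorem IsRNormable.qn_add_rpow_le {r : ℝ} (hr : IsRNormable X r) (x y : X) :
    qn (x + y) ^ r ≤ qn x ^ r + qn y ^ r := by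
  simpa [Fin.sum_univ_two] using hr.2.2 2 ![x, y]

theorem uniformity_hasBasis_qn_rpow {r : ℝ} (hr : 0 < r) :
    (𝓤 X).HasBasis (fun ε : ℝ => 0 < ε)
      (fun ε => {z : X × X | ((qn (z.1 - z.2) ^ r : ℝ≥0) : ℝ) < ε}) := by
  refine QuasiBanachSpace.uniformity_basis.to_hasBasis (fun ε hε => ?_) (fun ε hε => ?_)
  · refine ⟨((ε ^ r : ℝ≥0) : ℝ), by positivity, fun z hz => ?_⟩
    exact (NNReal.rpow_lt_rpow_iff hr).1 (NNReal.coe_lt_coe.1 hz)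
  · lift ε to ℝ≥0 using hε.le
    have hε' : 0 < ε := by exact_mod_cast hε
    refine ⟨ε ^ (1 / r), by positivity, fun z hz => ?_⟩
    have : qn (z.1 - z.2) ^ r < (ε ^ (1 / r)) ^ r := NNReal.rpow_lt_rpow hz hr
    rw [← NNReal.rpow_mul, one_div_mul_cancel hr.ne', NNReal.rpow_one] at this
    exact_mod_cast this

/-- The translation invariant metric `‖x - y‖ ^ r` of an `r`-normable space. -/
@[reducible]
noncomputable def rMetricSpace {r : ℝ} (hr : IsRNormable X r) : MetricSpace X :=
  let m : MetricSpace X :=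
    { dist := fun x y => ((qn (x - y) ^ r : ℝ≥0) : ℝ)
      dist_self := fun x => by simp [qn_zero, NNReal.zero_rpow hr.1.ne']
      dist_comm := fun x y => by rw [← qn_neg, neg_sub]
      dist_triangle := fun x y z => by
        rw [← sub_add_sub_cancel x y z]
        exact_mod_cast hr.qn_add_rpow_le _ _
      eq_of_dist_eq_zero := fun {x y} h => by
        have h' : qn (x - y) ^ r = 0 := by exact_mod_cast h
        rw [NNReal.rpow_eq_zero hr.1.ne'] at h'
        exact sub_eq_zero.1 ((QuasiBanachSpace.qnorm_eq_zero_iff _).1 h') }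
  m.replaceUniformity
    ((uniformity_hasBasis_qn_rpow hr.1).eq_of_same_basis
      (@Metric.uniformity_basis_dist X m.toPseudoMetricSpace))

/-- An `r`-normable quasi-Banach space is a normed group under `x ↦ ‖x‖ ^ r`, with the same
uniform structure. -/
@[reducible]
noncomputable def rNormedAddCommGroup {r : ℝ} (hr : IsRNormable X r) : NormedAddCommGroup X :=
  { ‹AddCommGroup X›, rMetricSpace hr with
    norm := fun x => ((qn x ^ r : ℝ≥0) : ℝ)
    dist_eq := fun x y => by
      change ((qn (x - y) ^ r : ℝ≥0) : ℝ) = ((qn (-x + y) ^ r : ℝ≥0) : ℝ)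
      rw [← qn_neg, neg_sub, sub_eq_neg_add] }

end Renorming

/-! ### `L^p` norms as integrals of powers. -/

section LpNorm

variable {Ω : Type*} {mΩ : MeasurableSpace Ω} {μ : Measure Ω}

theorem eLpNorm_coe_nnreal {p : ℝ} (hp : 0 < p) (h : Ω → ℝ≥0) :
    eLpNorm (fun ω => (h ω : ℝ)) (ENNReal.ofReal p) μ =
      (∫⁻ ω, ((h ω ^ p : ℝ≥0) : ℝ≥0∞) ∂μ) ^ (1 / p) := by
  rw [eLpNorm_eq_lintegral_rpow_enorm_toReal (by simpa using hp) (by simp),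
    ENNReal.toReal_ofReal hp.le]
  congr 1
  refine lintegral_congr fun ω => ?_
  rw [ENNReal.coe_rpow_of_nonneg _ hp.le]
  congr 1
  simp

theorem eLpNorm_coe_nnreal_le_iff {p D : ℝ} (hp : 0 < p) (hD : 0 ≤ D) (h k : Ω → ℝ≥0) :
    eLpNorm (fun ω => (h ω : ℝ)) (ENNReal.ofReal p) μ ≤
        ENNReal.ofReal D * eLpNorm (fun ω => (k ω : ℝ)) (ENNReal.ofReal p) μ ↔
      ∫⁻ ω, ((h ω ^ p : ℝ≥0) : ℝ≥0∞) ∂μ ≤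
        ENNReal.ofReal (D ^ p) * ∫⁻ ω, ((k ω ^ p : ℝ≥0) : ℝ≥0∞) ∂μ := by
  rw [eLpNorm_coe_nnreal hp, eLpNorm_coe_nnreal hp, ← ENNReal.rpow_le_rpow_iff hp,
    ENNReal.mul_rpow_of_nonneg _ _ hp.le, ← ENNReal.rpow_mul, ← ENNReal.rpow_mul,
    one_div_mul_cancel hp.ne', ENNReal.rpow_one, ENNReal.rpow_one,
    ENNReal.ofReal_rpow_of_nonneg hD hp.le]

end LpNorm

/-! ### Transfer between the quasi-norm and its `r`-th power. -/

section Transfer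

variable {X : Type v} [AddCommGroup X] [Module ℝ X] [UniformSpace X]
    [QuasiBanachSpace X] [MeasurableSpace X] [BorelSpace X] {r p q D : ℝ}

theorem IsGrowthFunction.comp_rpow_inv {Φ : ℝ≥0 → ℝ≥0} (hΦ : IsGrowthFunction q Φ) (hr : 0 < r) :
    IsGrowthFunction (q / r) fun t => Φ (t ^ (1 / r)) where
  continuous := hΦ.continuous.comp (NNReal.continuous_rpow_const (by positivity))
  monotone := fun s t hst => hΦ.monotone (NNReal.rpow_le_rpow hst (by positivity))
  map_zero := by rw [NNReal.zero_rpow (by positivity), hΦ.map_zero]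
  growth := fun s t hs => by
    rw [NNReal.mul_rpow]
    refine (hΦ.growth _ _ (NNReal.one_le_rpow hs (by positivity))).trans (le_of_eq ?_)
    rw [← NNReal.rpow_mul, one_div_mul_eq_div]

/-- The `p`-th power of the quasi-norm is the `p / r`-th power of the new norm, and `D ^ p = (D ^ r)
^ (p / r)`. Boundedness supplies the `L^p` membership required by the hypothesis. -/
theorem DecouplingWith.boundedDecoupling (hr : IsRNormable X r) (hp : 0 < p) (hD : 0 ≤ D)
    (H : DecouplingWith.{u, v} X p D) {Ω : Type u} {mΩ : MeasurableSpace Ω} (μ : Measure Ω)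
    [IsProbabilityMeasure μ] [μ.IsComplete] (ℱ : Filtration ℕ mΩ) :
    letI := rNormedAddCommGroup hr
    BoundedDecoupling X μ ℱ (p / r) (D ^ r) := by
  let _ := rNormedAddCommGroup hr
  have hr0 := hr.1
  have hnn : ∀ x : X, ‖x‖ = ((qn x ^ r : ℝ≥0) : ℝ) := fun x => rfl
  have hqn : ∀ x : X, (qn x : ℝ) = ‖x‖ ^ (1 / r) := fun x => by
    rw [hnn, ← NNReal.coe_rpow, ← NNReal.rpow_mul, mul_one_div_cancel hr0.ne', NNReal.rpow_one]
  have hpow : ∀ x : X, ENNReal.ofReal (‖x‖ ^ (p / r)) = ((qn x ^ p : ℝ≥0) : ℝ≥0∞) := fun x => by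
    rw [hnn, ← NNReal.coe_rpow, ENNReal.ofReal_coe_nnreal, ← NNReal.rpow_mul,
      mul_div_cancel₀ _ hr0.ne']
  intro f g hfg hb n hn
  simp only [hpow]
  rw [← Real.rpow_mul hD, mul_div_cancel₀ _ hr0.ne']
  rw [← eLpNorm_coe_nnreal_le_iff hp hD]
  refine H Ω mΩ μ ℱ f g hfg (fun k _ => ?_) n hn
  obtain ⟨C, hC⟩ := hb k
  have hf : StronglyMeasurable (f k) := (hfg.adapted k).mono (ℱ.le k)
  refine MemLp.of_bound (C := C ^ (1 / r)) ?_ (ae_of_all _ fun ω => ?_)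
  · simp only [hqn]
    exact ((Real.continuous_rpow_const (by positivity)).comp_stronglyMeasurable
      hf.norm).aestronglyMeasurable
  · rw [NNReal.norm_eq, hqn]
    exact Real.rpow_le_rpow (norm_nonneg _) (hC ω) (by positivity)

theorem DecouplingWith.phiDecouplingWith (hr : IsRNormable X r) (hp : 0 < p) (hq : 0 < q)
    (hD : 1 ≤ D) (H : DecouplingWith.{u, v} X p D) {Φ : ℝ≥0 → ℝ≥0} (hΦ : IsGrowthFunction q Φ) :
    PhiDecouplingWith.{u, v} X Φ (phiConst (p / r) (q / r) (D ^ r)) := by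
  intro Ω mΩ μ _ _ ℱ f g hfg n hn
  have hr0 := hr.1
  have hB := H.boundedDecoupling hr hp (by linarith) μ ℱ
  let _ := rNormedAddCommGroup hr
  have : CompleteSpace X := QuasiBanachSpace.complete
  have hΨ : ∀ t : ℝ≥0, (t ^ r) ^ (1 / r) = t := fun t => by
    rw [← NNReal.rpow_mul, mul_one_div_cancel hr0.ne', NNReal.rpow_one]
  have hqn : ∀ x : X, ‖x‖₊ ^ (1 / r) = qn x := fun x => hΨ (qn x)
  have hmax : ∀ (h : ℕ → Ω → X) (ω : Ω), supNorm h n ω ^ (1 / r) = maxFn h n ω := fun h ω => by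
    rw [← hΨ (maxFn h n ω)]
    congr 1
    exact (Finset.apply_sup_eq_sup_comp_of_linearOrder (fun t : ℝ≥0 => t ^ r)
      (NNReal.monotone_rpow_of_nonneg hr0.le) (NNReal.zero_rpow hr0.ne')).symm
  have := lintegral_phi_le (by positivity) (by positivity) (Real.one_le_rpow hD hr0.le) hB hfg
    (hΦ.comp_rpow_inv hr0) hn
  simpa only [hqn, hmax] using this

end Transfer

/-! ### The best constant. -/

section BestConstant

variable {X : Type v} [AddCommGroup X] [Module ℝ X] [UniformSpace X]
    [QuasiBanachSpace X] [MeasurableSpace X] {p q D K : ℝ}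

theorem DecouplingWith.mono {D' : ℝ} (H : DecouplingWith.{u, v} X p D) (hD : D ≤ D') :
    DecouplingWith.{u, v} X p D' := fun Ω mΩ μ _ _ ℱ f g hfg hf n hn =>
  (H Ω mΩ μ ℱ f g hfg hf n hn).trans (by gcongr)

theorem PhiDecouplingWith.mono {Φ : ℝ≥0 → ℝ≥0} {K' : ℝ} (H : PhiDecouplingWith.{u, v} X Φ K)
    (hK : K ≤ K') : PhiDecouplingWith.{u, v} X Φ K' := fun Ω mΩ μ _ _ ℱ f g hfg n hn =>
  ⟨(H Ω mΩ μ ℱ f g hfg n hn).1.trans (by gcongr), (H Ω mΩ μ ℱ f g hfg n hn).2.trans (by gcongr)⟩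

theorem isGrowthFunction_rpow (hq : 0 < q) : IsGrowthFunction q fun t : ℝ≥0 => t ^ q where
  continuous := NNReal.continuous_rpow_const hq.le
  monotone := NNReal.monotone_rpow_of_nonneg hq.le
  map_zero := NNReal.zero_rpow hq.ne'
  growth := fun _ _ _ => NNReal.mul_rpow.le

theorem PhiDecouplingWith.decouplingWith (hq : 0 < q) (hK : 0 ≤ K)
    (H : PhiDecouplingWith.{u, v} X (fun t => t ^ q) K) :
    DecouplingWith.{u, v} X q (K ^ (1 / q)) := fun Ω mΩ μ _ _ ℱ f g hfg _ n hn => by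
  rw [eLpNorm_coe_nnreal_le_iff hq (by positivity), ← Real.rpow_mul hK, one_div_mul_cancel hq.ne',
    Real.rpow_one]
  exact (H Ω mΩ μ ℱ f g hfg n hn).1

theorem IsBanach.isRNormable_one (h : IsBanach X) : IsRNormable X 1 := by
  refine ⟨one_pos, le_rfl, fun n x => ?_⟩
  simp only [NNReal.rpow_one]
  exact Finset.le_sum_of_subadditive _ qn_zero.le h _ _

/-- A constant sequence on a one-point space is its own decoupled sum sequence. -/
theorem isDecoupledSum_const (x : X) :
    IsDecoupledSum (Measure.dirac PUnit.unit.{u + 1}) (⊥ : Filtration ℕ PUnit.instMeasurableSpace.{u})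
      (fun n _ => if n = 0 then 0 else x) (fun n _ => if n = 0 then 0 else x) := by
  have hce : ∀ s : Set PUnit.{u + 1},
      (Measure.dirac PUnit.unit.{u + 1})⟦s | ⨆ k, (⊥ : Filtration ℕ PUnit.instMeasurableSpace.{u}) k⟧ =
        s.indicator fun _ => (1 : ℝ) := fun s => by
    refine condExp_of_stronglyMeasurable (iSup_le (Filtration.le _))
      (stronglyMeasurable_const' fun a b => by rw [Subsingleton.elim a b]) ?_
    exact (integrable_const _).indicator .of_discrete
  refine ⟨rfl, fun n => stronglyMeasurable_const, by ext; simp, by ext; simp,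
    ⟨fun n _ => stronglyMeasurable_const' fun a b => by rw [Subsingleton.elim a b],
      fun n _ B _ => ?_, fun n _ B _ => ?_⟩⟩
  · have : (⨆ k, (⊥ : Filtration ℕ PUnit.instMeasurableSpace.{u}) k) = (⊥ : MeasurableSpace PUnit.{u + 1}) :=
      iSup_eq_bot.2 fun _ => rfl
    rw [this]
    exact Filter.EventuallyEq.rfl
  · simp only [hce]
    refine Filter.Eventually.of_forall fun ω => ?_
    classical
    simp only [Set.indicator_apply, Set.mem_iInter]
    rw [Finset.prod_ite_zero, Finset.prod_const_one]

/-- Test on a nonzero constant sequence, which is its own decoupled sum sequence. The choice of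
`decoupledRatio` relies on `1 ≤ D`. -/
theorem DecouplingWith.one_le [Nontrivial X] (hp : 0 < p)
    (H : DecouplingWith.{u, v} X p D) : 1 ≤ D := by
  obtain ⟨x, hx⟩ := exists_ne (0 : X)
  have : (Measure.dirac PUnit.unit.{u + 1}).IsComplete := ⟨fun _ _ => .of_discrete⟩
  have h := H _ _ _ _ _ _ (isDecoupledSum_const x)
    (fun n _ => memLp_const _) 1 le_rfl
  have hx0 : 0 < qn x := pos_iff_ne_zero.2 fun h0 =>
    hx ((QuasiBanachSpace.qnorm_eq_zero_iff x).1 h0)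
  have hne : ENNReal.ofReal p ≠ 0 := by simpa using hp
  simp only [one_ne_zero, if_false] at h
  rw [eLpNorm_const _ hne (NeZero.ne _), measure_univ, ENNReal.one_rpow, mul_one] at h
  have h1 : (1 : ℝ≥0∞) * ‖(qn x : ℝ)‖ₑ ≤ ENNReal.ofReal D * ‖(qn x : ℝ)‖ₑ := by rwa [one_mul]
  rw [ENNReal.mul_le_mul_iff_left (by simpa using hx0.ne') (by simp)] at h1
  simpa using h1

/-- Every larger constant is admissible, and the right-hand side is continuous in the constant even
if the norm of `g n` is infinite, because the infimum is at least `1`. -/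
theorem DecouplingHolds.decouplingWith_decouplingConst [Nontrivial X] (hp : 0 < p)
    (H : DecouplingHolds.{u, v} X p) :
    DecouplingWith.{u, v} X p (decouplingConst.{u, v} X p) ∧ 1 ≤ decouplingConst.{u, v} X p := by
  obtain ⟨D, hD⟩ := H
  have hne : {D : ℝ | 0 ≤ D ∧ DecouplingWith.{u, v} X p D}.Nonempty :=
    ⟨max D 0, le_max_right _ _, hD.mono (le_max_left _ _)⟩
  have h1 : 1 ≤ decouplingConst.{u, v} X p := le_csInf hne fun D h => h.2.one_le hp
  refine ⟨fun Ω mΩ μ _ _ ℱ f g hfg hf n hn => ?_, h1⟩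
  have hlim : Filter.Tendsto (fun D => ENNReal.ofReal D *
      eLpNorm (fun ω => (qn (g n ω) : ℝ)) (ENNReal.ofReal p) μ)
      (nhdsWithin (decouplingConst.{u, v} X p) (Set.Ioi (decouplingConst.{u, v} X p)))
      (nhds (ENNReal.ofReal (decouplingConst.{u, v} X p) *
        eLpNorm (fun ω => (qn (g n ω) : ℝ)) (ENNReal.ofReal p) μ)) :=
    ENNReal.Tendsto.mul_const
      ((ENNReal.continuous_ofReal.tendsto _).mono_left nhdsWithin_le_nhds)
      (Or.inl (by simp; linarith))
  refine ge_of_tendsto hlim (Filter.eventually_of_mem self_mem_nhdsWithin fun D hD => ?_)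
  obtain ⟨D', hD', hlt⟩ := exists_lt_of_csInf_lt hne hD
  exact (hD'.2.mono hlt.le) Ω mΩ μ ℱ f g hfg hf n hn

theorem decouplingConst_nonneg : 0 ≤ decouplingConst.{u, v} X p :=
  Real.sInf_nonneg fun _ h => h.1

theorem DecouplingWith.decouplingConst_le (hD : 0 ≤ D) (H : DecouplingWith.{u, v} X p D) :
    decouplingConst.{u, v} X p ≤ D :=
  csInf_le ⟨0, fun _ h => h.1⟩ ⟨hD, H⟩

theorem qn_eq_zero_of_subsingleton [Subsingleton X] (x : X) : qn x = 0 := by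
  rw [Subsingleton.elim x 0, qn_zero]

theorem phiDecouplingWith_of_subsingleton [Subsingleton X] {Φ : ℝ≥0 → ℝ≥0} (hΦ : Φ 0 = 0) :
    PhiDecouplingWith.{u, v} X Φ K := fun Ω mΩ μ _ _ ℱ f g _ n _ => by
  have : (Finset.Icc 1 n).sup (fun _ => (0 : ℝ≥0)) = 0 := Finset.sup_bot _
  simp [maxFn, qn_eq_zero_of_subsingleton, hΦ, this]

end BestConstant

end Decoupling

/-! ### Conclusion. -/

theorem theorem4p1 {X : Type v} [AddCommGroup X] [Module ℝ X] [UniformSpace X]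
    [QuasiBanachSpace X] [MeasurableSpace X] [BorelSpace X] (r p : ℝ)
    (hr : Decoupling.IsRNormable X r) (hp : 0 < p)
    (hX : Decoupling.DecouplingHolds.{u, v} X p) :
    (∀ q : ℝ, 0 < q → ∃ K : ℝ, ∀ Φ : ℝ≥0 → ℝ≥0, Decoupling.IsGrowthFunction q Φ →
      Decoupling.PhiDecouplingWith.{u, v} X Φ K) ∧
    (∀ q : ℝ, 0 < q → Decoupling.DecouplingHolds.{u, v} X q) ∧
    (Decoupling.IsBanach X → 1 ≤ p → ∀ q : ℝ, 0 < q →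
      (∀ Φ : ℝ≥0 → ℝ≥0, Decoupling.IsGrowthFunction q Φ →
        Decoupling.PhiDecouplingWith.{u, v} X Φ
          (Real.exp q * 2 ^ (3 * q / p + p + 7 * q + 7) *
            Decoupling.decouplingConst.{u, v} X p ^ q * (q / p) ^ q)) ∧
      Decoupling.decouplingConst.{u, v} X q ≤
        Real.exp 1 * 2 ^ (3 / p + p / q + 7 + 7 / q) *
          Decoupling.decouplingConst.{u, v} X p * (q / p)) := by
  have hphi : ∀ q : ℝ, 0 < q → ∃ K : ℝ, ∀ Φ : ℝ≥0 → ℝ≥0, Decoupling.IsGrowthFunction q Φ →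
      Decoupling.PhiDecouplingWith.{u, v} X Φ K := fun q hq => by
    obtain ⟨D, hD⟩ := hX
    exact ⟨_, fun Φ hΦ =>
      (hD.mono (le_max_left D 1)).phiDecouplingWith hr hp hq (le_max_right _ _) hΦ⟩
  refine ⟨hphi, fun q hq => ?_, fun hB _ q hq => ?_⟩
  · obtain ⟨K, hK⟩ := hphi q hq
    exact ⟨_, Decoupling.PhiDecouplingWith.decouplingWith hq (le_max_right K 0)
      ((hK _ (Decoupling.isGrowthFunction_rpow hq)).mono (le_max_left K 0))⟩
  · have hphi' : ∀ Φ : ℝ≥0 → ℝ≥0, Decoupling.IsGrowthFunction q Φ →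
        Decoupling.PhiDecouplingWith.{u, v} X Φ
          (Real.exp q * 2 ^ (3 * q / p + p + 7 * q + 7) *
            Decoupling.decouplingConst.{u, v} X p ^ q * (q / p) ^ q) := fun Φ hΦ => by
      -- In the zero space the bound `1 ≤ D` is unavailable, but both sides of the inequalities
      -- vanish.
      rcases subsingleton_or_nontrivial X with _ | _
      · exact Decoupling.phiDecouplingWith_of_subsingleton hΦ.map_zero
      · obtain ⟨hD, hD1⟩ := hX.decouplingWith_decouplingConst hp
        have := hD.phiDecouplingWith hB.isRNormable_one hp hq hD1 hΦ
        rw [div_one, div_one, Real.rpow_one] at this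
        exact this.mono (Decoupling.phiConst_le hp hq hD1)
    refine ⟨hphi', ?_⟩
    have hD0 : 0 ≤ Decoupling.decouplingConst.{u, v} X p := Decoupling.decouplingConst_nonneg
    refine (Decoupling.DecouplingWith.decouplingConst_le (by positivity)
      (Decoupling.PhiDecouplingWith.decouplingWith hq (by positivity)
        (hphi' _ (Decoupling.isGrowthFunction_rpow hq)))).trans (le_of_eq ?_)
    have hpow : ∀ t : ℝ, 0 ≤ t → (t ^ q) ^ (1 / q) = t := fun t ht => by
      rw [← Real.rpow_mul ht, mul_one_div_cancel hq.ne', Real.rpow_one]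
    rw [Real.mul_rpow (by positivity) (by positivity), Real.mul_rpow (by positivity) (by positivity),
      Real.mul_rpow (by positivity) (by positivity), hpow _ hD0, hpow _ (by positivity),
      ← Real.exp_mul, ← Real.rpow_mul (by norm_num), mul_one_div_cancel hq.ne']
    congr 4
    field_simp
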